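/- Let $n\ge 1$, let $\Omega=\prod_{i=1}^n(a_i,b_i)\subset\mathbb R^n$ be an open cuboid, and let $\Omega_1$ be a nonempty open set with $\overline{\Omega_1}\subset\Omega$ and with boundary of class $C^3$; put $\Omega_2=\Omega\setminus\overline{\Omega_1}$. Let $\alpha,\beta,\gamma>0$ be constants, $q,h\in L^2(\Omega)$ and $g\in H^1(\Omega)$. Let $r$ be the signed distance function to $\partial\Omega_1$, positive in $\Omega_1$ and negative outside $\overline{\Omega_1}$. Put $$D_0=\chi_{\Omega_1}+\alpha\chi_{\Omega_2},\qquad c_0=\gamma\chi_{\Omega_1}+\beta\chi_{\Omega_2},\qquad f_0=q\chi_{\Omega_1}+h\chi_{\Omega_2},$$ and, for $\varepsilon\in(0,1)$, $$\phi_\varepsilon=\tfrac12\bigl[1+\tanh(r/\varepsilon)\bigr],\quad D_\varepsilon=\alpha+(1-\alpha)\phi_\varepsilon,\quad c_\varepsilon=\beta+(\gamma-\beta)\phi_\varepsilon,\quad f_\varepsilon=h+(q-h)\phi_\varepsilon .$$ (1) There is a unique weak solution $u_0\in H^1(\Omega)$ of the two-sided problem (with $\kappa=0$) $$-\Delta u_1+\gamma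 u_1=q\ \text{in }\Omega_1,\qquad -\alpha\Delta u_2+\beta u_2=h\ \text{in }\Omega_2,$$ $$u_1=u_2\ \text{ and }\ -\nabla(u_1-\alpha u_2)\cdot\boldsymbol n_1=g\ \text{on }\partial\Omega_1,\qquad \alpha\nabla u_2\cdot\boldsymbol n_2=0\ \text{on }\partial\Omega,$$ where $u_i=u_0|_{\Omega_i}$ and $\boldsymbol n_1,\boldsymbol n_2$ are the outward unit normals of $\Omega_1$ and $\Omega$; that is, with $g,v$ on $\partial\Omega_1$ understood as traces and $dS$ the surface measure, $$\int_\Omega (D_0\nabla u_0\cdot\nabla v+c_0u_0v)\,dx+\int_{\partial\Omega_1}g v\,dS=\int_\Omega f_0v\,dx\qquad\text{for all }v\in H^1(\Omega).$$ (2) For each $\varepsilon\in(0,1)$ there is a unique weak solution $u_\varepsilon\in H^1(\Omega)$ of the diffuse domain problem (with $\kappa=0$) $$-\nabla\cdot(D_\varepsilon\nabla u_\varepsilon)+c_\varepsilon u_\varepsilon+g|\nabla\phi_\varepsilon|=f_\varepsilon\ \text{in }\Omega,\qquad D_\varepsilon\nabla u_\varepsilon\cdot\boldsymbol n_2=0\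 \text{on }\partial\Omega,$$ that is, $$\int_\Omega (D_\varepsilon\nabla u_\varepsilon\cdot\nabla v+c_\varepsilon u_\varepsilon v+g|\nabla\phi_\varepsilon|v)\,dx=\int_\Omega f_\varepsilon v\,dx\qquad\text{for all }v\in H^1(\Omega).$$ (3) For every sequence $(\varepsilon_k)\subset(0,1)$ with $\varepsilon_k\to0$ there is a subsequence $(\varepsilon_{k_j})$ such that $u_{\varepsilon_{k_j}}\to u_0$ strongly in $H^1(\Omega)$ as $j\to\infty$. -/

import Mathlib

open MeasureTheory Set Filter Topology
open scoped ContDiff RealInnerProductSpace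

noncomputable section

namespace DiffuseDomain

/-- `ℝⁿ` with the Euclidean norm. -/
abbrev Rn (n : ℕ) : Type := EuclideanSpace ℝ (Fin n)

/-- The open cuboid `∏ (aᵢ, bᵢ)`. -/
def cuboid {n : ℕ} (a b : Fin n → ℝ) : Set (Rn n) :=
  {x | ∀ i, a i < x i ∧ x i < b i}

/-- The set `U` has a boundary of class `C³`: near each boundary point, `U` is the sublevel set
`{ρ < 0}` of a `C³` function `ρ` whose differential does not vanish at the point (in particular `U`
lies locally on one side of its boundary). -/
def HasC3Boundary {n : ℕ} (U : Set (Rn n)) : Prop :=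
  ∀ x ∈ frontier U, ∃ (V : Set (Rn n)) (ρ : Rn n → ℝ),
    IsOpen V ∧ x ∈ V ∧ ContDiffOn ℝ 3 ρ V ∧ fderiv ℝ ρ x ≠ 0 ∧ U ∩ V = {y ∈ V | ρ y < 0}

/-! ### The spaces `L²(Ω)` and `H¹(Ω)` -/

/-- Real functions in `L²(Ω)`. -/
abbrev L2 {n : ℕ} (Ω : Set (Rn n)) : Type :=
  Lp ℝ 2 ((volume : Measure (Rn n)).restrict Ω)

/-- Vector fields in `L²(Ω; ℝⁿ)`. -/
abbrev L2Vec {n : ℕ} (Ω : Set (Rn n)) : Type :=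
  Lp (Rn n) 2 ((volume : Measure (Rn n)).restrict Ω)

/-- `G` is the weak gradient of `u` on `Ω`:
`∫_Ω u ∂ᵢψ = - ∫_Ω Gᵢ ψ` for all `i` and all `ψ ∈ C_c^∞(Ω)`. -/
def IsWeakGradient {n : ℕ} (Ω : Set (Rn n)) (u : Rn n → ℝ) (G : Rn n → Rn n) : Prop :=
  ∀ ψ : Rn n → ℝ, ContDiff ℝ ∞ ψ → HasCompactSupport ψ → tsupport ψ ⊆ Ω →
    ∀ i : Fin n,
      ∫ x in Ω, u x * fderiv ℝ ψ x (EuclideanSpace.single i 1) = -∫ x in Ω, G x i * ψ x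

theorem integrable_mul_of_continuous {n : ℕ} {Ω : Set (Rn n)} (u : L2 Ω) {ψ : Rn n → ℝ}
    (hc : Continuous ψ) (hs : HasCompactSupport ψ) :
    Integrable (fun x => u x * ψ x) (volume.restrict Ω) := by
  have hψ : MemLp ψ 2 (volume.restrict Ω) := hc.memLp_of_hasCompactSupport hs
  exact (Lp.memLp u).integrable_mul hψ

theorem integrable_coord_mul {n : ℕ} {Ω : Set (Rn n)} (G : L2Vec Ω) (i : Fin n) {ψ : Rn n → ℝ}
    (hc : Continuous ψ) (hs : HasCompactSupport ψ) :
    Integrable (fun x => G x i * ψ x) (volume.restrict Ω) := by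
  have hG : MemLp (fun x => G x i) 2 (volume.restrict Ω) :=
    (EuclideanSpace.proj i : Rn n →L[ℝ] ℝ).comp_memLp' (Lp.memLp G)
  have hψ : MemLp ψ 2 (volume.restrict Ω) := hc.memLp_of_hasCompactSupport hs
  exact hG.integrable_mul hψ

theorem continuous_partial {n : ℕ} {ψ : Rn n → ℝ} (hψ : ContDiff ℝ ∞ ψ) (e : Rn n) :
    Continuous fun x => fderiv ℝ ψ x e :=
  (hψ.continuous_fderiv (by simp)).clm_apply continuous_const

theorem hasCompactSupport_partial {n : ℕ} {ψ : Rn n → ℝ} (hs : HasCompactSupport ψ) (e : Rn n) :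
    HasCompactSupport fun x => fderiv ℝ ψ x e :=
  hs.fderiv_apply (𝕜 := ℝ) e

/-- The Sobolev space `H¹(Ω)`, realised as the space of pairs `(u, ∇u)` with `u ∈ L²(Ω)` and weak
gradient `∇u ∈ L²(Ω; ℝⁿ)`, with the norm `(‖u‖² + ‖∇u‖²)^{1/2}` inherited from the `ℓ²`-product. -/
def H1Submodule {n : ℕ} (Ω : Set (Rn n)) : Submodule ℝ (WithLp 2 (L2 Ω × L2Vec Ω)) where
  carrier := {w | IsWeakGradient Ω w.fst w.snd}
  zero_mem' := by
    intro ψ _ _ _ i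
    have h1 : ((0 : WithLp 2 (L2 Ω × L2Vec Ω)).fst : Rn n → ℝ) =ᵐ[volume.restrict Ω] 0 :=
      Lp.coeFn_zero _ _ _
    have h2 : ((0 : WithLp 2 (L2 Ω × L2Vec Ω)).snd : Rn n → Rn n) =ᵐ[volume.restrict Ω] 0 :=
      Lp.coeFn_zero _ _ _
    rw [integral_eq_zero_of_ae, integral_eq_zero_of_ae, neg_zero]
    · filter_upwards [h2] with x hx
      rw [hx]
      simp
    · filter_upwards [h1] with x hx
      rw [hx]
      simp
  add_mem' := by
    intro v w hv hw ψ hψ hs ht i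
    have h1 : ((v + w).fst : Rn n → ℝ) =ᵐ[volume.restrict Ω] v.fst + w.fst := Lp.coeFn_add _ _
    have h2 : ((v + w).snd : Rn n → Rn n) =ᵐ[volume.restrict Ω] v.snd + w.snd := Lp.coeFn_add _ _
    have hc := continuous_partial hψ (EuclideanSpace.single i 1)
    have hcs := hasCompactSupport_partial hs (EuclideanSpace.single i 1)
    have e1 : ∫ x in Ω, (v + w).fst x * fderiv ℝ ψ x (EuclideanSpace.single i 1) =
        ∫ x in Ω, (v.fst x * fderiv ℝ ψ x (EuclideanSpace.single i 1) +
          w.fst x * fderiv ℝ ψ x (EuclideanSpace.single i 1)) := by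
      refine integral_congr_ae ?_
      filter_upwards [h1] with x hx
      rw [hx, Pi.add_apply, add_mul]
    have e2 : ∫ x in Ω, (v + w).snd x i * ψ x =
        ∫ x in Ω, (v.snd x i * ψ x + w.snd x i * ψ x) := by
      refine integral_congr_ae ?_
      filter_upwards [h2] with x hx
      rw [hx, Pi.add_apply, PiLp.add_apply, add_mul]
    rw [e1, e2, integral_add (integrable_mul_of_continuous _ hc hcs)
      (integrable_mul_of_continuous _ hc hcs),
      integral_add (integrable_coord_mul _ i hψ.continuous hs)
      (integrable_coord_mul _ i hψ.continuous hs), hv ψ hψ hs ht i, hw ψ hψ hs ht i, neg_add]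
  smul_mem' := by
    intro c w hw ψ hψ hs ht i
    have h1 : ((c • w).fst : Rn n → ℝ) =ᵐ[volume.restrict Ω] c • ⇑w.fst := Lp.coeFn_smul _ _
    have h2 : ((c • w).snd : Rn n → Rn n) =ᵐ[volume.restrict Ω] c • ⇑w.snd := Lp.coeFn_smul _ _
    have e1 : ∫ x in Ω, (c • w).fst x * fderiv ℝ ψ x (EuclideanSpace.single i 1) =
        ∫ x in Ω, c * (w.fst x * fderiv ℝ ψ x (EuclideanSpace.single i 1)) := by
      refine integral_congr_ae ?_
      filter_upwards [h1] with x hx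
      rw [hx, Pi.smul_apply, smul_eq_mul, mul_assoc]
    have e2 : ∫ x in Ω, (c • w).snd x i * ψ x = ∫ x in Ω, c * (w.snd x i * ψ x) := by
      refine integral_congr_ae ?_
      filter_upwards [h2] with x hx
      rw [hx, Pi.smul_apply, PiLp.smul_apply, smul_eq_mul, mul_assoc]
    rw [e1, e2, integral_const_mul, integral_const_mul, hw ψ hψ hs ht i, mul_neg]

/-- The Hilbert space `H¹(Ω)`. -/
abbrev H1 {n : ℕ} (Ω : Set (Rn n)) : Type := H1Submodule Ω

/-- The function underlying an element of `H¹(Ω)`. -/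
def H1.fn {n : ℕ} {Ω : Set (Rn n)} (u : H1 Ω) : L2 Ω := u.1.fst

/-- The weak gradient of an element of `H¹(Ω)`. -/
def H1.grad {n : ℕ} {Ω : Set (Rn n)} (u : H1 Ω) : L2Vec Ω := u.1.snd

/-! ### Surface measure and trace on `∂Ω₁` -/

/-- The surface measure `dS` on `∂Ω₁`: the `(n-1)`-dimensional Hausdorff measure, normalised so
that it agrees with Lebesgue measure on `(n-1)`-dimensional planes, restricted to `∂Ω₁`. -/
def surfaceMeasure {n : ℕ} (Ω₁ : Set (Rn n)) : Measure (Rn n) :=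
  (Measure.euclideanHausdorffMeasure (n - 1)).restrict (frontier Ω₁)

/-- `τ ∈ L²(∂Ω₁)` is the trace of `u ∈ H¹(Ω)` on `∂Ω₁`: there are smooth functions on `ℝⁿ` that
converge to `u` in `H¹(Ω)` and whose restrictions to `∂Ω₁` converge to `τ` in `L²(∂Ω₁)`. -/
def IsTrace {n : ℕ} {Ω : Set (Rn n)} (Ω₁ : Set (Rn n)) (u : H1 Ω)
    (τ : Lp ℝ 2 (surfaceMeasure Ω₁)) : Prop :=
  ∃ ψ : ℕ → Rn n → ℝ, (∀ k, ContDiff ℝ ∞ (ψ k)) ∧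
    Tendsto (fun k => eLpNorm (fun x => ψ k x - u.fn x) 2 (volume.restrict Ω)) atTop (𝓝 0) ∧
    Tendsto (fun k => eLpNorm (fun x => gradient (ψ k) x - u.grad x) 2 (volume.restrict Ω))
      atTop (𝓝 0) ∧
    Tendsto (fun k => eLpNorm (fun x => ψ k x - τ x) 2 (surfaceMeasure Ω₁)) atTop (𝓝 0)

open Classical in
/-- The trace of `u ∈ H¹(Ω)` on `∂Ω₁` (the default `0` is never used when `∂Ω₁` is a `C³`
hypersurface inside the cuboid `Ω`, where the trace exists and is unique). -/
def trace {n : ℕ} {Ω : Set (Rn n)} (Ω₁ : Set (Rn n)) (u : H1 Ω) : Lp ℝ 2 (surfaceMeasure Ω₁) :=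
  if h : ∃ τ, IsTrace Ω₁ u τ then h.choose else 0

/-! ### The two-sided (sharp interface) problem with `κ = 0` -/

/-- `D₀ = χ_{Ω₁} + α χ_{Ω₂}`, `Ω₂ = Ω \ closure Ω₁`. -/
def D₀ {n : ℕ} (Ω Ω₁ : Set (Rn n)) (α : ℝ) (x : Rn n) : ℝ :=
  Ω₁.indicator (fun _ => 1) x + (Ω \ closure Ω₁).indicator (fun _ => α) x

/-- `c₀ = γ χ_{Ω₁} + β χ_{Ω₂}`. -/
def c₀ {n : ℕ} (Ω Ω₁ : Set (Rn n)) (β γ : ℝ) (x : Rn n) : ℝ :=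
  Ω₁.indicator (fun _ => γ) x + (Ω \ closure Ω₁).indicator (fun _ => β) x

/-- `f₀ = q χ_{Ω₁} + h χ_{Ω₂}`. -/
def f₀ {n : ℕ} (Ω Ω₁ : Set (Rn n)) (q h : Rn n → ℝ) (x : Rn n) : ℝ :=
  Ω₁.indicator q x + (Ω \ closure Ω₁).indicator h x

/-- `u ∈ H¹(Ω)` is a (weak) solution of the two-sided problem
`-Δu₁ + γu₁ = q` in `Ω₁`, `-αΔu₂ + βu₂ = h` in `Ω₂`, `u₁ = u₂` and `-∇(u₁ - αu₂)·n₁ = g` on `∂Ω₁`,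
`α∇u₂·n₂ = 0` on `∂Ω`. -/
def IsTwoSidedSolution {n : ℕ} (Ω Ω₁ : Set (Rn n)) (α β γ : ℝ) (q h : L2 Ω) (g u : H1 Ω) : Prop :=
  ∀ v : H1 Ω,
    (∫ x in Ω, (D₀ Ω Ω₁ α x * ⟪u.grad x, v.grad x⟫ + c₀ Ω Ω₁ β γ x * u.fn x * v.fn x)) +
      ∫ x, trace Ω₁ g x * trace Ω₁ v x ∂(surfaceMeasure Ω₁) =
    ∫ x in Ω, f₀ Ω Ω₁ q h x * v.fn x

/-! ### The diffuse domain problem with `κ = 0` -/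

open Classical in
/-- The signed distance to `∂Ω₁`, positive in `Ω₁` and negative outside `closure Ω₁`. -/
def signedDist {n : ℕ} (Ω₁ : Set (Rn n)) (x : Rn n) : ℝ :=
  if x ∈ Ω₁ then Metric.infDist x (frontier Ω₁) else -Metric.infDist x (frontier Ω₁)

/-- The phase field `φ_ε = ½ (1 + tanh (r / ε))`. -/
def phaseField {n : ℕ} (Ω₁ : Set (Rn n)) (ε : ℝ) (x : Rn n) : ℝ :=
  1 / 2 * (1 + Real.tanh (signedDist Ω₁ x / ε))

/-- `D_ε = α + (1 - α) φ_ε`. -/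
def Dε {n : ℕ} (Ω₁ : Set (Rn n)) (α ε : ℝ) (x : Rn n) : ℝ :=
  α + (1 - α) * phaseField Ω₁ ε x

/-- `c_ε = β + (γ - β) φ_ε`. -/
def cε {n : ℕ} (Ω₁ : Set (Rn n)) (β γ ε : ℝ) (x : Rn n) : ℝ :=
  β + (γ - β) * phaseField Ω₁ ε x

/-- `f_ε = h + (q - h) φ_ε`. -/
def fε {n : ℕ} (Ω₁ : Set (Rn n)) (q h : Rn n → ℝ) (ε : ℝ) (x : Rn n) : ℝ :=
  h x + (q x - h x) * phaseField Ω₁ ε x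

/-- `u ∈ H¹(Ω)` is a (weak) solution of the diffuse domain problem
`-∇·(D_ε ∇u) + c_ε u + g |∇φ_ε| = f_ε` in `Ω`, `D_ε ∇u·n₂ = 0` on `∂Ω`. The function `φ_ε` is
Lipschitz, so its classical gradient exists almost everywhere. -/
def IsDiffuseSolution {n : ℕ} (Ω Ω₁ : Set (Rn n)) (α β γ : ℝ) (q h : L2 Ω) (g : H1 Ω) (ε : ℝ)
    (u : H1 Ω) : Prop :=
  ∀ v : H1 Ω,
    ∫ x in Ω, (Dε Ω₁ α ε x * ⟪u.grad x, v.grad x⟫ + cε Ω₁ β γ ε x * u.fn x * v.fn x +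
      g.fn x * ‖gradient (phaseField Ω₁ ε) x‖ * v.fn x) =
    ∫ x in Ω, fε Ω₁ q h ε x * v.fn x

end DiffuseDomain

end

/-!
Both problems take the form `phaseEnergy φ u = load φ m`, where the phase `φ` is `χ_{Ω₁}` in the
sharp problem and `φ_ε` in the diffuse one. To bring the boundary terms to this form, extend the
inward unit normal of `∂Ω₁` to a compactly supported `C¹` field `X`. Then
`∫_{∂Ω₁} g v dS = -∫_Ω χ_{Ω₁} ∇·(g v X)` by the divergence theorem, and
`∫_Ω (∇φ_ε · X) g v = -∫_Ω φ_ε ∇·(g v X)` by integration by parts. Almost everywhere, `∇r(x)` is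
the value of `X` at a nearest boundary point `y`, and `|X(x) - X(y)|` is at most a multiple of
`|r(x)|`; so the remaining density `m = |∇φ_ε| - ∇φ_ε · X` is bounded by a multiple of
`t / (1 + t²)` with `t = |r| / ε`, hence uniformly in `ε`, and tends to `0` off `∂Ω₁`. By dominated
convergence the loads converge in the dual of `H¹(Ω)`, and so do the energies of any fixed function;
as the energies are uniformly coercive, the solutions converge strongly.
-/

noncomputable section

namespace DiffuseDomain

section FlatChart

variable {E : Type*} [NormedAddCommGroup E] [InnerProductSpace ℝ E]
  {U V : Set E} {y N N' e x : E} {θ R R' t : ℝ} {σ ρ : E → ℝ}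

/-- On the ball of radius `R` around the boundary point `y`, the set `U` is the sublevel set
`{σ < 0}` of a function `σ` that differs from the linear function `⟪N, ·⟫` by a function with
Lipschitz constant `θ`. -/
structure FlatChart (U : Set E) (y N : E) (θ R : ℝ) (σ : E → ℝ) : Prop where
  pos : 0 < R
  approx : ∀ x ∈ Metric.ball y R, ∀ x' ∈ Metric.ball y R,
    |σ x' - σ x - ⟪N, x' - x⟫| ≤ θ * ‖x' - x‖
  mem_iff : ∀ x ∈ Metric.ball y R, (x ∈ U ↔ σ x < 0)
  base : σ y = 0

/-- `N` is the outer unit normal of `U` at the boundary point `y`, in the strong sense that `U`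
looks like the half-space `{⟪N, · - y⟫ < 0}` near `y` up to functions of arbitrarily small
Lipschitz constant. -/
def IsNormal (U : Set E) (y N : E) : Prop :=
  ‖N‖ = 1 ∧ ∀ θ > 0, ∃ R σ, FlatChart U y N θ R σ

theorem FlatChart.mono (h : FlatChart U y N θ R σ) (hR' : 0 < R') (hle : R' ≤ R) :
    FlatChart U y N θ R' σ where
  pos := hR'
  approx x hx x' hx' :=
    h.approx x (Metric.ball_subset_ball hle hx) x' (Metric.ball_subset_ball hle hx')
  mem_iff x hx := h.mem_iff x (Metric.ball_subset_ball hle hx)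
  base := h.base

theorem FlatChart.abs_add_smul_sub_le (h : FlatChart U y N θ R σ) (hx : x ∈ Metric.ball y R)
    (ht : 0 ≤ t) (hxt : x + t • e ∈ Metric.ball y R) :
    |σ (x + t • e) - σ x - t * ⟪N, e⟫| ≤ t * (θ * ‖e‖) := by
  have := h.approx x hx _ hxt
  rwa [add_sub_cancel_left, inner_smul_right, norm_smul, Real.norm_of_nonneg ht,
    mul_left_comm] at this

theorem FlatChart.sub_smul_mem (h : FlatChart U y N θ R σ) (he : θ * ‖e‖ ≤ ⟪N, e⟫)
    (hx : x ∈ Metric.ball y R) (hxU : x ∈ U) (ht : 0 ≤ t) (hxt : x - t • e ∈ Metric.ball y R) :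
    x - t • e ∈ U := by
  rw [sub_eq_add_neg, ← smul_neg] at hxt ⊢
  rw [h.mem_iff _ hxt]
  have hσ := (abs_le.1 (h.abs_add_smul_sub_le hx ht hxt)).2
  rw [inner_neg_right, norm_neg] at hσ
  linarith [(h.mem_iff x hx).1 hxU, mul_le_mul_of_nonneg_left he ht]

theorem eq_zero_of_mem_frontier {X : Type*} [TopologicalSpace X] {U V : Set X} {ρ : X → ℝ} {y : X}
    (hV : V ∈ 𝓝 y) (hρ : ContinuousAt ρ y) (hU : ∀ x ∈ V, (x ∈ U ↔ ρ x < 0))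
    (hy : y ∈ frontier U) : ρ y = 0 := by
  rcases lt_trichotomy (ρ y) 0 with hneg | hzero | hpos
  · refine absurd (mem_interior_iff_mem_nhds.2 ?_) hy.2
    filter_upwards [hV, hρ.eventually (gt_mem_nhds hneg)] with x hxV hx using (hU x hxV).2 hx
  · exact hzero
  · obtain ⟨x, hxU, hxV, hx⟩ := ((mem_closure_iff_frequently.1 hy.1).and_eventually
      (Filter.Eventually.and hV (hρ.eventually (lt_mem_nhds hpos)))).exists
    exact absurd ((hU x hxV).1 hxU) (lt_asymm hx)

theorem isNormal_of_hasStrictFDerivAt {ν : E} (hV : V ∈ 𝓝 y)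
    (hρ : HasStrictFDerivAt ρ (innerSL ℝ ν) y) (hν : ν ≠ 0)
    (hU : ∀ x ∈ V, (x ∈ U ↔ ρ x < 0)) (hy : y ∈ frontier U) :
    IsNormal U y (‖ν‖⁻¹ • ν) := by
  have hpos : 0 < ‖ν‖ := norm_pos_iff.2 hν
  refine ⟨by rw [norm_smul, norm_inv, norm_norm, inv_mul_cancel₀ hpos.ne'], fun θ hθ => ?_⟩
  obtain ⟨s, hs, happrox⟩ := hρ.approximates_deriv_on_nhds (c := (θ * ‖ν‖).toNNReal)
    (Or.inr (Real.toNNReal_pos.2 (mul_pos hθ hpos)))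
  obtain ⟨R, hR, hball⟩ := Metric.mem_nhds_iff.1 (inter_mem hV hs)
  refine ⟨R, fun x => ‖ν‖⁻¹ * ρ x, hR, fun x hx x' hx' => ?_, fun x hx => ?_, ?_⟩
  · have hle := happrox x' (hball hx').2 x (hball hx).2
    rw [Real.coe_toNNReal _ (by positivity), innerSL_apply_apply, Real.norm_eq_abs] at hle
    rw [real_inner_smul_left, ← mul_sub, ← mul_sub, abs_mul, abs_of_pos (inv_pos.2 hpos),
      inv_mul_le_iff₀ hpos]
    linarith
  · rw [hU x (hball hx).1, ← smul_eq_mul, smul_neg_iff_of_pos_left (inv_pos.2 hpos)]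
  · rw [eq_zero_of_mem_frontier hV hρ.hasFDerivAt.continuousAt hU hy, mul_zero]

theorem eventually_add_smul_mem_ball (hR : 0 < R) :
    ∀ᶠ t : ℝ in 𝓝[>] 0, y + t • e ∈ Metric.ball y R := by
  have hlim : Tendsto (fun t : ℝ => y + t • e) (𝓝[>] 0) (𝓝 (y + (0 : ℝ) • e)) :=
    (Continuous.tendsto (by fun_prop) 0).mono_left nhdsWithin_le_nhds
  rw [zero_smul, add_zero] at hlim
  exact hlim (Metric.ball_mem_nhds y hR)

theorem IsNormal.eventually_mem (h : IsNormal U y N) (he : ⟪N, e⟫ < 0) :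
    ∀ᶠ t : ℝ in 𝓝[>] 0, y + t • e ∈ U := by
  obtain ⟨θ, hθ, hθe⟩ := exists_pos_mul_lt (neg_pos.2 he) ‖e‖
  obtain ⟨R, σ, hf⟩ := h.2 θ hθ
  filter_upwards [eventually_add_smul_mem_ball (y := y) (e := e) hf.pos, self_mem_nhdsWithin]
    with t ht (ht0 : 0 < t)
  have hσ := (abs_le.1 (hf.abs_add_smul_sub_le (Metric.mem_ball_self hf.pos) ht0.le ht)).2
  rw [hf.mem_iff _ ht]
  linarith [hf.base, mul_lt_mul_of_pos_left hθe ht0, mul_comm θ ‖e‖]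

theorem IsNormal.eventually_notMem (h : IsNormal U y N) (he : 0 < ⟪N, e⟫) :
    ∀ᶠ t : ℝ in 𝓝[>] 0, y + t • e ∉ U := by
  obtain ⟨θ, hθ, hθe⟩ := exists_pos_mul_lt he ‖e‖
  obtain ⟨R, σ, hf⟩ := h.2 θ hθ
  filter_upwards [eventually_add_smul_mem_ball (y := y) (e := e) hf.pos, self_mem_nhdsWithin]
    with t ht (ht0 : 0 < t)
  have hσ := (abs_le.1 (hf.abs_add_smul_sub_le (Metric.mem_ball_self hf.pos) ht0.le ht)).1
  rw [hf.mem_iff _ ht, not_lt]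
  linarith [hf.base, mul_lt_mul_of_pos_left hθe ht0, mul_comm θ ‖e‖]

theorem inner_sub_pos_of_ne {p q : E} (hp : ‖p‖ = 1) (hq : ‖q‖ = 1) (hne : p ≠ q) :
    0 < ⟪p, p - q⟫ := by
  have hlt : ⟪p, q⟫ < 1 := by
    refine lt_of_le_of_ne ?_ fun h => hne ((inner_eq_one_iff_of_norm_eq_one hp hq).1 h)
    simpa [hp, hq] using real_inner_le_norm p q
  rw [inner_sub_right, real_inner_self_eq_norm_sq, hp]
  linarith

theorem IsNormal.unique (h : IsNormal U y N) (h' : IsNormal U y N') : N = N' := by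
  by_contra hne
  have hneg : ⟪N', N - N'⟫ < 0 := by
    rw [← neg_sub N' N, inner_neg_right, neg_lt_zero]
    exact inner_sub_pos_of_ne h'.1 h.1 (Ne.symm hne)
  obtain ⟨t, ht, ht'⟩ := ((h.eventually_notMem (inner_sub_pos_of_ne h.1 h'.1 hne)).and
    (h'.eventually_mem hneg)).exists
  exact ht ht'

end FlatChart

section TranslationMonotone

variable {E : Type*} [NormedAddCommGroup E] [MeasurableSpace E] [BorelSpace E] {μ : Measure E}
  [μ.IsAddHaarMeasure] {U : Set E} {w : E → ℝ}

theorem setIntegral_comp_add_right {G : Type*} [AddGroup G] [MeasurableSpace G] [MeasurableAdd G]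
    {μ : Measure G} [μ.IsAddRightInvariant] {U : Set G} (hU : MeasurableSet U) (w : G → ℝ) (a : G) :
    ∫ x in U, w (x + a) ∂μ = ∫ x, U.indicator (fun _ => w x) (x - a) ∂μ := by
  rw [← integral_indicator hU, ← integral_sub_right_eq_self _ a]
  congr 1 with x
  by_cases hx : x - a ∈ U <;> simp [hx]

theorem setIntegral_le_setIntegral_comp_add_right (hU : MeasurableSet U) (hw : Continuous w)
    (hwc : HasCompactSupport w) (hw0 : ∀ x, 0 ≤ w x) {a : E}
    (hmem : ∀ x ∈ U, x ∈ tsupport w → x - a ∈ U) :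
    ∫ x in U, w x ∂μ ≤ ∫ x in U, w (x + a) ∂μ := by
  have hwi : Integrable w μ := hw.integrable_of_hasCompactSupport hwc
  rw [setIntegral_comp_add_right hU, ← integral_indicator hU]
  refine integral_mono (hwi.indicator hU) ?_ fun x => ?_
  · exact hwi.indicator (s := (fun x => x - a) ⁻¹' U) (measurable_sub_const a hU)
  · by_cases hx : x ∈ U
    · by_cases hxs : x ∈ tsupport w
      · simp [hx, hmem x hx hxs]
      · simp [hx, indicator, image_eq_zero_of_notMem_tsupport hxs]
    · rw [indicator_of_notMem hx]
      exact indicator_nonneg (fun _ _ => hw0 x) _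

variable [NormedSpace ℝ E] [FiniteDimensional ℝ E]

theorem tendsto_setIntegral_translate_sub (hU : MeasurableSet U) (hfin : μ U ≠ ⊤)
    (hw : ContDiff ℝ 1 w) (hwc : HasCompactSupport w) (e : E) :
    Tendsto (fun t : ℝ => t⁻¹ * (∫ x in U, w (x + t • e) ∂μ - ∫ x in U, w x ∂μ)) (𝓝[>] 0)
      (𝓝 (∫ x in U, fderiv ℝ w x e ∂μ)) := by
  obtain ⟨C, hC⟩ := hw.lipschitzWith_of_hasCompactSupport hwc one_ne_zero
  have hone : Integrable (U.indicator fun _ => (1 : ℝ)) μ :=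
    (integrable_indicator_iff hU).2 (integrableOn_const hfin)
  have hmul : ∀ F : E → ℝ, ∫ x, F x * U.indicator (fun _ => (1 : ℝ)) x ∂μ = ∫ x in U, F x ∂μ :=
    fun F => by
      rw [← integral_indicator hU]
      congr 1 with x
      by_cases hx : x ∈ U <;> simp [hx]
  have hlim := hC.integral_inv_smul_sub_mul_tendsto_integral_lineDeriv_mul hone e
  simp only [hmul, (hw.differentiable one_ne_zero _).lineDeriv_eq_fderiv] at hlim
  refine hlim.congr fun t => ?_
  have hwi : Integrable w μ := hw.continuous.integrable_of_hasCompactSupport hwc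
  simp only [smul_eq_mul]
  rw [integral_const_mul, integral_sub (hwi.comp_add_right _).integrableOn hwi.integrableOn]

theorem setIntegral_fderiv_nonneg (hU : MeasurableSet U) (hfin : μ U ≠ ⊤) (hw : ContDiff ℝ 1 w)
    (hwc : HasCompactSupport w) (hw0 : ∀ x, 0 ≤ w x) {e : E}
    (hmem : ∀ᶠ t : ℝ in 𝓝[>] 0, ∀ x ∈ U, x ∈ tsupport w → x - t • e ∈ U) :
    0 ≤ ∫ x in U, fderiv ℝ w x e ∂μ := by
  refine ge_of_tendsto (tendsto_setIntegral_translate_sub hU hfin hw hwc e) ?_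
  filter_upwards [hmem, self_mem_nhdsWithin] with t ht (ht0 : 0 < t)
  exact mul_nonneg (inv_pos.2 ht0).le (sub_nonneg.2
    (setIntegral_le_setIntegral_comp_add_right hU hw.continuous hwc hw0 ht))

end TranslationMonotone

theorem eventually_forall_sub_smul_mem {E : Type*} [NormedAddCommGroup E] [NormedSpace ℝ E]
    {K B : Set E} (hK : IsCompact K) (hB : IsOpen B)
    (hKB : K ⊆ B) (e : E) : ∀ᶠ t : ℝ in 𝓝[>] 0, ∀ x ∈ K, x - t • e ∈ B := by
  obtain ⟨δ, hδ, hδB⟩ := hK.exists_thickening_subset_open hB hKB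
  have hlim : Tendsto (fun t : ℝ => ‖t • e‖) (𝓝[>] 0) (𝓝 ‖(0 : ℝ) • e‖) :=
    (Continuous.tendsto (by fun_prop) 0).mono_left nhdsWithin_le_nhds
  rw [zero_smul, norm_zero] at hlim
  filter_upwards [hlim.eventually (gt_mem_nhds hδ)] with t ht x hx
  exact hδB (Metric.mem_thickening_iff.2 ⟨x, hx, by simpa [dist_eq_norm] using ht⟩)

section FlatChartIntegral

variable {E : Type*} [NormedAddCommGroup E] [InnerProductSpace ℝ E] [FiniteDimensional ℝ E]
  [MeasurableSpace E] [BorelSpace E] {μ : Measure E} [μ.IsAddHaarMeasure]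
  {U : Set E} {y N e : E} {θ R : ℝ} {σ : E → ℝ}

theorem FlatChart.setIntegral_fderiv_nonneg (h : FlatChart U y N θ R σ) (hU : IsOpen U)
    (hUb : Bornology.IsBounded U) (he : θ * ‖e‖ ≤ ⟪N, e⟫) {w : E → ℝ} (hw : ContDiff ℝ 1 w)
    (hwc : HasCompactSupport w) (hws : tsupport w ⊆ Metric.ball y R) (hw0 : ∀ x, 0 ≤ w x) :
    0 ≤ ∫ x in U, fderiv ℝ w x e ∂μ := by
  refine DiffuseDomain.setIntegral_fderiv_nonneg hU.measurableSet hUb.measure_lt_top.ne hw hwc hw0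
    ?_
  filter_upwards [eventually_forall_sub_smul_mem hwc Metric.isOpen_ball hws e,
    self_mem_nhdsWithin] with t ht (ht0 : 0 < t) x hxU hxw
  exact h.sub_smul_mem he (hws hxw) hxU ht0.le (ht x hxw)

end FlatChartIntegral

section OrthogonalSplitting

variable {E : Type*} [NormedAddCommGroup E] [InnerProductSpace ℝ E] {N : E}

theorem inner_orthogonal_span_singleton (z : (ℝ ∙ N)ᗮ) : ⟪N, (z : E)⟫ = 0 :=
  Submodule.mem_orthogonal_singleton_iff_inner_right.1 z.2

theorem norm_sq_orthogonal_add_smul (hN : ‖N‖ = 1) (z : (ℝ ∙ N)ᗮ) (t : ℝ) :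
    ‖(z : E) + t • N‖ ^ 2 = ‖z‖ ^ 2 + t ^ 2 := by
  rw [norm_add_sq_real, inner_smul_right, real_inner_comm, inner_orthogonal_span_singleton,
    norm_smul, hN, Submodule.coe_norm, Real.norm_eq_abs, mul_one, sq_abs]
  ring

theorem norm_orthogonal_add_smul_le (hN : ‖N‖ = 1) (z : (ℝ ∙ N)ᗮ) (t : ℝ) :
    ‖(z : E) + t • N‖ ≤ ‖z‖ + |t| := by
  simpa [norm_smul, hN] using norm_add_le (z : E) (t • N)

theorem inner_orthogonal_add_smul (hN : ‖N‖ = 1) (z : (ℝ ∙ N)ᗮ) (t : ℝ) :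
    ⟪N, (z : E) + t • N⟫ = t := by
  rw [inner_add_right, inner_orthogonal_span_singleton, inner_smul_right,
    real_inner_self_eq_norm_sq, hN, one_pow, mul_one, zero_add]

theorem add_add_smul_mem_ball (hN : ‖N‖ = 1) {y : E} {z : (ℝ ∙ N)ᗮ} {t r : ℝ}
    (h : ‖z‖ + |t| < r) : y + z + t • N ∈ Metric.ball y r := by
  rw [mem_ball_iff_norm, add_assoc, add_sub_cancel_left]
  exact (norm_orthogonal_add_smul_le hN z t).trans_lt h

theorem norm_lt_and_abs_lt_of_mem_ball (hN : ‖N‖ = 1) {y : E} {z : (ℝ ∙ N)ᗮ} {t r : ℝ}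
    (h : y + z + t • N ∈ Metric.ball y r) : ‖z‖ < r ∧ |t| < r := by
  rw [mem_ball_iff_norm, add_assoc, add_sub_cancel_left] at h
  have hr : 0 ≤ r := (norm_nonneg _).trans h.le
  have hsq : ‖z‖ ^ 2 + t ^ 2 < r ^ 2 := by
    rw [← norm_sq_orthogonal_add_smul hN]
    gcongr
  exact ⟨lt_of_pow_lt_pow_left₀ 2 hr (by nlinarith [sq_nonneg t]),
    lt_of_pow_lt_pow_left₀ 2 hr (by nlinarith [sq_nonneg ‖z‖, sq_abs t])⟩

theorem isometry_add_smul (hN : ‖N‖ = 1) (p : E) : Isometry fun t : ℝ => p + t • N :=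
  Isometry.of_dist_eq fun s t => by
    rw [dist_add_left, dist_eq_norm, ← sub_smul, norm_smul, hN, mul_one, ← dist_eq_norm]

theorem setIntegral_Iio_fderiv_line (hN : ‖N‖ = 1) {w : E → ℝ} (hw : ContDiff ℝ 1 w)
    (hwc : HasCompactSupport w) (p : E) (s : ℝ) :
    ∫ t in Iio s, fderiv ℝ w (p + t • N) N = w (p + s • N) := by
  have hderiv : ∀ t : ℝ,
      HasDerivAt (fun t : ℝ => w (p + t • N)) (fderiv ℝ w (p + t • N) N) t := fun t =>
    (hw.differentiable one_ne_zero _).hasFDerivAt.comp_hasDerivAt t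
      (by simpa using ((hasDerivAt_id t).smul_const N).const_add p)
  have hw' : ContDiff ℝ 1 fun t : ℝ => w (p + t • N) := hw.comp (by fun_prop)
  have hc : HasCompactSupport fun t : ℝ => w (p + t • N) :=
    hwc.comp_isClosedEmbedding (isometry_add_smul hN p).isClosedEmbedding
  rw [← integral_Iic_eq_integral_Iio, ← hc.integral_Iic_deriv_eq hw' s]
  simp only [fun t => (hderiv t).deriv]

variable [FiniteDimensional ℝ E] [MeasurableSpace E] [BorelSpace E]

theorem integral_eq_integral_orthogonal (y : E) (hN : ‖N‖ = 1) {F : E → ℝ} (hF : Integrable F) :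
    ∫ x, F x = ∫ z : (ℝ ∙ N)ᗮ, ∫ t : ℝ, F (y + z + t • N) := by
  let span := LinearIsometryEquiv.toSpanUnitSingleton (𝕜 := ℝ) N hN
  let split : ℝ × (ℝ ∙ N)ᗮ ≃ᵐ E := (span.toHomeomorph.toMeasurableEquiv.prodCongr
    (MeasurableEquiv.refl _)).trans ((ℝ ∙ N).measurableEquivProd y).symm
  have hsplit : ∀ p, split p = y + (p.2 : E) + p.1 • N := fun p => by
    change ((ℝ ∙ N).measurableEquivProd y).symm (span p.1, p.2) = _
    rw [Submodule.measurableEquivProd_symm_apply, vadd_eq_add,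
      LinearIsometryEquiv.toSpanUnitSingleton_apply]
    abel
  have hprod := (ℝ ∙ N).measurePreserving_measurableEquivProd y
  rw [InnerProductSpace.euclideanHausdorffMeasure_eq_volume] at hprod
  have hmp : MeasurePreserving split (volume.prod volume) volume :=
    hprod.symm.comp (span.measurePreserving.prod (MeasurePreserving.id volume))
  have hFsplit : Integrable (fun p => F (split p)) (volume.prod volume) :=
    (hmp.integrable_comp_emb split.measurableEmbedding).2 hF
  rw [← hmp.integral_comp split.measurableEmbedding, integral_prod_symm _ hFsplit]
  simp only [hsplit]

end OrthogonalSplitting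

section GraphChart

variable {E : Type*} [NormedAddCommGroup E] [InnerProductSpace ℝ E]
  {U : Set E} {y N : E} {θ R : ℝ} {σ : E → ℝ}

/-- Near `y` the boundary of `U` is the graph over a ball of the hyperplane `Nᗮ` of the height
function `τ`, with `U` lying below it; the graph map has Lipschitz constant `(1 - θ)⁻¹`. -/
structure GraphChart (U : Set E) (y N : E) (θ r : ℝ) (τ : (ℝ ∙ N)ᗮ → ℝ) : Prop where
  pos : 0 < r
  mem_frontier : ∀ z : (ℝ ∙ N)ᗮ, ‖z‖ < r → y + z + τ z • N ∈ frontier U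
  mem_iff : ∀ z : (ℝ ∙ N)ᗮ, ‖z‖ < r → ∀ t : ℝ, |t| ≤ r → (y + z + t • N ∈ U ↔ t < τ z)
  eq_of_mem_frontier : ∀ z : (ℝ ∙ N)ᗮ, ‖z‖ < r → ∀ t : ℝ, |t| ≤ r →
    y + z + t • N ∈ frontier U → t = τ z
  lipschitz : ∀ z z' : (ℝ ∙ N)ᗮ, ‖z‖ < r → ‖z'‖ < r →
    dist (y + (z : E) + τ z • N) (y + z' + τ z' • N) ≤ (1 - θ)⁻¹ * dist z z'

theorem FlatChart.continuousAt (h : FlatChart U y N θ R σ) {x : E} (hx : x ∈ Metric.ball y R) :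
    ContinuousAt σ x := by
  have hbound : Tendsto (fun x' => θ * ‖x' - x‖) (𝓝 x) (𝓝 0) := by
    have : Continuous fun x' => θ * ‖x' - x‖ := by fun_prop
    simpa using this.tendsto x
  have hlin : Tendsto (fun x' => ⟪N, x' - x⟫) (𝓝 x) (𝓝 0) := by
    have : Continuous fun x' => ⟪N, x' - x⟫ := by fun_prop
    simpa using this.tendsto x
  have hdiff : Tendsto (fun x' => σ x' - σ x - ⟪N, x' - x⟫) (𝓝 x) (𝓝 0) := by
    refine squeeze_zero_norm' ?_ hbound
    filter_upwards [Metric.isOpen_ball.mem_nhds hx] with x' hx' using h.approx x hx x' hx'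
  rw [ContinuousAt, ← tendsto_sub_nhds_zero_iff]
  simpa using hdiff.add hlin

theorem FlatChart.strictMonoOn_line (h : FlatChart U y N θ R σ) (hN : ‖N‖ = 1) (hθ : θ < 1)
    (z : (ℝ ∙ N)ᗮ) : StrictMonoOn (fun t : ℝ => σ (y + z + t • N)) {t | ‖z‖ + |t| < R} := by
  intro t ht t' ht' htt'
  have hadd : y + (z : E) + t' • N = y + z + t • N + (t' - t) • N := by
    rw [sub_smul]
    abel
  have hball := add_add_smul_mem_ball hN (y := y) ht'
  rw [hadd] at hball
  have hσ := (abs_le.1 (h.abs_add_smul_sub_le (add_add_smul_mem_ball hN ht)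
    (sub_nonneg.2 htt'.le) hball)).1
  rw [← hadd, real_inner_self_eq_norm_sq, hN] at hσ
  change σ (y + z + t • N) < σ (y + z + t' • N)
  nlinarith [mul_pos (sub_pos.2 htt') (sub_pos.2 hθ)]

theorem FlatChart.abs_line_sub_le (h : FlatChart U y N θ R σ) (hN : ‖N‖ = 1) (hθ : 0 ≤ θ)
    {z : (ℝ ∙ N)ᗮ} {t : ℝ} (ht : ‖z‖ + |t| < R) :
    |σ (y + z + t • N) - t| ≤ θ * (‖z‖ + |t|) := by
  have hσ := h.approx y (Metric.mem_ball_self h.pos) _ (add_add_smul_mem_ball hN ht)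
  rw [h.base, sub_zero, add_assoc, add_sub_cancel_left, inner_orthogonal_add_smul hN] at hσ
  rw [add_assoc]
  exact hσ.trans (mul_le_mul_of_nonneg_left (norm_orthogonal_add_smul_le hN z t) hθ)

theorem FlatChart.exists_height (h : FlatChart U y N θ R σ) (hN : ‖N‖ = 1) (hθ0 : 0 ≤ θ)
    (hθ : θ ≤ 1 / 3) {z : (ℝ ∙ N)ᗮ} (hz : ‖z‖ < R / 4) :
    ∃ t : ℝ, |t| < R / 2 ∧ σ (y + z + t • N) = 0 := by
  have hR := h.pos
  have habs : |R / 2| = R / 2 := abs_of_pos (by linarith)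
  have hval : ∀ t : ℝ, |t| = R / 2 → |σ (y + z + t • N) - t| < R / 2 := fun t ht => by
    have hle := h.abs_line_sub_le hN hθ0 (z := z) (t := t) (by linarith)
    nlinarith [norm_nonneg z]
  have hpos : 0 < σ (y + z + (R / 2) • N) := by linarith [(abs_lt.1 (hval _ habs)).1]
  have hneg : σ (y + z + (-(R / 2)) • N) < 0 := by
    linarith [(abs_lt.1 (hval (-(R / 2)) (by rwa [abs_neg]))).2]
  have hcont : ContinuousOn (fun t : ℝ => σ (y + z + t • N)) (Icc (-(R / 2)) (R / 2)) :=
    fun t ht => (ContinuousAt.comp (f := fun t : ℝ => y + (z : E) + t • N)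
      (h.continuousAt (add_add_smul_mem_ball hN (by linarith [abs_le.2 ht])))
      (by fun_prop)).continuousWithinAt
  obtain ⟨t, ht, ht0⟩ := intermediate_value_Ioo (by linarith) hcont ⟨hneg, hpos⟩
  exact ⟨t, abs_lt.2 ht, ht0⟩

theorem FlatChart.line_mem_iff (h : FlatChart U y N θ R σ) (hN : ‖N‖ = 1) (hθ : θ < 1)
    {z : (ℝ ∙ N)ᗮ} {s t : ℝ} (hs : ‖z‖ + |s| < R) (hs0 : σ (y + z + s • N) = 0)
    (ht : ‖z‖ + |t| < R) : y + z + t • N ∈ U ↔ t < s := by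
  rw [h.mem_iff _ (add_add_smul_mem_ball hN ht), ← hs0]
  exact (h.strictMonoOn_line hN hθ z).lt_iff_lt ht hs

theorem FlatChart.line_mem_frontier (h : FlatChart U y N θ R σ) (hU : IsOpen U) (hN : ‖N‖ = 1)
    (hθ : θ < 1) {z : (ℝ ∙ N)ᗮ} {s : ℝ} (hs : ‖z‖ + |s| < R) (hs0 : σ (y + z + s • N) = 0) :
    y + z + s • N ∈ frontier U := by
  rw [hU.frontier_eq]
  refine ⟨?_, fun hmem => lt_irrefl _ ((h.line_mem_iff hN hθ hs hs0 hs).1 hmem)⟩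
  have hlim : Tendsto (fun t : ℝ => y + (z : E) + t • N) (𝓝[<] s) (𝓝 (y + z + s • N)) :=
    (Continuous.tendsto (by fun_prop) _).mono_left nhdsWithin_le_nhds
  have hnear : ∀ᶠ t in 𝓝[<] s, ‖z‖ + |t| < R :=
    nhdsWithin_le_nhds (ContinuousAt.eventually_lt (by fun_prop) continuousAt_const hs)
  refine mem_closure_of_tendsto hlim ?_
  filter_upwards [hnear, self_mem_nhdsWithin] with t ht (hts : t < s)
  exact (h.line_mem_iff hN hθ hs hs0 ht).2 hts

theorem FlatChart.dist_le_of_eq_zero (h : FlatChart U y N θ R σ) (hN : ‖N‖ = 1) (hθ : θ < 1)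
    {z z' : (ℝ ∙ N)ᗮ} {s s' : ℝ} (hs : ‖z‖ + |s| < R) (hs' : ‖z'‖ + |s'| < R)
    (hs0 : σ (y + z + s • N) = 0) (hs0' : σ (y + z' + s' • N) = 0) :
    dist (y + (z : E) + s • N) (y + z' + s' • N) ≤ (1 - θ)⁻¹ * dist z z' := by
  have hsub : y + (z : E) + s • N - (y + z' + s' • N) =
      ((z - z' : (ℝ ∙ N)ᗮ) : E) + (s - s') • N := by
    rw [sub_smul, Submodule.coe_sub]
    abel
  have hheight : |s - s'| ≤ θ * ‖((z - z' : (ℝ ∙ N)ᗮ) : E) + (s - s') • N‖ := by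
    have := h.approx _ (add_add_smul_mem_ball hN hs') _ (add_add_smul_mem_ball hN hs)
    rwa [hs0, hs0', sub_self, zero_sub, abs_neg, hsub, inner_orthogonal_add_smul hN] at this
  rw [dist_eq_norm, dist_eq_norm, inv_mul_eq_div, le_div_iff₀ (by linarith), hsub]
  linarith [norm_orthogonal_add_smul_le hN (z - z') (s - s')]

theorem FlatChart.exists_graphChart (h : FlatChart U y N θ R σ) (hU : IsOpen U) (hN : ‖N‖ = 1)
    (hθ0 : 0 ≤ θ) (hθ : θ ≤ 1 / 3) : ∃ τ, GraphChart U y N θ (R / 4) τ := by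
  have hR := h.pos
  have hθ1 : θ < 1 := by linarith
  choose! τ hτ using fun z : (ℝ ∙ N)ᗮ => h.exists_height hN hθ0 hθ (z := z)
  have hτR : ∀ z : (ℝ ∙ N)ᗮ, ‖z‖ < R / 4 → ‖z‖ + |τ z| < R := fun z hz => by
    linarith [(hτ z hz).1]
  refine ⟨τ, by linarith, fun z hz => h.line_mem_frontier hU hN hθ1 (hτR z hz) (hτ z hz).2,
    fun z hz t ht => h.line_mem_iff hN hθ1 (hτR z hz) (hτ z hz).2 (by linarith),
    fun z hz t ht hfr => ?_,
    fun z z' hz hz' => h.dist_le_of_eq_zero hN hθ1 (hτR z hz) (hτR z' hz') (hτ z hz).2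
      (hτ z' hz').2⟩
  have ht' : ‖z‖ + |t| < R := by linarith
  have hball := add_add_smul_mem_ball hN (y := y) ht'
  exact (h.strictMonoOn_line hN hθ1 z).injOn ht' (hτR z hz) <|
    (eq_zero_of_mem_frontier (Metric.isOpen_ball.mem_nhds hball) (h.continuousAt hball)
      h.mem_iff hfr).trans (hτ z hz).2.symm

variable [FiniteDimensional ℝ E] [MeasurableSpace E] [BorelSpace E] {r : ℝ} {τ : (ℝ ∙ N)ᗮ → ℝ}

theorem GraphChart.setIntegral_fderiv_eq (h : GraphChart U y N θ r τ) (hU : IsOpen U)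
    (hN : ‖N‖ = 1) {w : E → ℝ} (hw : ContDiff ℝ 1 w) (hwc : HasCompactSupport w)
    (hws : tsupport w ⊆ Metric.ball y r) :
    ∫ x in U, fderiv ℝ w x N = ∫ z in Metric.ball (0 : (ℝ ∙ N)ᗮ) r, w (y + z + τ z • N) := by
  have hInt : Integrable (U.indicator fun x => fderiv ℝ w x N) :=
    (((hw.continuous_fderiv one_ne_zero).clm_apply
      continuous_const).integrable_of_hasCompactSupport (hwc.fderiv_apply (𝕜 := ℝ) N)).indicator
      hU.measurableSet
  have hzero : ∀ (z : (ℝ ∙ N)ᗮ) (t : ℝ), ¬(‖z‖ < r ∧ |t| < r) →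
      fderiv ℝ w (y + z + t • N) N = 0 := fun z t hzt => by
    rw [image_eq_zero_of_notMem_tsupport fun hmem => hzt
      (norm_lt_and_abs_lt_of_mem_ball hN (hws (tsupport_fderiv_subset ℝ hmem))),
      zero_apply]
  rw [← integral_indicator hU.measurableSet, integral_eq_integral_orthogonal y hN hInt,
    ← integral_indicator Metric.isOpen_ball.measurableSet]
  congr 1 with z
  by_cases hz : ‖z‖ < r
  · have hline : (fun t : ℝ => U.indicator (fun x => fderiv ℝ w x N) (y + z + t • N)) =
        (Iio (τ z)).indicator fun t => fderiv ℝ w (y + z + t • N) N := by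
      funext t
      by_cases ht : |t| < r
      · by_cases htτ : t < τ z <;> simp [htτ, h.mem_iff z hz t ht.le]
      · simp only [indicator, hzero z t fun hzt => ht hzt.2, ite_self]
    rw [indicator_of_mem (mem_ball_zero_iff.2 hz), hline, integral_indicator measurableSet_Iio,
      setIntegral_Iio_fderiv_line hN hw hwc]
  · rw [indicator_of_notMem (mt mem_ball_zero_iff.1 hz)]
    simp only [indicator, hzero z _ fun hzt => hz hzt.1, ite_self, integral_zero]

end GraphChart

section OrthogonalProjection

variable {E : Type*} [NormedAddCommGroup E] [InnerProductSpace ℝ E] {N : E}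

theorem orthogonalProjectionOnto_orthogonal_add_smul (z : (ℝ ∙ N)ᗮ) (t : ℝ) :
    (ℝ ∙ N)ᗮ.orthogonalProjectionOnto ((z : E) + t • N) = z := by
  rw [map_add, Submodule.orthogonalProjectionOnto_mem_subspace_eq_self,
    Submodule.orthogonalProjectionOnto_apply_of_mem_orthogonal, add_zero]
  exact Submodule.le_orthogonal_orthogonal _
    (Submodule.smul_mem _ _ (Submodule.mem_span_singleton_self N))

theorem orthogonalProjectionOnto_add_inner_smul (hN : ‖N‖ = 1) (x : E) :
    ((ℝ ∙ N)ᗮ.orthogonalProjectionOnto x : E) + ⟪N, x⟫ • N = x := by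
  have hsum := Submodule.starProjection_add_starProjection_orthogonal (K := ℝ ∙ N) x
  rwa [Submodule.starProjection_unit_singleton ℝ hN, add_comm] at hsum

end OrthogonalProjection

section HausdorffMeasure

theorem euclideanHausdorffMeasure_image_le {X Y : Type*} [EMetricSpace X] [MeasurableSpace X]
    [BorelSpace X] [EMetricSpace Y] [MeasurableSpace Y] [BorelSpace Y] {K : NNReal} {f : X → Y}
    {s : Set X} (h : LipschitzOnWith K f s) (d : ℕ) :
    Measure.euclideanHausdorffMeasure d (f '' s) ≤
      (K : ENNReal) ^ d * Measure.euclideanHausdorffMeasure d s := by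
  have hle := h.hausdorffMeasure_image_le (d := d) (Nat.cast_nonneg d)
  rw [ENNReal.rpow_natCast] at hle
  simp only [Measure.euclideanHausdorffMeasure_def, Measure.smul_apply, ENNReal.smul_def,
    smul_eq_mul]
  rw [mul_left_comm]
  gcongr

theorem euclideanHausdorffMeasure_orthogonal_eq_volume {n : ℕ} {N : Rn n} (hN : ‖N‖ = 1) :
    (Measure.euclideanHausdorffMeasure (n - 1) : Measure (ℝ ∙ N)ᗮ) = volume := by
  have hN0 : N ≠ 0 := norm_ne_zero_iff.1 (hN ▸ one_ne_zero)
  have hrank := (ℝ ∙ N).finrank_add_finrank_orthogonal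
  rw [finrank_span_singleton hN0, finrank_euclideanSpace_fin] at hrank
  rw [← InnerProductSpace.euclideanHausdorffMeasure_eq_volume]
  congr 1
  omega

end HausdorffMeasure

section SurfaceMeasure

variable {n : ℕ} {U : Set (Rn n)} {y N : Rn n} {θ r : ℝ} {τ : (ℝ ∙ N)ᗮ → ℝ}

/-- The parametrisation of the graph of `τ` over the hyperplane `y + Nᗮ`. -/
def graphMap (y N : Rn n) (τ : (ℝ ∙ N)ᗮ → ℝ) (z : (ℝ ∙ N)ᗮ) : Rn n := y + z + τ z • N

theorem GraphChart.lipschitzOnWith (h : GraphChart U y N θ r τ) (hθ : θ < 1) :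
    LipschitzOnWith (1 - θ)⁻¹.toNNReal (graphMap y N τ) (Metric.ball 0 r) := by
  refine LipschitzOnWith.of_dist_le_mul fun z hz z' hz' => ?_
  rw [Real.coe_toNNReal _ (inv_nonneg.2 (by linarith))]
  exact h.lipschitz z z' (mem_ball_zero_iff.1 hz) (mem_ball_zero_iff.1 hz')

theorem GraphChart.aemeasurable (h : GraphChart U y N θ r τ) (hθ : θ < 1) :
    AEMeasurable (graphMap y N τ) (volume.restrict (Metric.ball 0 r)) :=
  (h.lipschitzOnWith hθ).continuousOn.aemeasurable Metric.isOpen_ball.measurableSet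

-- The orthogonal projection onto the base is a left inverse of the graph map, and `1`-Lipschitz.
theorem GraphChart.map_le (h : GraphChart U y N θ r τ) (hN : ‖N‖ = 1) (hθ : θ < 1) :
    (volume.restrict (Metric.ball 0 r)).map (graphMap y N τ) ≤ surfaceMeasure U := by
  refine Measure.le_iff.2 fun B hB => ?_
  rw [Measure.map_apply_of_aemeasurable (h.aemeasurable hθ) hB,
    Measure.restrict_apply' Metric.isOpen_ball.measurableSet, surfaceMeasure,
    Measure.restrict_apply hB, ← euclideanHausdorffMeasure_orthogonal_eq_volume hN]
  let proj : Rn n → (ℝ ∙ N)ᗮ := fun x => (ℝ ∙ N)ᗮ.orthogonalProjectionOnto (x - y)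
  have hproj : LipschitzWith 1 proj := LipschitzWith.of_dist_le_mul fun x x' => by
    rw [NNReal.coe_one, one_mul, dist_eq_norm, dist_eq_norm, ← map_sub, sub_sub_sub_cancel_right]
    exact Submodule.norm_orthogonalProjectionOnto_apply_le _ _
  have hsub : graphMap y N τ ⁻¹' B ∩ Metric.ball 0 r ⊆ proj '' (B ∩ frontier U) :=
    fun z ⟨hzB, hz⟩ => ⟨_, ⟨hzB, h.mem_frontier z (mem_ball_zero_iff.1 hz)⟩, by
      simp only [proj, graphMap]
      rw [add_assoc, add_sub_cancel_left, orthogonalProjectionOnto_orthogonal_add_smul]⟩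
  refine (measure_mono hsub).trans ?_
  simpa using euclideanHausdorffMeasure_image_le (hproj.lipschitzOnWith (s := B ∩ frontier U))
    (n - 1)

theorem GraphChart.inter_frontier_subset_image (h : GraphChart U y N θ r τ) (hN : ‖N‖ = 1) :
    Metric.ball y r ∩ frontier U ⊆ graphMap y N τ '' Metric.ball 0 r := by
  rintro x ⟨hxr, hx⟩
  rw [mem_ball_iff_norm] at hxr
  have hz : ‖(ℝ ∙ N)ᗮ.orthogonalProjectionOnto (x - y)‖ < r :=
    (Submodule.norm_orthogonalProjectionOnto_apply_le _ _).trans_lt hxr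
  have ht : |⟪N, x - y⟫| ≤ r := by
    have := abs_real_inner_le_norm N (x - y)
    rw [hN, one_mul] at this
    linarith
  have hsplit : y + (ℝ ∙ N)ᗮ.orthogonalProjectionOnto (x - y) + ⟪N, x - y⟫ • N = x := by
    rw [add_assoc, orthogonalProjectionOnto_add_inner_smul hN, add_sub_cancel]
  refine ⟨_, mem_ball_zero_iff.2 hz, ?_⟩
  rw [graphMap, ← h.eq_of_mem_frontier _ hz _ ht (by rwa [hsplit]), hsplit]

theorem GraphChart.restrict_ball_le (h : GraphChart U y N θ r τ) (hN : ‖N‖ = 1) (hθ : θ < 1) :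
    (surfaceMeasure U).restrict (Metric.ball y r) ≤
      ((1 - θ)⁻¹.toNNReal : ENNReal) ^ (n - 1) •
        (volume.restrict (Metric.ball 0 r)).map (graphMap y N τ) := by
  refine Measure.le_iff.2 fun B hB => ?_
  rw [Measure.smul_apply, Measure.map_apply_of_aemeasurable (h.aemeasurable hθ) hB,
    Measure.restrict_apply' Metric.isOpen_ball.measurableSet,
    Measure.restrict_apply' Metric.isOpen_ball.measurableSet, surfaceMeasure,
    Measure.restrict_apply (hB.inter Metric.isOpen_ball.measurableSet),
    ← euclideanHausdorffMeasure_orthogonal_eq_volume hN]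
  have hsub : B ∩ Metric.ball y r ∩ frontier U ⊆
      graphMap y N τ '' (graphMap y N τ ⁻¹' B ∩ Metric.ball 0 r) := by
    rw [image_preimage_inter, inter_assoc]
    exact inter_subset_inter_right B (h.inter_frontier_subset_image hN)
  exact (measure_mono hsub).trans (euclideanHausdorffMeasure_image_le
    ((h.lipschitzOnWith hθ).mono inter_subset_right) (n - 1))

theorem GraphChart.surfaceMeasure_ball_lt_top (h : GraphChart U y N θ r τ) (hN : ‖N‖ = 1)
    (hθ : θ < 1) : surfaceMeasure U (Metric.ball y r) < ⊤ := by
  have hle := h.restrict_ball_le hN hθ univ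
  rw [Measure.restrict_apply_univ, Measure.smul_apply,
    Measure.map_apply_of_aemeasurable (h.aemeasurable hθ) MeasurableSet.univ, preimage_univ,
    Measure.restrict_apply_univ] at hle
  exact hle.trans_lt (ENNReal.mul_lt_top (ENNReal.pow_lt_top ENNReal.coe_lt_top)
    Metric.isBounded_ball.measure_lt_top)

theorem GraphChart.setIntegral_fderiv_eq_integral_map (h : GraphChart U y N θ r τ)
    (hU : IsOpen U) (hN : ‖N‖ = 1) (hθ : θ < 1) {w : Rn n → ℝ} (hw : ContDiff ℝ 1 w)
    (hwc : HasCompactSupport w) (hws : tsupport w ⊆ Metric.ball y r) :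
    ∫ x in U, fderiv ℝ w x N =
      ∫ x, w x ∂(volume.restrict (Metric.ball 0 r)).map (graphMap y N τ) := by
  rw [h.setIntegral_fderiv_eq hU hN hw hwc hws,
    integral_map (h.aemeasurable hθ) hw.continuous.aestronglyMeasurable]
  rfl

theorem GraphChart.setIntegral_fderiv_le_integral_surface [IsFiniteMeasure (surfaceMeasure U)]
    (h : GraphChart U y N θ r τ) (hU : IsOpen U) (hN : ‖N‖ = 1) (hθ : θ < 1)
    {w : Rn n → ℝ} (hw : ContDiff ℝ 1 w) (hwc : HasCompactSupport w)
    (hws : tsupport w ⊆ Metric.ball y r) (hw0 : ∀ x, 0 ≤ w x) :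
    ∫ x in U, fderiv ℝ w x N ≤ ∫ x, w x ∂surfaceMeasure U := by
  rw [h.setIntegral_fderiv_eq_integral_map hU hN hθ hw hwc hws]
  exact integral_mono_measure (h.map_le hN hθ) (Eventually.of_forall hw0)
    (hw.continuous.integrable_of_hasCompactSupport hwc)

theorem GraphChart.integral_surface_le_setIntegral_fderiv [IsFiniteMeasure (surfaceMeasure U)]
    (h : GraphChart U y N θ r τ) (hU : IsOpen U) (hN : ‖N‖ = 1) (hθ : θ < 1)
    {w : Rn n → ℝ} (hw : ContDiff ℝ 1 w) (hwc : HasCompactSupport w)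
    (hws : tsupport w ⊆ Metric.ball y r) (hw0 : ∀ x, 0 ≤ w x) :
    ∫ x, w x ∂surfaceMeasure U ≤ (1 - θ)⁻¹ ^ (n - 1) * ∫ x in U, fderiv ℝ w x N := by
  have hw_surface : Integrable w (surfaceMeasure U) :=
    hw.continuous.integrable_of_hasCompactSupport hwc
  have hball : ∫ x in Metric.ball y r, w x ∂surfaceMeasure U = ∫ x, w x ∂surfaceMeasure U :=
    setIntegral_eq_integral_of_forall_compl_eq_zero fun x hx =>
      image_eq_zero_of_notMem_tsupport fun h => hx (hws h)
  rw [← hball, h.setIntegral_fderiv_eq_integral_map hU hN hθ hw hwc hws]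
  refine (integral_mono_measure (h.restrict_ball_le hN hθ) (Eventually.of_forall hw0)
    ((hw_surface.mono_measure (h.map_le hN hθ)).smul_measure
      (ENNReal.pow_ne_top ENNReal.coe_ne_top))).trans_eq ?_
  rw [integral_smul_measure, ENNReal.toReal_pow, ENNReal.coe_toReal,
    Real.coe_toNNReal _ (inv_nonneg.2 (by linarith)), smul_eq_mul]

theorem isFiniteMeasure_surfaceMeasure (hU : IsOpen U) (hUb : Bornology.IsBounded U)
    (hnormal : ∀ y ∈ frontier U, ∃ N, IsNormal U y N) : IsFiniteMeasure (surfaceMeasure U) := by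
  have hcompact : IsCompact (frontier U) :=
    Metric.isCompact_of_isClosed_isBounded isClosed_frontier
      (hUb.closure.subset frontier_subset_closure)
  have hfrontier : surfaceMeasure U univ = surfaceMeasure U (frontier U) := by
    rw [surfaceMeasure, Measure.restrict_apply_univ, Measure.restrict_apply_self]
  constructor
  rw [hfrontier]
  refine hcompact.measure_lt_top_of_nhdsWithin fun y hy => ?_
  obtain ⟨N, hN⟩ := hnormal y hy
  obtain ⟨R, σ, hflat⟩ := hN.2 (1 / 3) (by norm_num)
  obtain ⟨τ, hτ⟩ := hflat.exists_graphChart hU hN.1 (by norm_num) le_rfl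
  exact ⟨Metric.ball y (R / 4), mem_nhdsWithin_of_mem_nhds (Metric.ball_mem_nhds y hτ.pos),
    hτ.surfaceMeasure_ball_lt_top hN.1 (by norm_num)⟩

theorem volume_frontier_eq_zero (hn : 1 ≤ n) [IsFiniteMeasure (surfaceMeasure U)] :
    volume (frontier U) = 0 := by
  have hdim := Measure.euclideanHausdorffMeasure_zero_or_top (show n - 1 < n by omega) (frontier U)
  rw [EuclideanSpace.euclideanHausdorffMeasure_eq_volume] at hdim
  refine hdim.resolve_right ?_
  have := measure_ne_top (surfaceMeasure U) univ
  rwa [surfaceMeasure, Measure.restrict_apply_univ] at this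

end SurfaceMeasure

section NormalField

variable {E : Type*} [NormedAddCommGroup E] [InnerProductSpace ℝ E] {k : WithTop ℕ∞}

/-- The set `U` has a boundary of class `Cᵏ` and lies locally on one side of it; for `k = 3` this
is `HasC3Boundary`. -/
def HasContDiffBoundary (k : WithTop ℕ∞) (U : Set E) : Prop :=
  ∀ x ∈ frontier U, ∃ (V : Set E) (ρ : E → ℝ),
    IsOpen V ∧ x ∈ V ∧ ContDiffOn ℝ k ρ V ∧ fderiv ℝ ρ x ≠ 0 ∧ U ∩ V = {y ∈ V | ρ y < 0}

theorem HasContDiffBoundary.of_le {U : Set E} {l : WithTop ℕ∞} (h : HasContDiffBoundary k U)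
    (hl : l ≤ k) : HasContDiffBoundary l U := fun x hx =>
  let ⟨V, ρ, hV, hxV, hρ, hne, hUV⟩ := h x hx
  ⟨V, ρ, hV, hxV, hρ.of_le hl, hne, hUV⟩

theorem HasContDiffBoundary.exists_contDiffOn_isNormal [CompleteSpace E] {U : Set E} {y : E}
    (h : HasContDiffBoundary (k + 1) U) (hy : y ∈ frontier U) :
    ∃ V ∈ 𝓝 y, ∃ ν : E → E, ContDiffOn ℝ k ν V ∧ ∀ x ∈ V, x ∈ frontier U → IsNormal U x (ν x) := by
  obtain ⟨V, ρ, hV, hyV, hρ, hne, hUV⟩ := h y hy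
  have hmem : ∀ x ∈ V, (x ∈ U ↔ ρ x < 0) := fun x hx => by
    have := Set.ext_iff.1 hUV x
    simpa only [mem_inter_iff, hx, and_true, mem_ofPred_eq, true_and] using this
  have hgrad : ContDiffOn ℝ k (gradient ρ) V :=
    (InnerProductSpace.toDual ℝ E).symm.contDiff.comp_contDiffOn (hρ.fderiv_of_isOpen hV le_rfl)
  have hgrady : gradient ρ y ≠ 0 := by simpa [gradient] using hne
  have hopen : IsOpen (V ∩ gradient ρ ⁻¹' {0}ᶜ) :=
    hgrad.continuousOn.isOpen_inter_preimage hV isOpen_compl_singleton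
  have hgrad' := hgrad.mono (inter_subset_left (t := gradient ρ ⁻¹' {0}ᶜ))
  refine ⟨_, hopen.mem_nhds ⟨hyV, hgrady⟩, fun x => ‖gradient ρ x‖⁻¹ • gradient ρ x,
    ((hgrad'.norm ℝ fun x hx => hx.2).inv fun x hx => norm_ne_zero_iff.2 hx.2).smul hgrad',
    fun x hx hxU => isNormal_of_hasStrictFDerivAt (hV.mem_nhds hx.1) ?_ hx.2 hmem hxU⟩
  have hstrict : HasStrictFDerivAt ρ (fderiv ℝ ρ x) x :=
    (hρ.contDiffAt (hV.mem_nhds hx.1)).hasStrictFDerivAt (by simp)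
  convert hstrict
  ext v
  simp [gradient]

variable {F : Type*} [NormedAddCommGroup F] [NormedSpace ℝ F] [FiniteDimensional ℝ E]

open scoped Manifold in
theorem exists_contDiff_eqOn_of_forall_local {K W : Set E} (hK : IsCompact K) (hW : IsOpen W)
    (hKW : K ⊆ W) {j : ℕ∞} {f : E → F}
    (hf : ∀ x ∈ K, ∃ V ∈ 𝓝 x, ∃ g : E → F, ContDiffOn ℝ j g V ∧ EqOn g f (V ∩ K)) :
    ∃ X : E → F, ContDiff ℝ j X ∧ HasCompactSupport X ∧ tsupport X ⊆ W ∧ EqOn X f K := by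
  obtain ⟨L, hL, hKL, hLW⟩ := exists_compact_between hK hW hKW
  obtain ⟨X, hX⟩ := exists_contMDiffMap_forall_mem_convex_of_local (n := j) 𝓘(ℝ, E)
    (t := fun x => {v : F | (x ∈ K → v = f x) ∧ (x ∉ L → v = 0)})
    (fun x => by
      by_cases hxK : x ∈ K <;> by_cases hxL : x ∈ L <;> simp only [hxK, hxL, true_imp_iff,
        not_true_eq_false, false_imp_iff, not_false_eq_true, and_true, true_and, ofPred_true]
      exacts [convex_singleton _, (convex_singleton _).inter (convex_singleton _), convex_univ,
        convex_singleton _])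
    (fun x => by
      by_cases hx : x ∈ K
      · obtain ⟨V, hV, g, hg, hgf⟩ := hf x hx
        refine ⟨V ∩ interior L, inter_mem hV (isOpen_interior.mem_nhds (hKL hx)), g,
          (hg.mono inter_subset_left).contMDiffOn, fun y hy => ⟨fun hyK => hgf ⟨hy.1, hyK⟩,
            fun hyL => absurd (interior_subset hy.2) hyL⟩⟩
      · exact ⟨Kᶜ, hK.isClosed.isOpen_compl.mem_nhds hx, 0, contMDiffOn_const,
          fun y hy => ⟨fun hyK => absurd hyK hy, fun _ => rfl⟩⟩)
  have hts : tsupport X ⊆ L :=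
    closure_minimal (fun x hx => not_not.1 fun hxL => hx ((hX x).2 hxL)) hL.isClosed
  exact ⟨X, X.contMDiff.contDiff, hL.of_isClosed_subset (isClosed_tsupport _) hts,
    hts.trans hLW, fun x hx => (hX x).1 hx⟩

theorem exists_inward_normal_field {U W : Set E} (hUb : Bornology.IsBounded U)
    (hC : HasContDiffBoundary 2 U) (hW : IsOpen W) (hUW : frontier U ⊆ W) :
    ∃ X : E → E, ContDiff ℝ 1 X ∧ HasCompactSupport X ∧ tsupport X ⊆ W ∧
      ∀ y ∈ frontier U, IsNormal U y (-X y) := by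
  have := FiniteDimensional.complete ℝ E
  have hcompact : IsCompact (frontier U) :=
    Metric.isCompact_of_isClosed_isBounded isClosed_frontier
      (hUb.closure.subset frontier_subset_closure)
  rw [← one_add_one_eq_two] at hC
  choose! V hV ν hν hnormal using fun y (hy : y ∈ frontier U) => hC.exists_contDiffOn_isNormal hy
  have hself : ∀ y ∈ frontier U, IsNormal U y (ν y y) := fun y hy =>
    hnormal y hy y (mem_of_mem_nhds (hV y hy)) hy
  obtain ⟨X, hX, hXc, hXW, hXν⟩ := exists_contDiff_eqOn_of_forall_local (j := 1) hcompact hW hUW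
    (f := fun y => -ν y y) fun y hy => ⟨V y, hV y hy, fun x => -ν y x, (hν y hy).neg,
      fun x hx => congrArg Neg.neg ((hnormal y hy x hx.1 hx.2).unique (hself x hx.2))⟩
  refine ⟨X, hX, hXc, hXW, fun y hy => ?_⟩
  rw [hXν hy, neg_neg]
  exact hself y hy

end NormalField

section IntegralFDeriv

variable {E : Type*} [NormedAddCommGroup E] [NormedSpace ℝ E] [MeasurableSpace E]
  {μ : Measure E} {h w : E → ℝ}

theorem integral_fderiv_const_mul (c : ℝ) (e : E) :
    ∫ x, fderiv ℝ (fun x => c * h x) x e ∂μ = c * ∫ x, fderiv ℝ h x e ∂μ := by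
  rw [← integral_const_mul]
  congr 1 with x
  rw [show (fun x => c * h x) = c • h from rfl, fderiv_const_smul_field]
  rfl

variable [BorelSpace E] [IsFiniteMeasureOnCompacts μ]

theorem integrable_fderiv_apply (hh : ContDiff ℝ 1 h) (hc : HasCompactSupport h) (e : E) :
    Integrable (fun x => fderiv ℝ h x e) μ :=
  ((hh.continuous_fderiv one_ne_zero).clm_apply continuous_const).integrable_of_hasCompactSupport
    (hc.fderiv_apply (𝕜 := ℝ) e)

theorem integral_fderiv_sub (hh : ContDiff ℝ 1 h) (hc : HasCompactSupport h)
    (hw : ContDiff ℝ 1 w) (hwc : HasCompactSupport w) (e : E) :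
    ∫ x, fderiv ℝ (fun x => h x - w x) x e ∂μ =
      (∫ x, fderiv ℝ h x e ∂μ) - ∫ x, fderiv ℝ w x e ∂μ := by
  rw [← integral_sub (integrable_fderiv_apply hh hc e) (integrable_fderiv_apply hw hwc e)]
  congr 1 with x
  rw [fderiv_fun_sub (hh.differentiable one_ne_zero x) (hw.differentiable one_ne_zero x)]
  rfl

theorem integral_fderiv_add_smul (hh : ContDiff ℝ 1 h) (hc : HasCompactSupport h)
    (e e' : E) (c : ℝ) :
    ∫ x, fderiv ℝ h x (e + c • e') ∂μ =
      (∫ x, fderiv ℝ h x e ∂μ) + c * ∫ x, fderiv ℝ h x e' ∂μ := by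
  rw [← integral_const_mul, ← integral_add (integrable_fderiv_apply hh hc e)
    ((integrable_fderiv_apply hh hc e').const_mul c)]
  congr 1 with x
  rw [map_add, map_smul, smul_eq_mul]

theorem integral_fderiv_eq_sum {ι : Type*} [Fintype ι] (b : Module.Basis ι ℝ E)
    (hh : ContDiff ℝ 1 h) (hc : HasCompactSupport h) (e : E) :
    ∫ x, fderiv ℝ h x e ∂μ = ∑ i, b.repr e i * ∫ x, fderiv ℝ h x (b i) ∂μ := by
  simp_rw [← integral_const_mul]
  rw [← integral_finsetSum _ fun i _ => (integrable_fderiv_apply hh hc _).const_mul _]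
  congr 1 with x
  conv_lhs => rw [← b.sum_repr e]
  simp only [map_sum, map_smul, smul_eq_mul]

end IntegralFDeriv

section TangentialBound

variable {E : Type*} [NormedAddCommGroup E] [InnerProductSpace ℝ E] [FiniteDimensional ℝ E]
  [MeasurableSpace E] [BorelSpace E] {μ : Measure E} [μ.IsAddHaarMeasure]
  {U : Set E} {y N e : E} {θ R δ : ℝ} {σ w w' Y : E → ℝ}

theorem FlatChart.setIntegral_fderiv_mono (hf : FlatChart U y N θ R σ) (hU : IsOpen U)
    (hUb : Bornology.IsBounded U) (he : θ * ‖e‖ ≤ ⟪N, e⟫) (hw : ContDiff ℝ 1 w)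
    (hwc : HasCompactSupport w) (hws : tsupport w ⊆ Metric.ball y R) (hw' : ContDiff ℝ 1 w')
    (hwc' : HasCompactSupport w') (hws' : tsupport w' ⊆ Metric.ball y R) (hle : ∀ x, w x ≤ w' x) :
    ∫ x in U, fderiv ℝ w x e ∂μ ≤ ∫ x in U, fderiv ℝ w' x e ∂μ := by
  rw [← sub_nonneg, ← integral_fderiv_sub hw' hwc' hw hwc]
  exact hf.setIntegral_fderiv_nonneg hU hUb he (hw'.sub hw) (hwc'.sub hwc)
    ((tsupport_sub w' w).trans (union_subset hws' hws)) fun x => sub_nonneg.2 (hle x)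

-- Both `N + e / 2` and `N - e / 2` lie in the cone of directions that point out of `U`.
theorem FlatChart.abs_setIntegral_fderiv_le (hf : FlatChart U y N θ R σ) (hU : IsOpen U)
    (hUb : Bornology.IsBounded U) (hN : ‖N‖ = 1) (hθ : θ ≤ 1 / 3) (he : ‖e‖ = 1)
    (hw : ContDiff ℝ 1 w) (hwc : HasCompactSupport w) (hws : tsupport w ⊆ Metric.ball y R)
    (hw0 : ∀ x, 0 ≤ w x) :
    |∫ x in U, fderiv ℝ w x e ∂μ| ≤ 2 * ∫ x in U, fderiv ℝ w x N ∂μ := by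
  have hcone : ∀ c : ℝ, |c| = 1 / 2 → 0 ≤ ∫ x in U, fderiv ℝ w x (N + c • e) ∂μ := by
    intro c hc
    refine hf.setIntegral_fderiv_nonneg hU hUb ?_ hw hwc hws hw0
    have hnorm : ‖N + c • e‖ ≤ 3 / 2 := by
      refine (norm_add_le _ _).trans ?_
      rw [norm_smul, Real.norm_eq_abs, hc, hN, he]
      norm_num
    have hinner : 1 / 2 ≤ ⟪N, N + c • e⟫ := by
      have habs : |c * ⟪N, e⟫| ≤ 1 / 2 := by
        rw [abs_mul, hc]
        have := abs_real_inner_le_norm N e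
        rw [hN, he] at this
        linarith
      rw [inner_add_right, real_inner_self_eq_norm_sq, hN, inner_smul_right]
      linarith [(abs_le.1 habs).1]
    nlinarith [norm_nonneg (N + c • e)]
  have hpos := hcone (1 / 2) (by norm_num)
  have hneg := hcone (-(1 / 2)) (by norm_num)
  rw [integral_fderiv_add_smul hw hwc] at hpos hneg
  rw [abs_le]
  constructor <;> linarith

-- `w Y = w (Y + δ) - δ w` is a difference of two nonnegative functions.
theorem FlatChart.abs_setIntegral_fderiv_mul_le (hf : FlatChart U y N θ R σ) (hU : IsOpen U)
    (hUb : Bornology.IsBounded U) (hN : ‖N‖ = 1) (hθ : θ ≤ 1 / 3) (he : ‖e‖ = 1)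
    (hw : ContDiff ℝ 1 w) (hwc : HasCompactSupport w) (hws : tsupport w ⊆ Metric.ball y R)
    (hw0 : ∀ x, 0 ≤ w x) (hY : ContDiff ℝ 1 Y) (hδ : 0 ≤ δ)
    (hYδ : ∀ x ∈ Metric.ball y R, |Y x| ≤ δ) :
    |∫ x in U, fderiv ℝ (fun x => w x * Y x) x e ∂μ| ≤
      6 * δ * ∫ x in U, fderiv ℝ w x N ∂μ := by
  have hshift : ContDiff ℝ 1 fun x => w x * (Y x + δ) := hw.mul (hY.add contDiff_const)
  have hshift_c : HasCompactSupport fun x => w x * (Y x + δ) := hwc.mul_right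
  have hshift_s : tsupport (fun x => w x * (Y x + δ)) ⊆ Metric.ball y R :=
    tsupport_mul_subset_left.trans hws
  have hbounds : ∀ x, 0 ≤ w x * (Y x + δ) ∧ w x * (Y x + δ) ≤ 2 * δ * w x := fun x => by
    by_cases hx : x ∈ tsupport w
    · have := abs_le.1 (hYδ x (hws hx))
      exact ⟨mul_nonneg (hw0 x) (by linarith), by nlinarith [hw0 x]⟩
    · simp [image_eq_zero_of_notMem_tsupport hx]
  have hN' : θ * ‖N‖ ≤ ⟪N, N⟫ := by
    rw [real_inner_self_eq_norm_sq, hN]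
    linarith
  have hsplit : ∫ x in U, fderiv ℝ (fun x => w x * Y x) x e ∂μ =
      (∫ x in U, fderiv ℝ (fun x => w x * (Y x + δ)) x e ∂μ) -
        δ * ∫ x in U, fderiv ℝ w x e ∂μ := by
    rw [← integral_fderiv_const_mul,
      ← integral_fderiv_sub hshift hshift_c (contDiff_const.mul hw) hwc.mul_left]
    simp only [mul_add, mul_comm δ, add_sub_cancel_right]
  have htangential := hf.abs_setIntegral_fderiv_le (μ := μ) hU hUb hN hθ he hw hwc hws hw0
  have hshift_tangential := hf.abs_setIntegral_fderiv_le (μ := μ) hU hUb hN hθ he hshift hshift_c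
    hshift_s fun x => (hbounds x).1
  have hshift_normal := hf.setIntegral_fderiv_mono (μ := μ) hU hUb hN' hshift hshift_c hshift_s
    (contDiff_const.mul hw) hwc.mul_left (tsupport_mul_subset_right.trans hws)
    fun x => (hbounds x).2
  rw [integral_fderiv_const_mul] at hshift_normal
  rw [hsplit]
  refine (abs_sub _ _).trans ?_
  rw [abs_mul, abs_of_nonneg hδ]
  nlinarith

end TangentialBound

theorem subset_or_disjoint_of_disjoint_frontier {α : Type*} [TopologicalSpace α] {s U : Set α}
    (hs : IsPreconnected s) (hU : IsOpen U) (h : Disjoint s (frontier U)) :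
    s ⊆ U ∨ Disjoint s U := by
  have hdisj : Disjoint U (closure U)ᶜ := disjoint_compl_right.mono_left subset_closure
  have hcover : s ⊆ U ∪ (closure U)ᶜ := fun x hx => by
    by_contra hnot
    rw [mem_union, not_or, notMem_compl_iff] at hnot
    exact disjoint_left.1 h hx (hU.frontier_eq ▸ ⟨hnot.2, hnot.1⟩)
  exact (hs.subset_or_subset hU isClosed_closure.isOpen_compl hdisj hcover).imp_right
    fun hsub => (hdisj.mono_right hsub).symm

section Divergence

variable {n : ℕ} {X Y : Rn n → Rn n} {x : Rn n}

/-- The divergence of a vector field on `ℝⁿ`. -/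
def divergence (X : Rn n → Rn n) (x : Rn n) : ℝ :=
  ∑ i, fderiv ℝ (fun z => X z i) x (EuclideanSpace.single i 1)

theorem contDiff_coord {k : WithTop ℕ∞} (hX : ContDiff ℝ k X) (i : Fin n) :
    ContDiff ℝ k fun z => X z i :=
  (EuclideanSpace.proj i : Rn n →L[ℝ] ℝ).contDiff.comp hX

theorem hasCompactSupport_coord (hXc : HasCompactSupport X) (i : Fin n) :
    HasCompactSupport fun z => X z i :=
  hXc.comp_left (g := fun v : Rn n => v i) rfl

theorem divergence_add (hX : DifferentiableAt ℝ X x) (hY : DifferentiableAt ℝ Y x) :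
    divergence (fun z => X z + Y z) x = divergence X x + divergence Y x := by
  have hcoord : ∀ {Z : Rn n → Rn n}, DifferentiableAt ℝ Z x → ∀ i,
      DifferentiableAt ℝ (fun z => Z z i) x := fun hZ i =>
    (EuclideanSpace.proj i : Rn n →L[ℝ] ℝ).differentiableAt.comp x hZ
  simp only [divergence, ← Finset.sum_add_distrib, PiLp.add_apply]
  exact Finset.sum_congr rfl fun i _ => by
    rw [fderiv_fun_add (hcoord hX i) (hcoord hY i), add_apply]

theorem divergence_smul {w : Rn n → ℝ} (hw : DifferentiableAt ℝ w x)
    (hX : DifferentiableAt ℝ X x) :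
    divergence (fun z => w z • X z) x = w x * divergence X x + ⟪gradient w x, X x⟫ := by
  have hcoord : ∀ i, DifferentiableAt ℝ (fun z => X z i) x := fun i =>
    (EuclideanSpace.proj i : Rn n →L[ℝ] ℝ).differentiableAt.comp x hX
  have hproduct : ∀ i, fderiv ℝ (fun z => w z * X z i) x (EuclideanSpace.single i 1) =
      w x * fderiv ℝ (fun z => X z i) x (EuclideanSpace.single i 1) +
        X x i * fderiv ℝ w x (EuclideanSpace.single i 1) := fun i => by
    rw [fderiv_fun_mul hw (hcoord i), add_apply, smul_apply, smul_apply, smul_eq_mul, smul_eq_mul]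
  have hinner : ⟪gradient w x, X x⟫ =
      ∑ i, X x i * fderiv ℝ w x (EuclideanSpace.single i 1) := by
    rw [inner_gradient_left]
    conv_lhs => rw [← (EuclideanSpace.basisFun (Fin n) ℝ).sum_repr (X x)]
    simp
  simp only [divergence, PiLp.smul_apply, smul_eq_mul, hproduct, Finset.sum_add_distrib, hinner,
    Finset.mul_sum]

theorem continuous_divergence (hX : ContDiff ℝ 1 X) : Continuous (divergence X) :=
  continuous_finsetSum _ fun i _ =>
    ((contDiff_coord hX i).continuous_fderiv one_ne_zero).clm_apply continuous_const

theorem tsupport_divergence_subset (X : Rn n → Rn n) : tsupport (divergence X) ⊆ tsupport X := by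
  refine closure_minimal (fun x hx => ?_) (isClosed_tsupport X)
  by_contra h
  refine hx (Finset.sum_eq_zero fun i _ => ?_)
  have hzero : (fun z => X z i) =ᶠ[𝓝 x] fun _ => 0 := by
    filter_upwards [(isClosed_tsupport X).isOpen_compl.mem_nhds h] with z hz
    rw [image_eq_zero_of_notMem_tsupport hz, PiLp.zero_apply]
  rw [hzero.fderiv_eq, fderiv_fun_const]
  rfl

theorem hasCompactSupport_divergence (hXc : HasCompactSupport X) :
    HasCompactSupport (divergence X) :=
  hXc.mono' (subset_closure.trans (tsupport_divergence_subset X))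

theorem integrable_divergence {μ : Measure (Rn n)} [IsFiniteMeasureOnCompacts μ]
    (hX : ContDiff ℝ 1 X) (hXc : HasCompactSupport X) : Integrable (divergence X) μ :=
  (continuous_divergence hX).integrable_of_hasCompactSupport (hasCompactSupport_divergence hXc)

theorem integral_divergence {μ : Measure (Rn n)} [IsFiniteMeasureOnCompacts μ]
    (hX : ContDiff ℝ 1 X) (hXc : HasCompactSupport X) :
    ∫ x, divergence X x ∂μ =
      ∑ i, ∫ x, fderiv ℝ (fun z => X z i) x (EuclideanSpace.single i 1) ∂μ :=
  integral_finsetSum _ fun i _ =>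
    integrable_fderiv_apply (contDiff_coord hX i) (hasCompactSupport_coord hXc i) _

theorem integral_divergence_add {μ : Measure (Rn n)} [IsFiniteMeasureOnCompacts μ]
    (hX : ContDiff ℝ 1 X) (hXc : HasCompactSupport X) (hY : ContDiff ℝ 1 Y)
    (hYc : HasCompactSupport Y) :
    ∫ x, divergence (fun z => X z + Y z) x ∂μ =
      (∫ x, divergence X x ∂μ) + ∫ x, divergence Y x ∂μ := by
  rw [← integral_add (integrable_divergence hX hXc) (integrable_divergence hY hYc)]
  congr 1 with x
  exact divergence_add (hX.differentiable one_ne_zero x) (hY.differentiable one_ne_zero x)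

theorem integral_divergence_eq_zero (hX : ContDiff ℝ 1 X) (hXc : HasCompactSupport X) :
    ∫ x, divergence X x = 0 := by
  rw [integral_divergence hX hXc]
  refine Finset.sum_eq_zero fun i _ => ?_
  have hXi := contDiff_coord hX i
  have hparts := integral_mul_fderiv_eq_neg_fderiv_mul_of_integrable (𝕜 := ℝ) (μ := volume)
    (f := fun _ => 1) (g := fun z => X z i) (v := EuclideanSpace.single i 1) (by simp)
    (by simpa using integrable_fderiv_apply hXi (hasCompactSupport_coord hXc i) _)
    (by simpa using hXi.continuous.integrable_of_hasCompactSupport (hasCompactSupport_coord hXc i))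
    (fun x _ => differentiableAt_const _) (fun x _ => hXi.differentiable one_ne_zero x)
  simpa using hparts

theorem setIntegral_divergence_eq_zero {U : Set (Rn n)} {y : Rn n} {b : ℝ} (hU : IsOpen U)
    (hX : ContDiff ℝ 1 X) (hXc : HasCompactSupport X) (hXb : tsupport X ⊆ Metric.ball y b)
    (hb : Disjoint (Metric.ball y b) (frontier U)) : ∫ x in U, divergence X x = 0 := by
  have hzero : ∀ x ∉ Metric.ball y b, divergence X x = 0 := fun x hx =>
    image_eq_zero_of_notMem_tsupport fun h => hx (hXb (tsupport_divergence_subset X h))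
  rcases subset_or_disjoint_of_disjoint_frontier (convex_ball y b).isPreconnected hU hb with h | h
  · rw [setIntegral_eq_integral_of_forall_compl_eq_zero fun x hx => hzero x fun hx' => hx (h hx')]
    exact integral_divergence_eq_zero hX hXc
  · exact setIntegral_eq_zero_of_forall_eq_zero fun x hx => hzero x (disjoint_right.1 h hx)

end Divergence

open scoped Manifold in
theorem exists_finite_smooth_partition {E : Type*} [NormedAddCommGroup E] [NormedSpace ℝ E]
    [FiniteDimensional ℝ E] {K : Set E} (hK : IsCompact K) (B : K → Set E)
    (hB : ∀ y, IsOpen (B y)) (hyB : ∀ y : K, (y : E) ∈ B y) :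
    ∃ (t : Finset K) (χ : t → E → ℝ), (∀ k, ContDiff ℝ ∞ (χ k)) ∧
      (∀ k, tsupport (χ k) ⊆ B k) ∧ (∀ k x, 0 ≤ χ k x) ∧ ∀ x ∈ K, ∑ k, χ k x = 1 := by
  obtain ⟨t, ht⟩ := hK.elim_finite_subcover B hB fun y hy => mem_iUnion.2 ⟨⟨y, hy⟩, hyB ⟨y, hy⟩⟩
  obtain ⟨f, hf⟩ := SmoothPartitionOfUnity.exists_isSubordinate 𝓘(ℝ, E) hK.isClosed
    (fun k : t => B k) (fun k => hB k) fun x hx =>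
      let ⟨i, hi, hxi⟩ := mem_iUnion₂.1 (ht hx)
      mem_iUnion.2 ⟨⟨i, hi⟩, hxi⟩
  refine ⟨t, fun k => f k, fun k => (f k).contMDiff.contDiff, hf, fun k x => f.nonneg k x,
    fun x hx => ?_⟩
  rw [← f.sum_eq_one hx, finsum_eq_sum_of_fintype]

theorem memLp_restrict_of_isBounded {E F : Type*} [PseudoMetricSpace E] [ProperSpace E]
    [MeasurableSpace E] [OpensMeasurableSpace E] [NormedAddCommGroup F]
    [SecondCountableTopologyEither E F] {μ : Measure E} {s : Set E} [IsFiniteMeasure (μ.restrict s)]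
    (hs : Bornology.IsBounded s) {f : E → F} (hf : Continuous f) (p : ENNReal) :
    MemLp f p (μ.restrict s) := by
  obtain ⟨C, hC⟩ := hs.isCompact_closure.exists_bound_of_continuousOn hf.continuousOn
  refine MemLp.of_bound hf.aestronglyMeasurable C ?_
  have hmem : ∀ᵐ x ∂μ.restrict s, x ∈ closure s :=
    (ae_restrict_iff isClosed_closure.measurableSet).2 (ae_of_all _ subset_closure)
  exact hmem.mono hC

section DivergenceTheorem

variable {n : ℕ} {U : Set (Rn n)} {X : Rn n → Rn n}

/-- The defect `∫_U div (w X) + ∫_{∂U} w dS` in the divergence theorem for `w X`, to be shown to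
vanish when `-X` is the outer unit normal on `∂U`. -/
def divergenceDefect (U : Set (Rn n)) (X : Rn n → Rn n) (w : Rn n → ℝ) : ℝ :=
  (∫ x in U, divergence (fun x => w x • X x) x) + ∫ x, w x ∂surfaceMeasure U

theorem memLp_surfaceMeasure [IsFiniteMeasure (surfaceMeasure U)] (hUb : Bornology.IsBounded U)
    {f : Rn n → ℝ} (hf : Continuous f) (p : ENNReal) : MemLp f p (surfaceMeasure U) :=
  have : IsFiniteMeasure ((Measure.euclideanHausdorffMeasure (n - 1)).restrict (frontier U)) :=
    inferInstanceAs (IsFiniteMeasure (surfaceMeasure U))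
  memLp_restrict_of_isBounded (hUb.closure.subset frontier_subset_closure) hf p

theorem divergenceDefect_add [IsFiniteMeasure (surfaceMeasure U)] (hUb : Bornology.IsBounded U)
    (hX : ContDiff ℝ 1 X) (hXc : HasCompactSupport X) {w w' : Rn n → ℝ} (hw : ContDiff ℝ 1 w)
    (hw' : ContDiff ℝ 1 w') :
    divergenceDefect U X (fun x => w x + w' x) =
      divergenceDefect U X w + divergenceDefect U X w' := by
  have hsurface : ∫ x, w x + w' x ∂surfaceMeasure U =
      ∫ x, w x ∂surfaceMeasure U + ∫ x, w' x ∂surfaceMeasure U :=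
    integral_add (memLp_one_iff_integrable.1 (memLp_surfaceMeasure hUb hw.continuous 1))
      (memLp_one_iff_integrable.1 (memLp_surfaceMeasure hUb hw'.continuous 1))
  have hsmul : ContDiff ℝ 1 fun x => w x • X x := hw.smul hX
  have hsmul' : ContDiff ℝ 1 fun x => w' x • X x := hw'.smul hX
  have hcompact : ∀ v : Rn n → ℝ, HasCompactSupport fun x => v x • X x := fun v =>
    HasCompactSupport.smul_left (f := v) hXc
  have hvolume := integral_divergence_add (μ := volume.restrict U) hsmul (hcompact w) hsmul'
    (hcompact w')
  simp only [divergenceDefect, add_smul]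
  linarith

theorem divergenceDefect_sum [IsFiniteMeasure (surfaceMeasure U)] (hUb : Bornology.IsBounded U)
    (hX : ContDiff ℝ 1 X) (hXc : HasCompactSupport X) {ι : Type*} (s : Finset ι)
    {w : ι → Rn n → ℝ} (hw : ∀ k, ContDiff ℝ 1 (w k)) :
    divergenceDefect U X (fun x => ∑ k ∈ s, w k x) = ∑ k ∈ s, divergenceDefect U X (w k) := by
  classical
  induction s using Finset.induction_on with
  | empty => simp [divergenceDefect, divergence]
  | insert k s hk ih =>
    simp only [Finset.sum_insert hk]
    rw [divergenceDefect_add hUb hX hXc (hw k) (ContDiff.sum fun i _ => hw i), ih]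

theorem divergenceDefect_congr (hX : frontier U ⊆ tsupport X) {w w' : Rn n → ℝ}
    (h : EqOn w w' (tsupport X)) : divergenceDefect U X w = divergenceDefect U X w' := by
  have hsmul : (fun x => w x • X x) = fun x => w' x • X x := funext fun x => by
    by_cases hx : x ∈ tsupport X
    · rw [h hx]
    · simp only [image_eq_zero_of_notMem_tsupport hx, smul_zero]
  rw [divergenceDefect, divergenceDefect, hsmul, surfaceMeasure,
    setIntegral_congr_fun isClosed_frontier.measurableSet (h.mono hX)]

theorem divergenceDefect_eq_zero_of_disjoint {y : Rn n} {b : ℝ} (hU : IsOpen U)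
    (hX : ContDiff ℝ 1 X) {w : Rn n → ℝ} (hw : ContDiff ℝ 1 w) (hwc : HasCompactSupport w)
    (hws : tsupport w ⊆ Metric.ball y b) (hb : Disjoint (Metric.ball y b) (frontier U)) :
    divergenceDefect U X w = 0 := by
  have hsurface : ∫ x, w x ∂surfaceMeasure U = 0 :=
    setIntegral_eq_zero_of_forall_eq_zero fun x hx =>
      image_eq_zero_of_notMem_tsupport fun h => disjoint_left.1 hb (hws h) hx
  rw [divergenceDefect, hsurface, add_zero]
  exact setIntegral_divergence_eq_zero hU (hw.smul hX) hwc.smul_right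
    ((tsupport_smul_subset_left w X).trans hws) hb

theorem FlatChart.abs_setIntegral_divergence_smul_le {y N : Rn n} {θ R δ : ℝ} {σ w : Rn n → ℝ}
    (hf : FlatChart U y N θ R σ) (hU : IsOpen U) (hUb : Bornology.IsBounded U) (hN : ‖N‖ = 1)
    (hθ : θ ≤ 1 / 3) (hw : ContDiff ℝ 1 w) (hwc : HasCompactSupport w)
    (hws : tsupport w ⊆ Metric.ball y R) (hw0 : ∀ x, 0 ≤ w x) (hX : ContDiff ℝ 1 X)
    (hδ : 0 ≤ δ) (hXδ : ∀ x ∈ Metric.ball y R, ‖X x‖ ≤ δ) :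
    |∫ x in U, divergence (fun x => w x • X x) x| ≤
      6 * n * δ * ∫ x in U, fderiv ℝ w x N := by
  rw [integral_divergence (X := fun x => w x • X x) (hw.smul hX) hwc.smul_right]
  simp only [PiLp.smul_apply, smul_eq_mul]
  calc |∑ i, ∫ x in U, fderiv ℝ (fun z => w z * X z i) x (EuclideanSpace.single i 1)|
      ≤ ∑ _i : Fin n, 6 * δ * ∫ x in U, fderiv ℝ w x N :=
        (Finset.abs_sum_le_sum_abs _ _).trans <| Finset.sum_le_sum fun i _ =>
          hf.abs_setIntegral_fderiv_mul_le hU hUb hN hθ (by simp) hw hwc hws hw0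
            (contDiff_coord hX i) hδ fun x hx =>
              (PiLp.norm_apply_le (X x) i).trans (hXδ x hx)
    _ = 6 * n * δ * ∫ x in U, fderiv ℝ w x N := by
        rw [Finset.sum_const, Finset.card_univ, Fintype.card_fin, nsmul_eq_mul]
        ring

theorem setIntegral_divergence_smul_const {w : Rn n → ℝ} (hw : ContDiff ℝ 1 w)
    (hwc : HasCompactSupport w) (e : Rn n) :
    ∫ x in U, divergence (fun x => w x • e) x = ∫ x in U, fderiv ℝ w x e := by
  rw [integral_divergence (X := fun x => w x • e) (hw.smul contDiff_const) hwc.smul_right,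
    integral_fderiv_eq_sum (EuclideanSpace.basisFun (Fin n) ℝ).toBasis hw hwc e]
  simp only [PiLp.smul_apply, smul_eq_mul, OrthonormalBasis.coe_toBasis_repr_apply,
    EuclideanSpace.basisFun_repr, OrthonormalBasis.coe_toBasis, EuclideanSpace.basisFun_apply]
  exact Finset.sum_congr rfl fun i _ => by simp_rw [mul_comm (w _), integral_fderiv_const_mul]

theorem GraphChart.abs_divergenceDefect_le [IsFiniteMeasure (surfaceMeasure U)] {y N : Rn n}
    {θ R δ : ℝ} {σ w : Rn n → ℝ} {τ : (ℝ ∙ N)ᗮ → ℝ}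
    (hτ : GraphChart U y N θ (R / 4) τ)
    (hf : FlatChart U y N θ R σ) (hU : IsOpen U) (hUb : Bornology.IsBounded U) (hN : ‖N‖ = 1)
    (hθ0 : 0 ≤ θ) (hθ : θ ≤ 1 / 3) (hX : ContDiff ℝ 1 X) (hδ : 0 ≤ δ)
    (hXδ : ∀ x ∈ Metric.ball y R, ‖X x + N‖ ≤ δ) (hw : ContDiff ℝ 1 w)
    (hwc : HasCompactSupport w) (hws : tsupport w ⊆ Metric.ball y (R / 4)) (hw0 : ∀ x, 0 ≤ w x) :
    |divergenceDefect U X w| ≤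
      (6 * n * δ + ((1 - θ)⁻¹ ^ (n - 1) - 1)) * ∫ x, w x ∂surfaceMeasure U := by
  have hwsR : tsupport w ⊆ Metric.ball y R :=
    hws.trans (Metric.ball_subset_ball (by linarith [hf.pos]))
  have hXN : ContDiff ℝ 1 fun x => X x + N := hX.add contDiff_const
  have hsplit : ∫ x in U, divergence (fun x => w x • X x) x =
      (∫ x in U, divergence (fun x => w x • (X x + N)) x) - ∫ x in U, fderiv ℝ w x N := by
    rw [← setIntegral_divergence_smul_const hw hwc, eq_sub_iff_add_eq,
      ← integral_divergence_add (X := fun x => w x • X x) (Y := fun x => w x • N) (hw.smul hX)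
        hwc.smul_right (hw.smul contDiff_const) hwc.smul_right]
    simp only [smul_add]
  have hlower := hτ.setIntegral_fderiv_le_integral_surface hU hN (by linarith) hw hwc hws hw0
  have hupper := hτ.integral_surface_le_setIntegral_fderiv hU hN (by linarith) hw hwc hws hw0
  have hvariation : |∫ x in U, divergence (fun x => w x • (X x + N)) x| ≤
      6 * n * δ * ∫ x, w x ∂surfaceMeasure U :=
    (hf.abs_setIntegral_divergence_smul_le hU hUb hN hθ hw hwc hwsR hw0 hXN hδ hXδ).trans
      (mul_le_mul_of_nonneg_left hlower (by positivity))
  have hone : 1 ≤ (1 - θ)⁻¹ ^ (n - 1) :=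
    one_le_pow₀ ((one_le_inv₀ (by linarith)).2 (by linarith [hθ0]))
  have harea : |(∫ x, w x ∂surfaceMeasure U) - ∫ x in U, fderiv ℝ w x N| ≤
      ((1 - θ)⁻¹ ^ (n - 1) - 1) * ∫ x, w x ∂surfaceMeasure U := by
    rw [abs_of_nonneg (sub_nonneg.2 hlower)]
    nlinarith
  rw [divergenceDefect, hsplit, add_mul, sub_add_eq_add_sub, add_sub_assoc]
  exact (abs_add_le _ _).trans (add_le_add hvariation harea)

theorem exists_pow_inv_one_sub_le {η : ℝ} (hη : 0 < η) (m : ℕ) :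
    ∃ θ : ℝ, 0 < θ ∧ θ ≤ 1 / 3 ∧ (1 - θ)⁻¹ ^ m ≤ 1 + η := by
  have hcont : ContinuousAt (fun θ : ℝ => (1 - θ)⁻¹ ^ m) 0 :=
    ContinuousAt.pow (ContinuousAt.inv₀ (by fun_prop) (by simp)) _
  have hsmall : ∀ᶠ θ in 𝓝[>] (0 : ℝ), (1 - θ)⁻¹ ^ m < 1 + η :=
    nhdsWithin_le_nhds (hcont.eventually (gt_mem_nhds (by simp [hη])))
  have hthird : ∀ᶠ θ in 𝓝[>] (0 : ℝ), θ < 1 / 3 :=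
    nhdsWithin_le_nhds (gt_mem_nhds (by norm_num))
  obtain ⟨θ, hle, hlt, hpos⟩ := (hsmall.and (hthird.and self_mem_nhdsWithin)).exists
  exact ⟨θ, hpos, hlt.le, hle.le⟩

theorem exists_ball_abs_divergenceDefect_le_of_isNormal [IsFiniteMeasure (surfaceMeasure U)]
    (hU : IsOpen U) (hUb : Bornology.IsBounded U) (hX : ContDiff ℝ 1 X) {y : Rn n}
    (hy : IsNormal U y (-X y)) {η : ℝ} (hη : 0 < η) :
    ∃ b > 0, ∀ w : Rn n → ℝ, ContDiff ℝ 1 w → HasCompactSupport w →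
      tsupport w ⊆ Metric.ball y b → (∀ x, 0 ≤ w x) →
      |divergenceDefect U X w| ≤ η * ∫ x, w x ∂surfaceMeasure U := by
  obtain ⟨θ, hθ0, hθ, hθη⟩ := exists_pow_inv_one_sub_le (half_pos hη) (n - 1)
  set δ : ℝ := η / (12 * (n + 1)) with hδ
  have hδ0 : 0 < δ := by positivity
  obtain ⟨R, σ, hf⟩ := hy.2 θ hθ0
  obtain ⟨R', hR', hXδ⟩ := Metric.continuous_iff.1 hX.continuous y δ hδ0
  have hf' := hf.mono (lt_min hf.pos hR') (min_le_left R R')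
  obtain ⟨τ, hτ⟩ := hf'.exists_graphChart hU hy.1 hθ0.le hθ
  refine ⟨min R R' / 4, hτ.pos, fun w hw hwc hws hw0 => ?_⟩
  refine (hτ.abs_divergenceDefect_le hf' hU hUb hy.1 hθ0.le hθ hX hδ0.le (fun x hx => ?_) hw hwc
    hws hw0).trans (mul_le_mul_of_nonneg_right ?_ (integral_nonneg hw0))
  · rw [← sub_eq_add_neg, ← dist_eq_norm]
    exact (hXδ x (Metric.ball_subset_ball (min_le_right R R') hx)).le
  · have hnδ : 6 * n * δ ≤ η / 2 := by
      rw [hδ, ← mul_div_assoc, div_le_iff₀ (by positivity)]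
      nlinarith
    linarith

theorem exists_ball_abs_divergenceDefect_le [IsFiniteMeasure (surfaceMeasure U)]
    (hU : IsOpen U) (hUb : Bornology.IsBounded U) (hX : ContDiff ℝ 1 X)
    (hnormal : ∀ y ∈ frontier U, IsNormal U y (-X y)) {η : ℝ} (hη : 0 < η) (y : Rn n) :
    ∃ b > 0, ∀ w : Rn n → ℝ, ContDiff ℝ 1 w → HasCompactSupport w →
      tsupport w ⊆ Metric.ball y b → (∀ x, 0 ≤ w x) →
      |divergenceDefect U X w| ≤ η * ∫ x, w x ∂surfaceMeasure U := by
  by_cases hy : y ∈ frontier U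
  · exact exists_ball_abs_divergenceDefect_le_of_isNormal hU hUb hX (hnormal y hy) hη
  · obtain ⟨b, hb, hbs⟩ := Metric.isOpen_iff.1 isClosed_frontier.isOpen_compl y hy
    refine ⟨b, hb, fun w hw hwc hws hw0 => ?_⟩
    rw [divergenceDefect_eq_zero_of_disjoint hU hX hw hwc hws
      (disjoint_left.2 fun x hx => hbs hx), abs_zero]
    exact mul_nonneg hη.le (integral_nonneg hw0)

theorem abs_divergenceDefect_le [IsFiniteMeasure (surfaceMeasure U)] (hU : IsOpen U)
    (hUb : Bornology.IsBounded U) (hX : ContDiff ℝ 1 X) (hXc : HasCompactSupport X)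
    (hnormal : ∀ y ∈ frontier U, IsNormal U y (-X y)) {w : Rn n → ℝ} (hw : ContDiff ℝ 1 w)
    (hw0 : ∀ x, 0 ≤ w x) {η : ℝ} (hη : 0 < η) :
    |divergenceDefect U X w| ≤ η * ∫ x, w x ∂surfaceMeasure U := by
  have hfrontier : frontier U ⊆ tsupport X := fun y hy => subset_tsupport _ fun h => by
    simpa [h] using (hnormal y hy).1
  choose b hb hlocal using exists_ball_abs_divergenceDefect_le hU hUb hX hnormal hη
  obtain ⟨t, χ, hχ, hχs, hχ0, hχ1⟩ := exists_finite_smooth_partition hXc.isCompact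
    (fun y => Metric.ball (y : Rn n) (b y)) (fun y => Metric.isOpen_ball)
    fun y => Metric.mem_ball_self (hb y)
  have hχc : ∀ k, HasCompactSupport (χ k) := fun k =>
    Metric.isCompact_of_isClosed_isBounded (isClosed_tsupport _)
      (Metric.isBounded_ball.subset (hχs k))
  have hχw : ∀ k, ContDiff ℝ 1 fun x => χ k x * w x := fun k => ((hχ k).of_le (by simp)).mul hw
  have hsum : EqOn w (fun x => ∑ k, χ k x * w x) (tsupport X) := fun x hx => by
    simp only [← Finset.sum_mul, hχ1 x hx, one_mul]
  have hsurface : ∫ x, w x ∂surfaceMeasure U = ∑ k, ∫ x, χ k x * w x ∂surfaceMeasure U := by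
    rw [← integral_finsetSum _ fun k _ =>
      (hχw k).continuous.integrable_of_hasCompactSupport (hχc k).mul_right]
    exact setIntegral_congr_fun isClosed_frontier.measurableSet (hsum.mono hfrontier)
  rw [divergenceDefect_congr hfrontier hsum, divergenceDefect_sum hUb hX hXc _ hχw, hsurface,
    Finset.mul_sum]
  exact (Finset.abs_sum_le_sum_abs _ _).trans <| Finset.sum_le_sum fun k _ =>
    hlocal k _ (hχw k) (hχc k).mul_right (tsupport_mul_subset_left.trans (hχs k))
      fun x => mul_nonneg (hχ0 k x) (hw0 x)

theorem divergenceDefect_eq_zero_of_nonneg [IsFiniteMeasure (surfaceMeasure U)] (hU : IsOpen U)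
    (hUb : Bornology.IsBounded U) (hX : ContDiff ℝ 1 X) (hXc : HasCompactSupport X)
    (hnormal : ∀ y ∈ frontier U, IsNormal U y (-X y)) {w : Rn n → ℝ} (hw : ContDiff ℝ 1 w)
    (hw0 : ∀ x, 0 ≤ w x) : divergenceDefect U X w = 0 := by
  have hlim : Tendsto (fun η : ℝ => η * ∫ x, w x ∂surfaceMeasure U) (𝓝[>] 0) (𝓝 0) := by
    simpa using ((continuous_mul_const (∫ x, w x ∂surfaceMeasure U)).tendsto 0).mono_left
      nhdsWithin_le_nhds
  refine abs_nonpos_iff.1 (ge_of_tendsto hlim ?_)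
  filter_upwards [self_mem_nhdsWithin] with η hη using
    abs_divergenceDefect_le hU hUb hX hXc hnormal hw hw0 hη

theorem setIntegral_divergence_smul_eq_neg_integral_surface [IsFiniteMeasure (surfaceMeasure U)]
    (hU : IsOpen U) (hUb : Bornology.IsBounded U) (hX : ContDiff ℝ 1 X)
    (hXc : HasCompactSupport X) (hnormal : ∀ y ∈ frontier U, IsNormal U y (-X y))
    {w : Rn n → ℝ} (hw : ContDiff ℝ 1 w) :
    ∫ x in U, divergence (fun x => w x • X x) x = -∫ x, w x ∂surfaceMeasure U := by
  have hsq : ∀ c : ℝ, ContDiff ℝ 1 fun x => ((w x + c) / 2) ^ 2 := fun c =>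
    ((hw.add contDiff_const).div_const 2).pow 2
  have hzero : ∀ c : ℝ, divergenceDefect U X (fun x => ((w x + c) / 2) ^ 2) = 0 := fun c =>
    divergenceDefect_eq_zero_of_nonneg hU hUb hX hXc hnormal (hsq c) fun x => sq_nonneg _
  have hpolarization : (fun x => ((w x + 1) / 2) ^ 2) = fun x => w x + ((w x + -1) / 2) ^ 2 :=
    funext fun x => by ring
  have hsplit := divergenceDefect_add hUb hX hXc hw (hsq (-1))
  rw [← hpolarization, hzero, hzero, add_zero] at hsplit
  exact eq_neg_of_add_eq_zero_left hsplit.symm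

end DivergenceTheorem

section Distance

theorem infDist_eq_dist_of_dist_add_dist {α : Type*} [PseudoMetricSpace α] {s : Set α} {x y z : α}
    (hy : y ∈ s) (hxy : Metric.infDist x s = dist x y) (hz : dist x z + dist z y = dist x y) :
    Metric.infDist z s = dist z y :=
  le_antisymm (Metric.infDist_le_dist_of_mem hy) <| by
    linarith [Metric.infDist_le_infDist_add_dist (s := s) (x := x) (y := z)]

theorem infDist_add_infDist_frontier_le {E : Type*} [NormedAddCommGroup E] [NormedSpace ℝ E]
    {U : Set E} {x x' : E} (hU : IsOpen U) (hx : x ∈ U) (hx' : x' ∉ U) :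
    Metric.infDist x (frontier U) + Metric.infDist x' (frontier U) ≤ dist x x' := by
  have hmeet : ¬Disjoint (segment ℝ x x') (frontier U) := fun hdisj =>
    (subset_or_disjoint_of_disjoint_frontier (convex_segment x x').isPreconnected hU hdisj).elim
      (fun h => hx' (h (right_mem_segment ℝ x x')))
      fun h => disjoint_left.1 h (left_mem_segment ℝ x x') hx
  obtain ⟨z, hz, hzU⟩ := not_disjoint_iff.1 hmeet
  rw [← dist_add_dist_of_mem_segment hz, dist_comm z x']
  exact add_le_add (Metric.infDist_le_dist_of_mem hzU) (Metric.infDist_le_dist_of_mem hzU)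

end Distance

section TouchingBall

variable {E : Type*} [NormedAddCommGroup E] [InnerProductSpace ℝ E] {U : Set E}
  {y p e N : E} {d : ℝ}

theorem eventually_add_smul_mem_ball_add_smul (hd : 0 < d) (hp : ‖p‖ = 1) (he : 0 < ⟪p, e⟫) :
    ∀ᶠ t : ℝ in 𝓝[>] 0, y + t • e ∈ Metric.ball (y + d • p) d := by
  have hlim : Tendsto (fun t : ℝ => t * ‖e‖ ^ 2) (𝓝[>] 0) (𝓝 0) :=
    ((continuous_mul_const _).tendsto' 0 0 (zero_mul _)).mono_left nhdsWithin_le_nhds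
  filter_upwards [hlim.eventually_lt_const (by positivity : 0 < 2 * d * ⟪p, e⟫),
    self_mem_nhdsWithin] with t ht (ht0 : 0 < t)
  rw [mem_ball_iff_norm, add_sub_add_left_eq_sub]
  refine lt_of_pow_lt_pow_left₀ 2 hd.le ?_
  rw [norm_sub_sq_real, norm_smul, norm_smul, hp, inner_smul_left, inner_smul_right,
    real_inner_comm, Real.norm_of_nonneg ht0.le, Real.norm_of_nonneg hd.le, conj_trivial]
  nlinarith

theorem IsNormal.eq_neg_of_ball_subset (hN : IsNormal U y N) (hp : ‖p‖ = 1) (hd : 0 < d)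
    (hb : Metric.ball (y + d • p) d ⊆ U) : N = -p := by
  by_contra hne
  have hp' : ‖-p‖ = 1 := by rw [norm_neg, hp]
  have hpos : 0 < ⟪p, N + p⟫ := by
    have := inner_sub_pos_of_ne hp' hN.1 (Ne.symm hne)
    rwa [inner_neg_left, ← inner_neg_right, neg_sub, sub_neg_eq_add] at this
  have hNpos : 0 < ⟪N, N + p⟫ := by
    simpa only [sub_neg_eq_add] using inner_sub_pos_of_ne hN.1 hp' hne
  obtain ⟨t, ht, ht'⟩ := ((eventually_add_smul_mem_ball_add_smul hd hp hpos).and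
    (hN.eventually_notMem hNpos)).exists
  exact ht' (hb ht)

theorem IsNormal.eq_of_disjoint_ball (hN : IsNormal U y N) (hp : ‖p‖ = 1) (hd : 0 < d)
    (hb : Disjoint (Metric.ball (y + d • p) d) U) : N = p := by
  by_contra hne
  have hneg : ⟪N, p - N⟫ < 0 := by
    rw [← neg_sub, inner_neg_right, neg_lt_zero]
    exact inner_sub_pos_of_ne hN.1 hp hne
  obtain ⟨t, ht, ht'⟩ := ((eventually_add_smul_mem_ball_add_smul hd hp
    (inner_sub_pos_of_ne hp hN.1 (Ne.symm hne))).and (hN.eventually_mem hneg)).exists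
  exact disjoint_left.1 hb ht ht'

theorem eq_of_inner_eq_one_of_norm_le {g : E} (hg : ‖g‖ ≤ 1) (hp : ‖p‖ = 1)
    (hgp : ⟪g, p⟫ = 1) : g = p := by
  have hle := real_inner_le_norm g p
  rw [hgp, hp, mul_one] at hle
  exact (inner_eq_one_iff_of_norm_eq_one (hg.antisymm hle) hp).1 hgp

theorem norm_gradient_le_of_lipschitzWith [CompleteSpace E] {f : E → ℝ} {C : NNReal}
    (hf : LipschitzWith C f) (x : E) : ‖gradient f x‖ ≤ C := by
  rw [gradient, LinearIsometryEquiv.norm_map]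
  exact norm_fderiv_le_of_lipschitz ℝ hf

theorem inner_gradient_eq_of_eventually_eq [CompleteSpace E] {f : E → ℝ} {x : E} {s : ℝ}
    (hf : DifferentiableAt ℝ f x) (h : ∀ᶠ t : ℝ in 𝓝[>] 0, f (x + t • p) = f x + t * s) :
    ⟪gradient f x, p⟫ = s := by
  have hline : HasDerivAt (fun t : ℝ => f (x + t • p)) (fderiv ℝ f x p) 0 :=
    hf.hasFDerivAt.hasLineDerivAt p
  have haffine : HasDerivWithinAt (fun t : ℝ => f x + t * s) s (Ioi 0) 0 := by
    simpa only [id_eq, one_mul] using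
      (((hasDerivAt_id (0 : ℝ)).mul_const s).const_add (f x)).hasDerivWithinAt
  rw [inner_gradient_left]
  exact (uniqueDiffWithinAt_Ioi (0 : ℝ)).eq_deriv _ hline.hasDerivWithinAt
    (haffine.congr_of_eventuallyEq h (by simp only [zero_smul, add_zero, zero_mul]))

end TouchingBall

section SignedDist

variable {n : ℕ} {U : Set (Rn n)}

theorem abs_signedDist (x : Rn n) : |signedDist U x| = Metric.infDist x (frontier U) := by
  unfold signedDist
  split_ifs
  · exact abs_of_nonneg Metric.infDist_nonneg
  · rw [abs_neg, abs_of_nonneg Metric.infDist_nonneg]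

theorem lipschitzWith_signedDist (hU : IsOpen U) : LipschitzWith 1 (signedDist U) := by
  refine LipschitzWith.of_le_add fun x x' => ?_
  have h1 := Metric.infDist_le_infDist_add_dist (s := frontier U) (x := x) (y := x')
  have h2 := Metric.infDist_le_infDist_add_dist (s := frontier U) (x := x') (y := x)
  have hx0 : 0 ≤ Metric.infDist x (frontier U) := Metric.infDist_nonneg
  have hx0' : 0 ≤ Metric.infDist x' (frontier U) := Metric.infDist_nonneg
  have hd : 0 ≤ dist x x' := dist_nonneg
  rw [dist_comm] at h2
  unfold signedDist
  split_ifs with hx hx'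
  · exact h1
  · linarith [infDist_add_infDist_frontier_le hU hx hx']
  · linarith
  · linarith

theorem infDist_frontier_segment {y p : Rn n} {d t : ℝ} (hp : ‖p‖ = 1) (hy : y ∈ frontier U)
    (hd : Metric.infDist (y + d • p) (frontier U) = d) (ht : t ∈ Icc 0 d) :
    Metric.infDist (y + t • p) (frontier U) = t := by
  have hdist : ∀ {s : ℝ}, 0 ≤ s → dist (y + s • p) y = s := fun hs => by
    rw [dist_self_add_left, norm_smul, hp, mul_one, Real.norm_of_nonneg hs]
  have hsub : dist (y + d • p) (y + t • p) = d - t := by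
    rw [dist_add_left, dist_eq_norm, ← sub_smul, norm_smul, hp, mul_one,
      Real.norm_of_nonneg (sub_nonneg.2 ht.2)]
  have hd0 : 0 ≤ d := ht.1.trans ht.2
  rw [infDist_eq_dist_of_dist_add_dist hy (hd.trans (hdist hd0).symm), hdist ht.1]
  rw [hsub, hdist ht.1, hdist hd0, sub_add_cancel]

theorem gradient_signedDist_add_smul {y p ν : Rn n} {d : ℝ} (hU : IsOpen U) (hy : y ∈ frontier U)
    (hp : ‖p‖ = 1) (hd : 0 < d) (hyd : Metric.infDist (y + d • p) (frontier U) = d)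
    (hν : IsNormal U y (-ν)) (hdiff : DifferentiableAt ℝ (signedDist U) (y + d • p)) :
    gradient (signedDist U) (y + d • p) = ν := by
  have hball : Disjoint (Metric.ball (y + d • p) d) (frontier U) := by
    simpa only [hyd] using Metric.disjoint_ball_infDist (s := frontier U) (x := y + d • p)
  have hray : ∀ᶠ t : ℝ in 𝓝[>] 0, y + d • p - t • p ∈ Metric.ball (y + d • p) d ∧
      Metric.infDist (y + d • p - t • p) (frontier U) = d - t := by
    filter_upwards [self_mem_nhdsWithin, nhdsWithin_le_nhds (gt_mem_nhds hd)]
      with t (ht0 : 0 < t) (htd : t < d)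
    constructor
    · rw [mem_ball_iff_norm', sub_sub_cancel, norm_smul, hp, mul_one, Real.norm_of_nonneg ht0.le]
      exact htd
    · rw [add_sub_assoc, ← sub_smul]
      exact infDist_frontier_segment hp hy hyd ⟨by linarith, by linarith⟩
  have hgrad : ∀ s : ℝ, (∀ z ∈ Metric.ball (y + d • p) d,
      signedDist U z = s * Metric.infDist z (frontier U)) →
      ⟪gradient (signedDist U) (y + d • p), p⟫ = s := fun s hs => by
    rw [← neg_inj, ← inner_neg_right]
    refine inner_gradient_eq_of_eventually_eq hdiff ?_
    filter_upwards [hray] with t ht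
    rw [smul_neg, ← sub_eq_add_neg, hs _ ht.1, ht.2, hs _ (Metric.mem_ball_self hd), hyd]
    ring
  have hnorm := norm_gradient_le_of_lipschitzWith (lipschitzWith_signedDist hU) (y + d • p)
  rcases subset_or_disjoint_of_disjoint_frontier (convex_ball _ d).isPreconnected hU hball
    with hb | hb
  · rw [← neg_inj, hν.eq_neg_of_ball_subset hp hd hb, neg_inj]
    refine eq_of_inner_eq_one_of_norm_le hnorm hp (hgrad 1 fun z hz => ?_)
    rw [signedDist, if_pos (hb hz), one_mul]
  · rw [← neg_inj, hν.eq_of_disjoint_ball hp hd hb]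
    refine eq_of_inner_eq_one_of_norm_le (by rwa [norm_neg]) hp ?_
    rw [inner_neg_left, hgrad (-1), neg_neg]
    intro z hz
    rw [signedDist, if_neg (disjoint_left.1 hb hz), neg_one_mul]

theorem gradient_signedDist_eq {x y ν : Rn n} (hU : IsOpen U) (hy : y ∈ frontier U)
    (hxy : Metric.infDist x (frontier U) = dist x y) (hx : x ∉ frontier U)
    (hν : IsNormal U y (-ν)) (hdiff : DifferentiableAt ℝ (signedDist U) x) :
    gradient (signedDist U) x = ν := by
  have hd : 0 < ‖x - y‖ := norm_pos_iff.2 (sub_ne_zero.2 fun h => hx (h ▸ hy))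
  have hx_eq : y + ‖x - y‖ • ‖x - y‖⁻¹ • (x - y) = x := by
    rw [smul_inv_smul₀ hd.ne', add_sub_cancel]
  have hgrad := gradient_signedDist_add_smul (p := ‖x - y‖⁻¹ • (x - y)) hU hy
    (by rw [norm_smul, norm_inv, norm_norm, inv_mul_cancel₀ hd.ne']) hd
    (by rw [hx_eq, hxy, dist_eq_norm]) hν (by rwa [hx_eq])
  rwa [hx_eq] at hgrad

end SignedDist

section Tanh

theorem hasDerivAt_tanh (s : ℝ) : HasDerivAt Real.tanh (1 / Real.cosh s ^ 2) s := by
  have h := (Real.hasDerivAt_sinh s).div (Real.hasDerivAt_cosh s) (Real.cosh_pos s).ne'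
  rw [← sq, ← sq, Real.cosh_sq_sub_sinh_sq] at h
  exact h.congr_of_eventuallyEq (Eventually.of_forall fun s => Real.tanh_eq_sinh_div_cosh s)

theorem one_add_sq_le_cosh_sq (s : ℝ) : 1 + s ^ 2 ≤ Real.cosh s ^ 2 := by
  have hsinh : |s| ≤ |Real.sinh s| := by
    rw [Real.abs_sinh]
    exact Real.self_le_sinh_iff.2 (abs_nonneg s)
  rw [Real.cosh_sq']
  exact add_le_add_right (sq_le_sq.2 hsinh) 1

theorem one_div_cosh_sq_le (s : ℝ) : 1 / Real.cosh s ^ 2 ≤ 1 / (1 + s ^ 2) :=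
  one_div_le_one_div_of_le (by positivity) (one_add_sq_le_cosh_sq s)

theorem tanh_sq (s : ℝ) : Real.tanh s ^ 2 = 1 - 1 / Real.cosh s ^ 2 := by
  have := (Real.cosh_pos s).ne'
  rw [Real.tanh_eq_sinh_div_cosh, div_pow, Real.sinh_sq]
  field_simp

theorem one_sub_tanh_le {s : ℝ} (hs : 0 ≤ s) : 1 - Real.tanh s ≤ 1 / (1 + s ^ 2) := by
  have hnonneg : 0 ≤ Real.tanh s := by
    rw [Real.tanh_eq_sinh_div_cosh]
    exact div_nonneg (Real.sinh_nonneg_iff.2 hs) (Real.cosh_pos s).le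
  nlinarith [tanh_sq s, Real.tanh_lt_one s, one_div_cosh_sq_le s]

theorem lipschitzWith_tanh : LipschitzWith 1 Real.tanh := by
  refine lipschitzWith_of_nnnorm_deriv_le (fun s => (hasDerivAt_tanh s).differentiableAt)
    fun s => ?_
  rw [(hasDerivAt_tanh s).deriv, ← NNReal.coe_le_coe, coe_nnnorm,
    Real.norm_of_nonneg (by positivity), NNReal.coe_one, div_le_one (pow_pos (Real.cosh_pos s) 2)]
  exact one_le_pow₀ (Real.one_le_cosh s)

end Tanh

section PhaseField

variable {n : ℕ} {U : Set (Rn n)} {ε : ℝ}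

theorem phaseField_mem_Icc (x : Rn n) : phaseField U ε x ∈ Icc (0 : ℝ) 1 := by
  have hlt := Real.tanh_lt_one (signedDist U x / ε)
  have hgt := Real.neg_one_lt_tanh (signedDist U x / ε)
  unfold phaseField
  constructor <;> linarith

theorem lipschitzWith_phaseField (hU : IsOpen U) (hε : 0 < ε) :
    LipschitzWith (1 / (2 * ε)).toNNReal (phaseField U ε) := by
  refine LipschitzWith.of_dist_le_mul fun x x' => ?_
  have htanh := lipschitzWith_tanh.dist_le_mul (signedDist U x / ε) (signedDist U x' / ε)
  have hdist := (lipschitzWith_signedDist hU).dist_le_mul x x'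
  rw [NNReal.coe_one, one_mul, Real.dist_eq] at htanh hdist
  rw [Real.dist_eq, ← sub_div, abs_div, abs_of_pos hε] at htanh
  rw [Real.coe_toNNReal _ (by positivity), Real.dist_eq, phaseField, phaseField, ← mul_sub,
    add_sub_add_left_eq_sub, abs_mul, abs_of_pos one_half_pos]
  calc 1 / 2 * |Real.tanh (signedDist U x / ε) - Real.tanh (signedDist U x' / ε)|
      ≤ 1 / 2 * (|signedDist U x - signedDist U x'| / ε) := by gcongr
    _ ≤ 1 / 2 * (dist x x' / ε) := by gcongr
    _ = 1 / (2 * ε) * dist x x' := by field_simp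

theorem gradient_phaseField {x : Rn n} (hd : DifferentiableAt ℝ (signedDist U) x) :
    gradient (phaseField U ε) x =
      (1 / (2 * ε) * (1 / Real.cosh (signedDist U x / ε) ^ 2)) • gradient (signedDist U) x := by
  have hdiv : HasFDerivAt (fun z => signedDist U z / ε) (ε⁻¹ • fderiv ℝ (signedDist U) x) x := by
    simpa only [div_eq_mul_inv] using hd.hasFDerivAt.mul_const ε⁻¹
  have hphase : fderiv ℝ (phaseField U ε) x = _ :=
    (((hasDerivAt_tanh (signedDist U x / ε)).comp_hasFDerivAt x hdiv).const_add 1).const_mul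
      (1 / 2) |>.fderiv
  rw [gradient, hphase, gradient]
  simp only [map_smul, smul_smul]
  congr 1
  ring

theorem abs_phaseField_sub_indicator_le (hε : 0 < ε) (x : Rn n) :
    |phaseField U ε x - U.indicator (fun _ => 1) x| ≤
      1 / (1 + (Metric.infDist x (frontier U) / ε) ^ 2) := by
  set s := Metric.infDist x (frontier U) / ε with hs
  have hle := one_sub_tanh_le (s := s) (div_nonneg Metric.infDist_nonneg hε.le)
  have hlt := Real.tanh_lt_one s
  unfold phaseField signedDist
  by_cases hx : x ∈ U
  · rw [if_pos hx, indicator_of_mem hx, ← hs, abs_le]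
    constructor <;> linarith
  · rw [if_neg hx, indicator_of_notMem hx, neg_div, ← hs, Real.tanh_neg, abs_le]
    constructor <;> linarith

theorem abs_one_sub_inner_le {E F : Type*} [PseudoMetricSpace E] [NormedAddCommGroup F]
    [InnerProductSpace ℝ F] {X : E → F} {L : NNReal} (hX : LipschitzWith L X) {y : E}
    (hy : ‖X y‖ = 1) (x : E) : |1 - ⟪X y, X x⟫| ≤ L * dist x y := by
  have h : 1 - ⟪X y, X x⟫ = ⟪X y, X y - X x⟫ := by
    rw [inner_sub_right, real_inner_self_eq_norm_sq, hy, one_pow]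
  calc |1 - ⟪X y, X x⟫| ≤ ‖X y‖ * ‖X y - X x‖ := h ▸ abs_real_inner_le_norm _ _
    _ = dist (X x) (X y) := by rw [hy, one_mul, dist_comm, dist_eq_norm]
    _ ≤ L * dist x y := hX.dist_le_mul x y

/-- The defect between the diffuse surface density `|∇φ_ε|` and its representation `∇φ_ε · X` by
a field `X` extending the inward unit normal. -/
def densityDefect (U : Set (Rn n)) (X : Rn n → Rn n) (ε : ℝ) (x : Rn n) : ℝ :=
  ‖gradient (phaseField U ε) x‖ - ⟪gradient (phaseField U ε) x, X x⟫

theorem abs_densityDefect_le (hU : IsOpen U) (hne : (frontier U).Nonempty)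
    (hε : 0 < ε) {X : Rn n → Rn n} {L : NNReal} (hX : LipschitzWith L X)
    (hnormal : ∀ y ∈ frontier U, IsNormal U y (-X y)) {x : Rn n} (hx : x ∉ frontier U)
    (hd : DifferentiableAt ℝ (signedDist U) x) :
    |densityDefect U X ε x| ≤
      L * ((Metric.infDist x (frontier U) / ε) /
        (1 + (Metric.infDist x (frontier U) / ε) ^ 2)) := by
  obtain ⟨y, hy, hxy⟩ := isClosed_frontier.exists_infDist_eq_dist hne x
  have hXy : ‖X y‖ = 1 := by simpa only [norm_neg] using (hnormal y hy).1
  set d := Metric.infDist x (frontier U)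
  set k : ℝ := 1 / (2 * ε) * (1 / Real.cosh (signedDist U x / ε) ^ 2)
  have hd0 : 0 ≤ d := Metric.infDist_nonneg
  have hk0 : 0 ≤ k := by
    have := Real.cosh_pos (signedDist U x / ε)
    positivity
  have hk_le : k ≤ 1 / (2 * ε) * (1 / (1 + (d / ε) ^ 2)) := by
    have hsq : (signedDist U x / ε) ^ 2 = (d / ε) ^ 2 := by
      rw [← sq_abs, abs_div, abs_signedDist, abs_of_pos hε]
    rw [← hsq]
    exact mul_le_mul_of_nonneg_left (one_div_cosh_sq_le _) (by positivity)
  rw [densityDefect, gradient_phaseField hd,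
    gradient_signedDist_eq hU hy hxy hx (hnormal y hy) hd, norm_smul,
    hXy, real_inner_smul_left, Real.norm_of_nonneg hk0, ← mul_sub, abs_mul, abs_of_nonneg hk0]
  calc k * |1 - ⟪X y, X x⟫|
      ≤ 1 / (2 * ε) * (1 / (1 + (d / ε) ^ 2)) * (L * d) := by
        gcongr
        exact hxy ▸ abs_one_sub_inner_le hX hXy x
    _ = L * ((d / ε) / (1 + (d / ε) ^ 2)) / 2 := by field_simp
    _ ≤ L * ((d / ε) / (1 + (d / ε) ^ 2)) := half_le_self (by positivity)

end PhaseField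

section IntegrationByParts

theorem measurable_gradient {E : Type*} [NormedAddCommGroup E] [InnerProductSpace ℝ E]
    [CompleteSpace E] [MeasurableSpace E] [BorelSpace E] (φ : E → ℝ) : Measurable (gradient φ) :=
  (InnerProductSpace.toDual ℝ E).symm.continuous.measurable.comp (measurable_fderiv ℝ φ)

theorem integral_fderiv_mul_eq_neg {E : Type*} [NormedAddCommGroup E] [NormedSpace ℝ E]
    [FiniteDimensional ℝ E] [MeasurableSpace E] [BorelSpace E] {μ : Measure E} [μ.IsAddHaarMeasure]
    {φ w : E → ℝ} {C : NNReal} (hφ : LipschitzWith C φ) (hw : ContDiff ℝ 1 w)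
    (hwc : HasCompactSupport w) (e : E) :
    ∫ x, fderiv ℝ φ x e * w x ∂μ = -∫ x, φ x * fderiv ℝ w x e ∂μ := by
  obtain ⟨D, hD⟩ := ContDiff.lipschitzWith_of_hasCompactSupport hwc hw one_ne_zero
  have hline : ∫ x, fderiv ℝ φ x e * w x ∂μ = ∫ x, lineDeriv ℝ φ x e * w x ∂μ := by
    refine integral_congr_ae ?_
    filter_upwards [hφ.ae_differentiableAt] with x hx
    rw [hx.lineDeriv_eq_fderiv]
  rw [hline, hφ.integral_lineDeriv_mul_eq hD hwc e, ← integral_neg]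
  congr 1 with x
  rw [(hw.differentiable one_ne_zero x).lineDeriv_eq_fderiv, map_neg, neg_mul, mul_comm]

variable {n : ℕ}

theorem inner_gradient_eq_sum (φ : Rn n → ℝ) (x v : Rn n) :
    ⟪gradient φ x, v⟫ = ∑ i, fderiv ℝ φ x (EuclideanSpace.single i 1) * v i := by
  rw [inner_gradient_left]
  conv_lhs => rw [← (EuclideanSpace.basisFun (Fin n) ℝ).sum_repr v]
  simp only [map_sum, map_smul, EuclideanSpace.basisFun_repr, EuclideanSpace.basisFun_apply,
    smul_eq_mul, mul_comm]

theorem integral_inner_gradient_eq_neg {φ : Rn n → ℝ} {C : NNReal} (hφ : LipschitzWith C φ)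
    {Y : Rn n → Rn n} (hY : ContDiff ℝ 1 Y) (hYc : HasCompactSupport Y) :
    ∫ x, ⟪gradient φ x, Y x⟫ = -∫ x, φ x * divergence Y x := by
  have hgradient : ∀ i, Integrable fun x =>
      fderiv ℝ φ x (EuclideanSpace.single i 1) * Y x i := fun i =>
    ((contDiff_coord hY i).continuous.integrable_of_hasCompactSupport
      (hasCompactSupport_coord hYc i)).bdd_mul (c := C)
      (measurable_fderiv_apply_const ℝ φ _).aestronglyMeasurable
      (Eventually.of_forall fun x => by
        simpa using (fderiv ℝ φ x).le_of_opNorm_le (norm_fderiv_le_of_lipschitz ℝ hφ)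
          (EuclideanSpace.single i 1))
  have hdivergence : ∀ i, Integrable fun x =>
      φ x * fderiv ℝ (fun z => Y z i) x (EuclideanSpace.single i 1) := fun i =>
    (hφ.continuous.mul (((contDiff_coord hY i).continuous_fderiv one_ne_zero).clm_apply
      continuous_const)).integrable_of_hasCompactSupport
      ((hasCompactSupport_coord hYc i).fderiv_apply (𝕜 := ℝ) _).mul_left
  simp only [inner_gradient_eq_sum, divergence, Finset.mul_sum]
  rw [integral_finsetSum _ fun i _ => hgradient i, integral_finsetSum _ fun i _ => hdivergence i,
    ← Finset.sum_neg_distrib]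
  exact Finset.sum_congr rfl fun i _ => integral_fderiv_mul_eq_neg hφ (contDiff_coord hY i)
    (hasCompactSupport_coord hYc i) _

end IntegrationByParts

section Mollification

open scoped Convolution ENNReal
open ContinuousLinearMap (lsmul)
open Module (finrank)

variable {E F : Type*} [NormedAddCommGroup E] [NormedSpace ℝ E] [FiniteDimensional ℝ E]
  [MeasurableSpace E] [BorelSpace E] {μ : Measure E} [μ.IsAddHaarMeasure]
  [NormedAddCommGroup F]

theorem lintegral_ofReal_normed (φ : ContDiffBump (0 : E)) :
    ∫⁻ t, ENNReal.ofReal (φ.normed μ t) ∂μ = 1 := by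
  rw [← ofReal_integral_eq_lintegral_ofReal φ.integrable_normed
    (Eventually.of_forall φ.nonneg_normed), φ.integral_normed, ENNReal.ofReal_one]

theorem enorm_convolution_normed_rpow_le [NormedSpace ℝ F] (φ : ContDiffBump (0 : E))
    {f : E → F} (hf : AEStronglyMeasurable f μ) {p : NNReal} (hp : 1 ≤ p) (x : E) :
    ‖(φ.normed μ ⋆[lsmul ℝ ℝ, μ] f) x‖ₑ ^ (p : ℝ) ≤
      ∫⁻ t, ENNReal.ofReal (φ.normed μ t) * ‖f (x - t)‖ₑ ^ (p : ℝ) ∂μ := by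
  have hη : AEMeasurable (fun t => ENNReal.ofReal (φ.normed μ t)) μ :=
    φ.continuous_normed.measurable.ennreal_ofReal.aemeasurable
  set ν := μ.withDensity fun t => ENNReal.ofReal (φ.normed μ t) with hν
  have : IsProbabilityMeasure ν := ⟨by
    rw [hν, withDensity_apply _ MeasurableSet.univ, Measure.restrict_univ,
      lintegral_ofReal_normed]⟩
  have hfx : AEStronglyMeasurable (fun t => f (x - t)) μ :=
    hf.comp_quasiMeasurePreserving (quasiMeasurePreserving_sub_left μ x)
  have h_one : ‖(φ.normed μ ⋆[lsmul ℝ ℝ, μ] f) x‖ₑ ≤ eLpNorm (fun t => f (x - t)) 1 ν := by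
    rw [convolution_def, eLpNorm_one_eq_lintegral_enorm, hν,
      lintegral_withDensity_eq_lintegral_mul₀ hη hfx.enorm]
    refine (enorm_integral_le_lintegral_enorm _).trans (le_of_eq (lintegral_congr fun t => ?_))
    rw [ContinuousLinearMap.lsmul_apply, enorm_smul, Pi.mul_apply,
      Real.enorm_of_nonneg (φ.nonneg_normed t)]
  have h_jensen := h_one.trans (eLpNorm_le_eLpNorm_of_exponent_le
    (by exact_mod_cast hp : (1 : ℝ≥0∞) ≤ p)
    (hfx.mono_ac (withDensity_absolutelyContinuous μ _)))
  refine (ENNReal.rpow_le_rpow h_jensen p.coe_nonneg).trans (le_of_eq ?_)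
  rw [eLpNorm_nnreal_pow_eq_lintegral (zero_lt_one.trans_le hp).ne', hν,
    lintegral_withDensity_eq_lintegral_mul₀ hη (hfx.enorm.pow_const _)]
  rfl

theorem eLpNorm_convolution_normed_le [NormedSpace ℝ F] (φ : ContDiffBump (0 : E))
    {f : E → F} (hf : AEStronglyMeasurable f μ) {p : ℝ≥0∞} (hp : 1 ≤ p) (hp' : p ≠ ⊤) :
    eLpNorm (φ.normed μ ⋆[lsmul ℝ ℝ, μ] f) p μ ≤ eLpNorm f p μ := by
  lift p to NNReal using hp'
  have hp₁ : 1 ≤ p := by exact_mod_cast hp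
  have hp₀ : 0 < p := zero_lt_one.trans_le hp₁
  have hη : Measurable fun t => ENNReal.ofReal (φ.normed μ t) :=
    φ.continuous_normed.measurable.ennreal_ofReal
  rw [← ENNReal.rpow_le_rpow_iff (NNReal.coe_pos.2 hp₀),
    eLpNorm_nnreal_pow_eq_lintegral hp₀.ne', eLpNorm_nnreal_pow_eq_lintegral hp₀.ne']
  calc ∫⁻ x, ‖(φ.normed μ ⋆[lsmul ℝ ℝ, μ] f) x‖ₑ ^ (p : ℝ) ∂μ
      ≤ ∫⁻ x, ∫⁻ t, ENNReal.ofReal (φ.normed μ t) * ‖f (x - t)‖ₑ ^ (p : ℝ) ∂μ ∂μ :=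
        lintegral_mono fun x => enorm_convolution_normed_rpow_le φ hf hp₁ x
    _ = ∫⁻ t, ∫⁻ x, ENNReal.ofReal (φ.normed μ t) * ‖f (x - t)‖ₑ ^ (p : ℝ) ∂μ ∂μ := by
        refine lintegral_lintegral_swap ?_
        exact (hη.comp measurable_snd).aemeasurable.mul
          ((hf.comp_quasiMeasurePreserving
            (quasiMeasurePreserving_sub_of_right_invariant μ μ)).enorm.pow_const _)
    _ = ∫⁻ t, ENNReal.ofReal (φ.normed μ t) * ∫⁻ x, ‖f x‖ₑ ^ (p : ℝ) ∂μ ∂μ := by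
        refine lintegral_congr fun t => ?_
        rw [lintegral_const_mul' _ _ ENNReal.ofReal_ne_top,
          lintegral_sub_right_eq_self (fun x => ‖f x‖ₑ ^ (p : ℝ)) t]
    _ = ∫⁻ x, ‖f x‖ₑ ^ (p : ℝ) ∂μ := by
        rw [lintegral_mul_const _ hη, lintegral_ofReal_normed, one_mul]

theorem eLpNorm_comp_dilation (c : E) {l : ℝ} (hl : l ≠ 0) {g : E → F}
    (hg : AEStronglyMeasurable g μ) (p : ℝ≥0∞) :
    eLpNorm (fun x => g (c + l • (x - c))) p μ =
      ENNReal.ofReal |(l ^ finrank ℝ E)⁻¹| ^ (1 / p).toReal * eLpNorm g p μ := by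
  have hmap : μ.map (fun x => c + l • (x - c)) =
      ENNReal.ofReal |(l ^ finrank ℝ E)⁻¹| • μ := by
    have hcomp : (fun x : E => c + l • (x - c)) =
        (fun x => (c - l • c) + x) ∘ (fun x => l • x) := by
      funext x
      simp only [Function.comp_apply, smul_sub]
      abel
    rw [hcomp, ← Measure.map_map (by fun_prop) (by fun_prop), Measure.map_addHaar_smul _ hl,
      Measure.map_smul, map_add_left_eq_self]
  have hg' : AEStronglyMeasurable g (μ.map fun x => c + l • (x - c)) :=
    hmap ▸ hg.mono_ac Measure.smul_absolutelyContinuous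
  have h := eLpNorm_map_measure (p := p) hg' (by fun_prop)
  rw [hmap, eLpNorm_smul_measure_of_ne_zero (by simp [hl]), smul_eq_mul] at h
  exact h.symm

theorem tendsto_eLpNorm_sub_of_tendstoUniformlyOn {ι α : Type*} {m : MeasurableSpace α}
    {ν : Measure α} {𝓕 : Filter ι} {s : Set α} (hs : MeasurableSet s) (hνs : ν s ≠ ⊤)
    {f : ι → α → F} {g : α → F} (h : TendstoUniformlyOn f g 𝓕 s) {p : ℝ≥0∞} :
    Tendsto (fun i => eLpNorm (f i - g) p (ν.restrict s)) 𝓕 (𝓝 0) := by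
  set V := ν s ^ p.toReal⁻¹
  have hV : V ≠ ⊤ := ENNReal.rpow_ne_top_of_nonneg (inv_nonneg.2 ENNReal.toReal_nonneg) hνs
  have hlim : Tendsto (fun δ : ℝ => V * ENNReal.ofReal δ) (𝓝[>] 0) (𝓝 0) := by
    have : Tendsto (fun δ : ℝ => V * ENNReal.ofReal δ) (𝓝 0) (𝓝 (V * ENNReal.ofReal 0)) :=
      ENNReal.Tendsto.const_mul (ENNReal.tendsto_ofReal tendsto_id) (Or.inr hV)
    rw [ENNReal.ofReal_zero, mul_zero] at this
    exact this.mono_left nhdsWithin_le_nhds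
  rw [ENNReal.tendsto_nhds_zero]
  intro ε hε
  obtain ⟨δ, hδε, hδ⟩ := ((ENNReal.tendsto_nhds_zero.1 hlim ε hε).and self_mem_nhdsWithin).exists
  filter_upwards [Metric.tendstoUniformlyOn_iff.1 h δ hδ] with i hi
  refine (eLpNorm_le_of_ae_bound (C := δ) ?_).trans (le_of_eq_of_le ?_ hδε)
  · filter_upwards [ae_restrict_mem hs] with x hx
    rw [Pi.sub_apply, ← dist_eq_norm, dist_comm]
    exact (hi x hx).le
  · rw [Measure.restrict_apply_univ]

variable [NormedSpace ℝ F]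

/-- The mollification of `f` by the normalised bump `φ`, composed with the dilation of ratio `l`
about `c`. On a domain that is star-shaped about `c`, taking `l < 1` makes room for the
mollification. -/
def dilateMollify (μ : Measure E) (φ : ContDiffBump (0 : E)) (c : E) (l : ℝ) (f : E → F) (x : E) :
    F :=
  (φ.normed μ ⋆[lsmul ℝ ℝ, μ] f) (c + l • (x - c))

theorem contDiff_dilateMollify (φ : ContDiffBump (0 : E)) (c : E) (l : ℝ)
    {f : E → F} (hf : LocallyIntegrable f μ) : ContDiff ℝ ∞ (dilateMollify μ φ c l f) :=
  (φ.hasCompactSupport_normed.contDiff_convolution_left _ φ.contDiff_normed hf).comp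
    (by fun_prop : ContDiff ℝ ∞ fun x : E => c + l • (x - c))

theorem dilateMollify_sub (φ : ContDiffBump (0 : E)) (c : E) (l : ℝ) {f g : E → F}
    (hf : LocallyIntegrable f μ) (hg : LocallyIntegrable g μ) :
    dilateMollify μ φ c l (f - g) = dilateMollify μ φ c l f - dilateMollify μ φ c l g := by
  have hexists (f : E → F) (hf : LocallyIntegrable f μ) :
      ConvolutionExists (φ.normed μ) f (lsmul ℝ ℝ) μ :=
    φ.hasCompactSupport_normed.convolutionExists_left _ φ.continuous_normed hf
  have hadd := (hexists _ (hf.sub hg)).distrib_add (hexists _ hg)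
  rw [sub_add_cancel] at hadd
  funext x
  exact eq_sub_of_add_eq (congrFun hadd _).symm

theorem eLpNorm_dilateMollify_le (φ : ContDiffBump (0 : E)) (c : E) {l : ℝ} (hl : l ≠ 0)
    {p : ℝ≥0∞} (hp : 1 ≤ p) (hp' : p ≠ ⊤) {f : E → F} (hf : MemLp f p μ) :
    eLpNorm (dilateMollify μ φ c l f) p μ ≤
      ENNReal.ofReal |(l ^ finrank ℝ E)⁻¹| ^ (1 / p).toReal * eLpNorm f p μ := by
  have hcont : Continuous (φ.normed μ ⋆[lsmul ℝ ℝ, μ] f) :=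
    φ.hasCompactSupport_normed.continuous_convolution_left _ φ.continuous_normed
      (hf.locallyIntegrable hp)
  refine (eLpNorm_comp_dilation c hl hcont.aestronglyMeasurable p).trans_le ?_
  gcongr
  exact eLpNorm_convolution_normed_le φ hf.aestronglyMeasurable hp hp'

variable {ι : Type*} {𝓕 : Filter ι} {Ω : Set E} {l : ι → ℝ} {φ : ι → ContDiffBump (0 : E)}

theorem tendstoUniformlyOn_dilateMollify [CompleteSpace F] (hΩ : Bornology.IsBounded Ω) (c : E)
    (hl : Tendsto l 𝓕 (𝓝 1)) (hφ : Tendsto (fun i => (φ i).rOut) 𝓕 (𝓝 0)) {g : E → F}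
    (hg : UniformContinuous g) :
    TendstoUniformlyOn (fun i => dilateMollify μ (φ i) c (l i) g) g 𝓕 Ω := by
  rw [Metric.tendstoUniformlyOn_iff]
  intro δ hδ
  obtain ⟨D, hD⟩ := hΩ.subset_closedBall c
  obtain ⟨ρ, hρ, hgρ⟩ := Metric.uniformContinuous_iff.1 hg (δ / 2) (half_pos hδ)
  have hlD : Tendsto (fun i => |l i - 1| * D) 𝓕 (𝓝 0) := by
    simpa using ((hl.sub_const 1).abs).mul_const D
  filter_upwards [hφ.eventually_lt_const hρ, hlD.eventually_lt_const hρ] with i hφi hli x hx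
  have hmollify : dist (dilateMollify μ (φ i) c (l i) g x) (g (c + l i • (x - c))) ≤ δ / 2 :=
    (φ i).dist_normed_convolution_le hg.continuous.aestronglyMeasurable fun z hz =>
      (hgρ (lt_trans hz hφi)).le
  have hdilate : dist (g (c + l i • (x - c))) (g x) < δ / 2 := by
    refine hgρ ?_
    have hsub : c + l i • (x - c) - x = (l i - 1) • (x - c) := by module
    rw [dist_eq_norm, hsub, norm_smul, Real.norm_eq_abs]
    exact (mul_le_mul_of_nonneg_left (mem_closedBall_iff_norm.1 (hD hx)) (abs_nonneg _)).trans_lt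
      hli
  rw [dist_comm]
  linarith [dist_triangle (dilateMollify μ (φ i) c (l i) g x) (g (c + l i • (x - c))) (g x)]

theorem eLpNorm_dilateMollify_sub_restrict_le (φ : ContDiffBump (0 : E)) (c : E) (l : ℝ)
    {p : ℝ≥0∞} (hp : 1 ≤ p) {f g : E → F} (hf : MemLp f p μ) (hg : MemLp g p μ) :
    eLpNorm (dilateMollify μ φ c l f - f) p (μ.restrict Ω) ≤
      eLpNorm (dilateMollify μ φ c l (f - g)) p μ +
        (eLpNorm (dilateMollify μ φ c l g - g) p (μ.restrict Ω) + eLpNorm (f - g) p μ) := by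
  have hA {u : E → F} (hu : MemLp u p μ) :
      AEStronglyMeasurable (dilateMollify μ φ c l u) (μ.restrict Ω) :=
    (contDiff_dilateMollify _ _ _ (hu.locallyIntegrable hp)).continuous.aestronglyMeasurable
  have hfm := hf.aestronglyMeasurable.restrict (s := Ω)
  have hgm := hg.aestronglyMeasurable.restrict (s := Ω)
  have hsplit : dilateMollify μ φ c l f - f =
      dilateMollify μ φ c l (f - g) + ((dilateMollify μ φ c l g - g) + (g - f)) := by
    rw [dilateMollify_sub _ _ _ (hf.locallyIntegrable hp) (hg.locallyIntegrable hp)]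
    abel
  rw [hsplit, eLpNorm_sub_comm f g]
  refine (eLpNorm_add_le (hA (hf.sub hg)) (((hA hg).sub hgm).add (hgm.sub hfm)) hp).trans
    (add_le_add (eLpNorm_mono_measure _ Measure.restrict_le_self) ?_)
  exact (eLpNorm_add_le ((hA hg).sub hgm) (hgm.sub hfm) hp).trans
    (add_le_add_right (eLpNorm_mono_measure _ Measure.restrict_le_self) _)

theorem tendsto_eLpNorm_dilateMollify_sub [CompleteSpace F] (hΩ : Bornology.IsBounded Ω)
    (hΩm : MeasurableSet Ω) (c : E) (hl : Tendsto l 𝓕 (𝓝 1))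
    (hφ : Tendsto (fun i => (φ i).rOut) 𝓕 (𝓝 0)) {p : ℝ≥0∞} (hp : 1 ≤ p) (hp' : p ≠ ⊤)
    {f : E → F} (hf : MemLp f p μ) :
    Tendsto (fun i => eLpNorm (dilateMollify μ (φ i) c (l i) f - f) p (μ.restrict Ω)) 𝓕
      (𝓝 0) := by
  rw [ENNReal.tendsto_nhds_zero]
  intro ε hε
  have hε₄ : 0 < ε / 4 := ENNReal.div_pos hε.ne' (by simp)
  obtain ⟨g, hgc, hfg, hg, hgp⟩ := hf.exists_hasCompactSupport_eLpNorm_sub_le hp' hε₄.ne'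
  have hscale : Tendsto (fun i => ENNReal.ofReal |(l i ^ finrank ℝ E)⁻¹| ^ (1 / p).toReal) 𝓕
      (𝓝 1) := by
    have h := (((hl.pow (finrank ℝ E)).inv₀ (by simp)).abs)
    simpa using ((ENNReal.tendsto_ofReal h).ennrpow_const (1 / p).toReal)
  have hunif := tendsto_eLpNorm_sub_of_tendstoUniformlyOn hΩm hΩ.measure_lt_top.ne
    (tendstoUniformlyOn_dilateMollify (μ := μ) hΩ c hl hφ
      (hgc.uniformContinuous_of_continuous hg)) (ν := μ) (p := p)
  filter_upwards [hl.eventually_ne one_ne_zero, hscale.eventually_le_const ENNReal.one_lt_two,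
    ENNReal.tendsto_nhds_zero.1 hunif _ hε₄] with i hli hsi hgi
  have hfar : eLpNorm (dilateMollify μ (φ i) c (l i) (f - g)) p μ ≤ 2 * (ε / 4) :=
    (eLpNorm_dilateMollify_le _ c hli hp hp' (hf.sub hgp)).trans (mul_le_mul' hsi hfg)
  calc eLpNorm (dilateMollify μ (φ i) c (l i) f - f) p (μ.restrict Ω)
      ≤ 2 * (ε / 4) + (ε / 4 + ε / 4) :=
        (eLpNorm_dilateMollify_sub_restrict_le _ c _ hp hf hgp).trans
          (add_le_add hfar (add_le_add hgi hfg))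
    _ = ε := by
        rw [← two_mul, ← add_mul, show (2 : ℝ≥0∞) + 2 = 4 by norm_num]
        exact ENNReal.mul_div_cancel (by simp) (by simp)

end Mollification

section SmoothApproximation

open scoped Convolution Pointwise
open ContinuousLinearMap (lsmul)

theorem closedBall_dilation_subset_of_convex {E : Type*} [NormedAddCommGroup E] [NormedSpace ℝ E]
    {s : Set E} (hs : Convex ℝ s) {c x : E} {r t : ℝ} (hc : Metric.closedBall c r ⊆ s)
    (hx : x ∈ s) (hr : 0 ≤ r) (ht : t ∈ Icc (0 : ℝ) 1) :
    Metric.closedBall (c + (1 - t) • (x - c)) (t * r) ⊆ s := by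
  have hball : Metric.closedBall (c + (1 - t) • (x - c)) (t * r) =
      (1 - t) • {x} + t • Metric.closedBall c r := by
    rw [smul_set_singleton, smul_closedBall _ _ hr, singleton_add_closedBall,
      Real.norm_of_nonneg ht.1]
    congr 1
    module
  rw [hball]
  exact (add_subset_add (smul_set_mono (singleton_subset_iff.2 hx)) (smul_set_mono hc)).trans
    (hs.set_combo_subset (sub_nonneg.2 ht.2) ht.1 (by ring))

theorem tendsto_eLpNorm_smul_sub {ι α F : Type*} [NormedAddCommGroup F] [NormedSpace ℝ F]
    {m : MeasurableSpace α} {μ : Measure α} {𝓕 : Filter ι} {p : ENNReal} (hp : 1 ≤ p)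
    {a : ι → ℝ} (ha : Tendsto a 𝓕 (𝓝 1)) {f : ι → α → F}
    (hf : ∀ i, AEStronglyMeasurable (f i) μ) {g : α → F} (hg : MemLp g p μ)
    (h : Tendsto (fun i => eLpNorm (f i - g) p μ) 𝓕 (𝓝 0)) :
    Tendsto (fun i => eLpNorm (a i • f i - g) p μ) 𝓕 (𝓝 0) := by
  have hbound (i : ι) : eLpNorm (a i • f i - g) p μ ≤
      ‖a i‖ₑ * eLpNorm (f i - g) p μ + ‖a i - 1‖ₑ * eLpNorm g p μ := by
    have hsplit : a i • f i - g = a i • (f i - g) + (a i - 1) • g := by module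
    rw [hsplit, ← eLpNorm_const_smul, ← eLpNorm_const_smul]
    exact eLpNorm_add_le (((hf i).sub hg.aestronglyMeasurable).const_smul _)
      (hg.aestronglyMeasurable.const_smul _) hp
  have hlim : Tendsto (fun i => ‖a i‖ₑ * eLpNorm (f i - g) p μ + ‖a i - 1‖ₑ * eLpNorm g p μ) 𝓕
      (𝓝 (‖(1 : ℝ)‖ₑ * 0 + ‖(1 : ℝ) - 1‖ₑ * eLpNorm g p μ)) :=
    (ENNReal.Tendsto.mul ha.enorm (Or.inr (by simp)) h (Or.inr (by simp))).add
      (ENNReal.Tendsto.mul_const (ha.sub_const 1).enorm (Or.inr hg.eLpNorm_lt_top.ne))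
  rw [sub_self, enorm_zero, zero_mul, mul_zero, add_zero] at hlim
  exact tendsto_of_tendsto_of_tendsto_of_le_of_le tendsto_const_nhds hlim (fun _ => zero_le)
    hbound

theorem convolution_indicator {E F E' F' : Type*} [AddCommGroup E] [MeasurableSpace E]
    [MeasurableAdd₂ E] [MeasurableNeg E] {μ : Measure E} [μ.IsAddLeftInvariant] [μ.IsNegInvariant]
    [NormedAddCommGroup F] [NormedSpace ℝ F] [NormedAddCommGroup E'] [NormedSpace ℝ E']
    [NormedAddCommGroup F'] [NormedSpace ℝ F'] (L : E' →L[ℝ] F →L[ℝ] F') (η : E → E') (f : E → F)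
    {s : Set E} (hs : MeasurableSet s) (x : E) :
    (η ⋆[L, μ] s.indicator f) x = ∫ y in s, L (η (x - y)) (f y) ∂μ := by
  rw [convolution_eq_swap, ← integral_indicator hs]
  congr 1 with y
  by_cases hy : y ∈ s <;> simp [hy]

theorem fderiv_comp_const_sub_apply {E : Type*} [NormedAddCommGroup E] [NormedSpace ℝ E]
    {η : E → ℝ} (hη : Differentiable ℝ η) (x y v : E) :
    fderiv ℝ (fun z => η (x - z)) y v = -fderiv ℝ η (x - y) v := by
  have h := (hη (x - y)).hasFDerivAt.comp y ((hasFDerivAt_id y).const_sub x)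
  rw [show fderiv ℝ (fun z => η (x - z)) y = _ from h.fderiv]
  simp

variable {n : ℕ} {Ω : Set (Rn n)} {u : Rn n → ℝ} {G : Rn n → Rn n}

theorem tsupport_normed_comp_const_sub_subset (φ : ContDiffBump (0 : Rn n)) (p : Rn n) :
    tsupport (fun y => φ.normed volume (p - y)) ⊆ Metric.closedBall p φ.rOut := by
  refine closure_minimal (fun y hy => ?_) Metric.isClosed_closedBall
  have hpy : p - y ∈ Function.support (φ.normed volume) := hy
  rw [φ.support_normed_eq, mem_ball_zero_iff, ← dist_eq_norm, dist_comm] at hpy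
  exact hpy.le

theorem fderiv_convolution_normed_indicator_apply (hΩ : MeasurableSet Ω)
    (hu : LocallyIntegrable (Ω.indicator u) volume) (φ : ContDiffBump (0 : Rn n)) (p e : Rn n) :
    (fderiv ℝ (φ.normed volume) ⋆[(lsmul ℝ ℝ).precompL (Rn n), volume] Ω.indicator u) p e =
      -∫ y in Ω, u y * fderiv ℝ (fun z => φ.normed volume (p - z)) y e := by
  set η := φ.normed (volume : Measure (Rn n))
  have hη : ContDiff ℝ ∞ η := φ.contDiff_normed
  have hconv : ConvolutionExistsAt (fderiv ℝ η) (Ω.indicator u) p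
      ((lsmul ℝ ℝ).precompL (Rn n)) volume :=
    (φ.hasCompactSupport_normed.fderiv (𝕜 := ℝ)).convolutionExists_left _
      (hη.continuous_fderiv (by simp)) hu p
  calc (fderiv ℝ η ⋆[(lsmul ℝ ℝ).precompL (Rn n), volume] Ω.indicator u) p e
      = ((fderiv ℝ η · e) ⋆[lsmul ℝ ℝ, volume] Ω.indicator u) p :=
        ContinuousLinearMap.integral_apply hconv e
    _ = -∫ y in Ω, u y * fderiv ℝ (fun z => η (p - z)) y e := by
        rw [convolution_indicator _ _ _ hΩ, ← integral_neg]
        congr 1 with y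
        rw [fderiv_comp_const_sub_apply (hη.differentiable (by simp)),
          ContinuousLinearMap.lsmul_apply, smul_eq_mul]
        ring

theorem convolution_normed_indicator_apply (hΩ : MeasurableSet Ω)
    (hG : LocallyIntegrable (Ω.indicator G) volume) (φ : ContDiffBump (0 : Rn n)) (p : Rn n)
    (i : Fin n) :
    (φ.normed volume ⋆[lsmul ℝ ℝ, volume] Ω.indicator G) p i =
      ∫ y in Ω, G y i * φ.normed volume (p - y) := by
  have hconv : ConvolutionExistsAt (φ.normed volume) (Ω.indicator G) p (lsmul ℝ ℝ) volume :=
    φ.hasCompactSupport_normed.convolutionExists_left _ φ.continuous_normed hG p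
  calc (φ.normed volume ⋆[lsmul ℝ ℝ, volume] Ω.indicator G) p i
      = (φ.normed volume ⋆[lsmul ℝ ℝ, volume] Ω.indicator (G · i)) p := by
        refine ((EuclideanSpace.proj i : Rn n →L[ℝ] ℝ).integral_comp_comm hconv).symm.trans ?_
        refine integral_congr_ae (Eventually.of_forall fun y => ?_)
        by_cases hy : p - y ∈ Ω <;> simp [hy]
    _ = ∫ y in Ω, G y i * φ.normed volume (p - y) := by
        rw [convolution_indicator _ _ _ hΩ]
        simp only [ContinuousLinearMap.lsmul_apply, smul_eq_mul, mul_comm]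

theorem fderiv_convolution_normed_indicator_single (hΩ : MeasurableSet Ω)
    (hu : LocallyIntegrable (Ω.indicator u) volume)
    (hG : LocallyIntegrable (Ω.indicator G) volume) (huG : IsWeakGradient Ω u G)
    (φ : ContDiffBump (0 : Rn n)) {p : Rn n} (hp : Metric.closedBall p φ.rOut ⊆ Ω) (i : Fin n) :
    (fderiv ℝ (φ.normed volume) ⋆[(lsmul ℝ ℝ).precompL (Rn n), volume] Ω.indicator u) p
        (EuclideanSpace.single i 1) =
      (φ.normed volume ⋆[lsmul ℝ ℝ, volume] Ω.indicator G) p i := by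
  have hsupp := tsupport_normed_comp_const_sub_subset φ p
  have htest := huG (fun y => φ.normed volume (p - y))
    (φ.contDiff_normed.comp (contDiff_const.sub contDiff_id))
    ((isCompact_closedBall p φ.rOut).of_isClosed_subset (isClosed_tsupport _) hsupp)
    (hsupp.trans hp) i
  rw [fderiv_convolution_normed_indicator_apply hΩ hu, convolution_normed_indicator_apply hΩ hG,
    htest, neg_neg]

theorem hasGradientAt_convolution_normed_indicator (hΩ : MeasurableSet Ω)
    (hu : LocallyIntegrable (Ω.indicator u) volume)
    (hG : LocallyIntegrable (Ω.indicator G) volume) (huG : IsWeakGradient Ω u G)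
    (φ : ContDiffBump (0 : Rn n)) {p : Rn n} (hp : Metric.closedBall p φ.rOut ⊆ Ω) :
    HasGradientAt (φ.normed volume ⋆[lsmul ℝ ℝ, volume] Ω.indicator u)
      ((φ.normed volume ⋆[lsmul ℝ ℝ, volume] Ω.indicator G) p) p := by
  have hderiv := φ.hasCompactSupport_normed.hasFDerivAt_convolution_left (lsmul ℝ ℝ)
    (φ.contDiff_normed (n := 1) (μ := volume)) hu p
  rw [hasGradientAt_iff_hasFDerivAt]
  refine hderiv.congr_fderiv (ContinuousLinearMap.coe_injective
    ((EuclideanSpace.basisFun (Fin n) ℝ).toBasis.ext fun i => ?_))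
  simpa [EuclideanSpace.inner_single_right] using
    fderiv_convolution_normed_indicator_single hΩ hu hG huG φ hp i

theorem gradient_dilateMollify_indicator (hΩ : MeasurableSet Ω)
    (hu : LocallyIntegrable (Ω.indicator u) volume)
    (hG : LocallyIntegrable (Ω.indicator G) volume) (huG : IsWeakGradient Ω u G)
    (φ : ContDiffBump (0 : Rn n)) {c x : Rn n} {l : ℝ}
    (hx : Metric.closedBall (c + l • (x - c)) φ.rOut ⊆ Ω) :
    gradient (dilateMollify volume φ c l (Ω.indicator u)) x =
      l • dilateMollify volume φ c l (Ω.indicator G) x := by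
  have hdilate : HasFDerivAt (fun x : Rn n => c + l • (x - c))
      (l • ContinuousLinearMap.id ℝ (Rn n)) x :=
    (((hasFDerivAt_id x).sub_const c).const_smul l).const_add c
  have hcomp := (hasGradientAt_convolution_normed_indicator hΩ hu hG huG φ hx).hasFDerivAt.comp x
    hdilate
  refine HasGradientAt.gradient (hasGradientAt_iff_hasFDerivAt.2 (hcomp.congr_fderiv ?_))
  ext v
  simp [dilateMollify]

theorem H1.exists_smooth_approx (hΩ : IsOpen Ω) (hconv : Convex ℝ Ω)
    (hb : Bornology.IsBounded Ω) (u : H1 Ω) :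
    ∃ ψ : ℕ → Rn n → ℝ, (∀ k, ContDiff ℝ ∞ (ψ k)) ∧
      Tendsto (fun k => eLpNorm (fun x => ψ k x - u.fn x) 2 (volume.restrict Ω)) atTop (𝓝 0) ∧
      Tendsto (fun k => eLpNorm (fun x => gradient (ψ k) x - u.grad x) 2 (volume.restrict Ω))
        atTop (𝓝 0) := by
  rcases Ω.eq_empty_or_nonempty with rfl | ⟨c, hc⟩
  · exact ⟨0, fun _ => contDiff_const, by simp, by simp⟩
  obtain ⟨r, hr, hrΩ⟩ := Metric.nhds_basis_closedBall.mem_iff.1 (hΩ.mem_nhds hc)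
  set t : ℕ → ℝ := fun k => 1 / ((k : ℝ) + 1)
  have ht (k : ℕ) : 0 < t k := Nat.one_div_pos_of_nat
  have ht₁ (k : ℕ) : t k ∈ Icc (0 : ℝ) 1 := ⟨(ht k).le, (div_le_one (by positivity)).2 (by simp)⟩
  have ht₀ : Tendsto t atTop (𝓝 0) := tendsto_one_div_add_atTop_nhds_zero_nat
  have hl : Tendsto (fun k => 1 - t k) atTop (𝓝 1) := by simpa using ht₀.const_sub 1
  set φ : ℕ → ContDiffBump (0 : Rn n) := fun k =>
    ⟨t k * (r / 2), t k * r, mul_pos (ht k) (half_pos hr),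
      mul_lt_mul_of_pos_left (half_lt_self hr) (ht k)⟩
  have hφ : Tendsto (fun k => (φ k).rOut) atTop (𝓝 0) := by simpa using ht₀.mul_const r
  have hu : MemLp (Ω.indicator u.fn) 2 volume :=
    (memLp_indicator_iff_restrict hΩ.measurableSet).2 (Lp.memLp u.fn)
  have hG : MemLp (Ω.indicator u.grad) 2 volume :=
    (memLp_indicator_iff_restrict hΩ.measurableSet).2 (Lp.memLp u.grad)
  have hul := hu.locallyIntegrable one_le_two
  have hGl := hG.locallyIntegrable one_le_two
  have hin : ∀ᵐ x ∂(volume.restrict Ω), x ∈ Ω := ae_restrict_mem hΩ.measurableSet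
  refine ⟨fun k => dilateMollify volume (φ k) c (1 - t k) (Ω.indicator u.fn),
    fun k => contDiff_dilateMollify _ _ _ hul, ?_, ?_⟩
  · refine (tendsto_eLpNorm_dilateMollify_sub hb hΩ.measurableSet c hl hφ one_le_two
      ENNReal.ofNat_ne_top hu).congr fun k => eLpNorm_congr_ae ?_
    filter_upwards [hin] with x hx
    rw [Pi.sub_apply, indicator_of_mem hx]
  · refine (tendsto_eLpNorm_smul_sub one_le_two hl
      (fun k => (contDiff_dilateMollify _ _ _ hGl).continuous.aestronglyMeasurable)
      (hG.restrict Ω) (tendsto_eLpNorm_dilateMollify_sub hb hΩ.measurableSet c hl hφ one_le_two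
        ENNReal.ofNat_ne_top hG)).congr fun k => eLpNorm_congr_ae ?_
    filter_upwards [hin] with x hx
    rw [gradient_dilateMollify_indicator hΩ.measurableSet hul hGl u.2 (φ k)
      (closedBall_dilation_subset_of_convex hconv hrΩ hx hr.le (ht₁ k)), Pi.sub_apply,
      Pi.smul_apply, indicator_of_mem hx]

end SmoothApproximation

section WeightedMap

open scoped ENNReal

variable {α ι : Type*} {m : MeasurableSpace α} {μ : Measure α} {V E F : Type*}
  [NormedAddCommGroup V] [NormedAddCommGroup E] [NormedAddCommGroup F] {p : ℝ≥0∞}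
  {𝓕 : Filter ι} [𝓕.IsCountablyGenerated]

theorem tendsto_eLpNorm_zero_of_dominated {f : ι → α → E} {bound : α → ℝ} (hp : p ≠ 0)
    (hp' : p ≠ ⊤) (hbound : MemLp bound p μ) (hf : ∀ᶠ i in 𝓕, AEStronglyMeasurable (f i) μ)
    (hle : ∀ᶠ i in 𝓕, ∀ᵐ x ∂μ, ‖f i x‖ ≤ bound x)
    (hlim : ∀ᵐ x ∂μ, Tendsto (fun i => f i x) 𝓕 (𝓝 0)) :
    Tendsto (fun i => eLpNorm (f i) p μ) 𝓕 (𝓝 0) := by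
  have hp_pos : 0 < p.toReal := ENNReal.toReal_pos hp hp'
  have hlintegral : Tendsto (fun i => ∫⁻ x, ‖f i x‖ₑ ^ p.toReal ∂μ) 𝓕 (𝓝 (∫⁻ _, 0 ∂μ)) := by
    refine tendsto_lintegral_filter_of_dominated_convergence' (fun x => ‖bound x‖ₑ ^ p.toReal)
      (hf.mono fun i hi => hi.enorm.pow_const _) (hle.mono fun i hi => hi.mono fun x hx => ?_)
      (lintegral_rpow_enorm_lt_top_of_eLpNorm_lt_top hp hp' hbound.2).ne
      (hlim.mono fun x hx => ?_)
    · gcongr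
      exact enorm_le_iff_norm_le.2 (hx.trans (Real.le_norm_self _))
    · simpa [hp_pos] using hx.enorm.ennrpow_const p.toReal
  simpa [eLpNorm_eq_lintegral_rpow_enorm_toReal hp hp', hp_pos] using
    hlintegral.ennrpow_const (1 / p.toReal)

variable [NormedSpace ℝ V] [NormedSpace ℝ E] [NormedSpace ℝ F] [Fact (1 ≤ p)]

open Classical in
/-- The operator `f ↦ B (W x) (f x)` on `Lᵖ`, for an essentially bounded weight `W`; it is `0` for
other `W`. -/
def weightedMap (p : ℝ≥0∞) [Fact (1 ≤ p)] (μ : Measure α) (B : V →L[ℝ] E →L[ℝ] F) (W : α → V) :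
    Lp E p μ →L[ℝ] Lp F p μ :=
  if h : MemLp W ⊤ μ then B.holderL μ ⊤ p p h.toLp else 0

theorem coeFn_weightedMap (B : V →L[ℝ] E →L[ℝ] F) {W : α → V} (hW : MemLp W ⊤ μ) (f : Lp E p μ) :
    weightedMap p μ B W f =ᵐ[μ] fun x => B (W x) (f x) := by
  rw [weightedMap, dif_pos hW]
  filter_upwards [B.coeFn_holder (r := p) hW.toLp f, hW.coeFn_toLp] with x hx hWx
  exact hx.trans (by rw [hWx])

theorem tendsto_weightedMap (B : V →L[ℝ] E →L[ℝ] F) {W : ι → α → V} {W₀ : α → V} {C : ℝ}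
    (hp : p ≠ ⊤) (hW : ∀ᶠ i in 𝓕, AEStronglyMeasurable (W i) μ)
    (hW₀ : AEStronglyMeasurable W₀ μ) (hWC : ∀ᶠ i in 𝓕, ∀ᵐ x ∂μ, ‖W i x‖ ≤ C)
    (hW₀C : ∀ᵐ x ∂μ, ‖W₀ x‖ ≤ C) (hlim : ∀ᵐ x ∂μ, Tendsto (fun i => W i x) 𝓕 (𝓝 (W₀ x)))
    (f : Lp E p μ) :
    Tendsto (fun i => weightedMap p μ B (W i) f) 𝓕 (𝓝 (weightedMap p μ B W₀ f)) := by
  have hW₀' : MemLp W₀ ⊤ μ := memLp_top_of_bound hW₀ C hW₀C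
  have hW' : ∀ᶠ i in 𝓕, MemLp (W i) ⊤ μ := by
    filter_upwards [hW, hWC] with i hi hiC using memLp_top_of_bound hi C hiC
  rw [Lp.tendsto_Lp_iff_tendsto_eLpNorm']
  have heq : ∀ᶠ i in 𝓕, ⇑(weightedMap p μ B (W i) f) - ⇑(weightedMap p μ B W₀ f) =ᵐ[μ]
      fun x => B (W i x - W₀ x) (f x) := by
    filter_upwards [hW'] with i hi
    filter_upwards [coeFn_weightedMap B hi f, coeFn_weightedMap B hW₀' f] with x hx hx₀
    rw [Pi.sub_apply, hx, hx₀, map_sub, sub_apply]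
  refine (tendsto_eLpNorm_zero_of_dominated (bound := fun x => ‖B‖ * (C + C) * ‖f x‖)
    (zero_lt_one.trans_le Fact.out).ne' hp ((Lp.memLp f).norm.const_mul _) ?_ ?_ ?_).congr'
    (heq.mono fun i hi => eLpNorm_congr_ae hi.symm)
  · filter_upwards [hW] with i hi
    exact B.aestronglyMeasurable_comp₂ (hi.sub hW₀) (Lp.aestronglyMeasurable f)
  · filter_upwards [hWC] with i hiC
    filter_upwards [hiC, hW₀C] with x hxC hx₀C
    exact (B.le_opNorm₂ _ _).trans (by gcongr; exact norm_sub_le_of_le hxC hx₀C)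
  · filter_upwards [hlim] with x hx
    have hB := ((B.flip (f x)).continuous.tendsto 0).comp (tendsto_sub_nhds_zero_iff.2 hx)
    simpa only [Function.comp_def, map_zero, ContinuousLinearMap.flip_apply] using hB

end WeightedMap

section AbstractForms

variable {V ι : Type*} [NormedAddCommGroup V]

theorem existsUnique_eq_of_isCoercive [InnerProductSpace ℝ V] [CompleteSpace V]
    {B : V →L[ℝ] V →L[ℝ] ℝ} (hB : IsCoercive B) (ℓ : V →L[ℝ] ℝ) : ∃! u, B u = ℓ := by
  have h (u : V) :
      B u = ℓ ↔ hB.continuousLinearEquivOfBilin u = (InnerProductSpace.toDual ℝ V).symm ℓ := by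
    rw [ContinuousLinearMap.ext_iff, ext_iff_inner_right ℝ]
    simp only [hB.continuousLinearEquivOfBilin_apply, InnerProductSpace.toDual_symm_apply]
  simp only [h]
  exact hB.continuousLinearEquivOfBilin.bijective.existsUnique _

theorem tendsto_of_tendsto_sub_of_coercive [NormedSpace ℝ V] {𝓕 : Filter ι}
    {B : ι → V →L[ℝ] V →L[ℝ] ℝ} {κ : ℝ} (hκ : 0 < κ)
    (hB : ∀ᶠ i in 𝓕, ∀ v, κ * ‖v‖ ^ 2 ≤ B i v v) {u : ι → V} {u₀ : V}
    (h : Tendsto (fun i => B i (u i) - B i u₀) 𝓕 (𝓝 0)) : Tendsto u 𝓕 (𝓝 u₀) := by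
  rw [tendsto_iff_norm_sub_tendsto_zero]
  have hlim := h.norm.div_const κ
  rw [norm_zero, zero_div] at hlim
  refine squeeze_zero' (.of_forall fun i => norm_nonneg _) ?_ hlim
  filter_upwards [hB] with i hi
  rw [le_div_iff₀' hκ, ← map_sub]
  rcases (norm_nonneg (u i - u₀)).eq_or_lt with h0 | h0
  · rw [← h0, mul_zero]
    exact norm_nonneg _
  · refine le_of_mul_le_mul_right ?_ h0
    calc κ * ‖u i - u₀‖ * ‖u i - u₀‖ = κ * ‖u i - u₀‖ ^ 2 := by ring
      _ ≤ B i (u i - u₀) (u i - u₀) := hi _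
      _ ≤ ‖B i (u i - u₀)‖ * ‖u i - u₀‖ :=
        (Real.le_norm_self _).trans ((B i (u i - u₀)).le_opNorm _)

end AbstractForms

section Multiplication

variable {α E : Type*} {m : MeasurableSpace α} {μ : Measure α} [NormedAddCommGroup E]
  {s : α → ℝ}

/-- Multiplication of square integrable functions by an essentially bounded function. -/
abbrev mulMap [NormedSpace ℝ E] (μ : Measure α) (s : α → ℝ) : Lp E 2 μ →L[ℝ] Lp E 2 μ :=
  weightedMap 2 μ (ContinuousLinearMap.lsmul ℝ ℝ) s

theorem coeFn_mulMap [NormedSpace ℝ E] (hs : MemLp s ⊤ μ) (f : Lp E 2 μ) :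
    mulMap μ s f =ᵐ[μ] fun x => s x • f x :=
  coeFn_weightedMap _ hs f

variable [InnerProductSpace ℝ E]

theorem continuous_integral_inner {f : α → E} (hf : MemLp f 2 μ) :
    Continuous fun u : Lp E 2 μ => ∫ x, ⟪f x, u x⟫ ∂μ := by
  have h (u : Lp E 2 μ) : ∫ x, ⟪f x, u x⟫ ∂μ = ⟪hf.toLp f, u⟫ := by
    rw [L2.inner_def]
    exact integral_congr_ae (hf.coeFn_toLp.mono fun x hx => by simp only [hx])
  simp only [h]
  fun_prop

theorem inner_mulMap_ae_eq (hs : MemLp s ⊤ μ) (f g : Lp E 2 μ) :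
    (fun x => ⟪mulMap μ s f x, g x⟫) =ᵐ[μ] fun x => s x * ⟪f x, g x⟫ := by
  filter_upwards [coeFn_mulMap hs f] with x hx
  rw [hx, real_inner_smul_left]

theorem inner_mulMap (hs : MemLp s ⊤ μ) (f g : Lp E 2 μ) :
    ⟪mulMap μ s f, g⟫ = ∫ x, s x * ⟪f x, g x⟫ ∂μ := by
  rw [L2.inner_def]
  exact integral_congr_ae (inner_mulMap_ae_eq hs f g)

theorem integrable_mul_inner (hs : MemLp s ⊤ μ) (f g : Lp E 2 μ) :
    Integrable (fun x => s x * ⟪f x, g x⟫) μ :=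
  (L2.integrable_inner (𝕜 := ℝ) (mulMap μ s f) g).congr (inner_mulMap_ae_eq hs f g)

theorem mul_sq_norm_le_inner_mulMap (hs : MemLp s ⊤ μ) {κ : ℝ} (hκ : ∀ᵐ x ∂μ, κ ≤ s x)
    (f : Lp E 2 μ) : κ * ‖f‖ ^ 2 ≤ ⟪mulMap μ s f, f⟫ := by
  rw [inner_mulMap hs, ← real_inner_self_eq_norm_sq, L2.inner_def, ← integral_const_mul]
  refine integral_mono_ae ((L2.integrable_inner (𝕜 := ℝ) f f).const_mul κ)
    (integrable_mul_inner hs f f) (hκ.mono fun x hx => ?_)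
  exact mul_le_mul_of_nonneg_right hx real_inner_self_nonneg

end Multiplication

section Sobolev

variable {n : ℕ} {Ω : Set (Rn n)} {ι : Type*} {𝓕 : Filter ι}

theorem isClosed_H1Submodule (Ω : Set (Rn n)) :
    IsClosed (H1Submodule Ω : Set (WithLp 2 (L2 Ω × L2Vec Ω))) := by
  have h : (H1Submodule Ω : Set (WithLp 2 (L2 Ω × L2Vec Ω))) =
      ⋂ (ψ : Rn n → ℝ) (_ : ContDiff ℝ ∞ ψ) (_ : HasCompactSupport ψ) (_ : tsupport ψ ⊆ Ω)
        (i : Fin n), {w | ∫ x in Ω, ⟪fderiv ℝ ψ x (EuclideanSpace.single i 1), w.fst x⟫ =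
          -∫ x in Ω, ⟪ψ x • (EuclideanSpace.single i 1 : Rn n), w.snd x⟫} := by
    ext w
    simp only [mem_iInter, mem_ofPred_eq, real_inner_smul_left, EuclideanSpace.inner_single_left,
      map_one, one_mul, mul_comm (_ : ℝ) (w.snd _ _)]
    exact Iff.rfl
  rw [h]
  refine isClosed_iInter fun ψ => isClosed_iInter fun hψ => isClosed_iInter fun hs =>
    isClosed_iInter fun _ => isClosed_iInter fun i => isClosed_eq ?_ ?_
  · exact (continuous_integral_inner ((continuous_partial hψ _).memLp_of_hasCompactSupport
      (hasCompactSupport_partial hs _))).comp (WithLp.fstL 2 ℝ (L2 Ω) (L2Vec Ω)).continuous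
  · exact ((continuous_integral_inner ((hψ.continuous.smul
      continuous_const).memLp_of_hasCompactSupport hs.smul_right)).comp
        (WithLp.sndL 2 ℝ (L2 Ω) (L2Vec Ω)).continuous).neg

instance (Ω : Set (Rn n)) : CompleteSpace (H1 Ω) :=
  (isClosed_H1Submodule Ω).completeSpace_coe

/-- The embedding `u ↦ u` of `H¹(Ω)` in `L²(Ω)` as a continuous linear map. -/
def H1.fnL (Ω : Set (Rn n)) : H1 Ω →L[ℝ] L2 Ω :=
  (WithLp.fstL 2 ℝ (L2 Ω) (L2Vec Ω)) ∘L (H1Submodule Ω).subtypeL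

/-- The weak gradient as a continuous linear map. -/
def H1.gradL (Ω : Set (Rn n)) : H1 Ω →L[ℝ] L2Vec Ω :=
  (WithLp.sndL 2 ℝ (L2 Ω) (L2Vec Ω)) ∘L (H1Submodule Ω).subtypeL

theorem H1.norm_sq_eq (u : H1 Ω) : ‖u‖ ^ 2 = ‖u.fn‖ ^ 2 + ‖u.grad‖ ^ 2 :=
  WithLp.prod_norm_sq_eq_of_L2 u.1

/-- The bilinear form `(u, v) ↦ ∫_Ω (A u · v + B u · ∇v)` on `H¹(Ω)`. -/
def H1.pairing (A : H1 Ω →L[ℝ] L2 Ω) (B : H1 Ω →L[ℝ] L2Vec Ω) : H1 Ω →L[ℝ] H1 Ω →L[ℝ] ℝ :=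
  (innerSL ℝ : L2 Ω →L[ℝ] L2 Ω →L[ℝ] ℝ).bilinearComp A (H1.fnL Ω) +
    (innerSL ℝ : L2Vec Ω →L[ℝ] L2Vec Ω →L[ℝ] ℝ).bilinearComp B (H1.gradL Ω)

theorem H1.pairing_apply (A : H1 Ω →L[ℝ] L2 Ω) (B : H1 Ω →L[ℝ] L2Vec Ω) (u v : H1 Ω) :
    H1.pairing A B u v = ⟪A u, v.fn⟫ + ⟪B u, v.grad⟫ := rfl

theorem H1.tendsto_pairing {A : ι → H1 Ω →L[ℝ] L2 Ω} {B : ι → H1 Ω →L[ℝ] L2Vec Ω}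
    {A₀ : H1 Ω →L[ℝ] L2 Ω} {B₀ : H1 Ω →L[ℝ] L2Vec Ω} {u : H1 Ω}
    (hA : Tendsto (fun i => A i u) 𝓕 (𝓝 (A₀ u))) (hB : Tendsto (fun i => B i u) 𝓕 (𝓝 (B₀ u))) :
    Tendsto (fun i => H1.pairing (A i) (B i) u) 𝓕 (𝓝 (H1.pairing A₀ B₀ u)) := by
  exact ((((ContinuousLinearMap.precomp ℝ (H1.fnL Ω)) ∘L
    (innerSL ℝ : L2 Ω →L[ℝ] L2 Ω →L[ℝ] ℝ)).continuous.tendsto _).comp hA).add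
    ((((ContinuousLinearMap.precomp ℝ (H1.gradL Ω)) ∘L
    (innerSL ℝ : L2Vec Ω →L[ℝ] L2Vec Ω →L[ℝ] ℝ)).continuous.tendsto _).comp hB)

/-- The energy form `∫_Ω (D ∇u·∇v + c u v)`. -/
def energy (Ω : Set (Rn n)) (D c : Rn n → ℝ) : H1 Ω →L[ℝ] H1 Ω →L[ℝ] ℝ :=
  H1.pairing (mulMap (volume.restrict Ω) c ∘L H1.fnL Ω)
    (mulMap (volume.restrict Ω) D ∘L H1.gradL Ω)

variable {D c : Rn n → ℝ}

theorem integrable_energy (hD : MemLp D ⊤ (volume.restrict Ω))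
    (hc : MemLp c ⊤ (volume.restrict Ω)) (u v : H1 Ω) :
    Integrable (fun x => D x * ⟪u.grad x, v.grad x⟫ + c x * u.fn x * v.fn x)
      (volume.restrict Ω) := by
  simp only [mul_assoc, ← Real.inner_apply (u.fn _)]
  exact (integrable_mul_inner hD u.grad v.grad).add (integrable_mul_inner hc u.fn v.fn)

theorem energy_apply (hD : MemLp D ⊤ (volume.restrict Ω)) (hc : MemLp c ⊤ (volume.restrict Ω))
    (u v : H1 Ω) :
    energy Ω D c u v = ∫ x in Ω, (D x * ⟪u.grad x, v.grad x⟫ + c x * u.fn x * v.fn x) := by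
  simp only [mul_assoc, ← Real.inner_apply (u.fn _)]
  rw [integral_add (integrable_mul_inner hD _ _) (integrable_mul_inner hc _ _), ← inner_mulMap hD,
    ← inner_mulMap hc, add_comm]
  rfl

theorem mul_sq_norm_le_energy (hD : MemLp D ⊤ (volume.restrict Ω))
    (hc : MemLp c ⊤ (volume.restrict Ω)) {κ : ℝ} (hκD : ∀ᵐ x ∂(volume.restrict Ω), κ ≤ D x)
    (hκc : ∀ᵐ x ∂(volume.restrict Ω), κ ≤ c x) (u : H1 Ω) : κ * ‖u‖ ^ 2 ≤ energy Ω D c u u := by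
  rw [H1.norm_sq_eq, mul_add, energy, H1.pairing_apply]
  exact add_le_add (mul_sq_norm_le_inner_mulMap hc hκc u.fn)
    (mul_sq_norm_le_inner_mulMap hD hκD u.grad)

end Sobolev

section SmoothFunctions

theorem continuous_gradient {E : Type*} [NormedAddCommGroup E] [InnerProductSpace ℝ E]
    [CompleteSpace E] {ψ : E → ℝ} (hψ : ContDiff ℝ 1 ψ) : Continuous (gradient ψ) :=
  (InnerProductSpace.toDual ℝ E).symm.continuous.comp (hψ.continuous_fderiv one_ne_zero)

variable {n : ℕ} {Ω : Set (Rn n)} {ψ η : Rn n → ℝ}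

theorem memLp_of_isBounded {E : Type*} [NormedAddCommGroup E] (hb : Bornology.IsBounded Ω)
    {f : Rn n → E} (hf : Continuous f) (p : ENNReal) : MemLp f p (volume.restrict Ω) :=
  have : IsFiniteMeasure (volume.restrict Ω) := isFiniteMeasure_restrict.2 hb.measure_lt_top.ne
  memLp_restrict_of_isBounded hb hf p

theorem isWeakGradient_gradient (hψ : ContDiff ℝ 1 ψ) : IsWeakGradient Ω ψ (gradient ψ) := by
  intro ζ hζ hζc hζΩ i
  set e : Rn n := EuclideanSpace.single i 1
  have hζ1 : Continuous fun x => fderiv ℝ ζ x e := continuous_partial hζ e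
  have hψ1 : Continuous fun x => fderiv ℝ ψ x e :=
    (hψ.continuous_fderiv one_ne_zero).clm_apply continuous_const
  have hparts : ∫ x, ψ x * fderiv ℝ ζ x e = -∫ x, fderiv ℝ ψ x e * ζ x :=
    integral_mul_fderiv_eq_neg_fderiv_mul_of_integrable
      ((hψ1.mul hζ.continuous).integrable_of_hasCompactSupport hζc.mul_left)
      ((hψ.continuous.mul hζ1).integrable_of_hasCompactSupport
        (hasCompactSupport_partial hζc e).mul_left)
      ((hψ.continuous.mul hζ.continuous).integrable_of_hasCompactSupport hζc.mul_left)
      (fun x _ => hψ.differentiable one_ne_zero x) (fun x _ => hζ.differentiable (by simp) x)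
  have hcoord (x : Rn n) : gradient ψ x i = fderiv ℝ ψ x e := by
    rw [← inner_gradient_left, real_inner_comm, EuclideanSpace.inner_single_left, map_one, one_mul]
  simp only [hcoord]
  rw [setIntegral_eq_integral_of_forall_compl_eq_zero fun x hx => ?_,
    setIntegral_eq_integral_of_forall_compl_eq_zero fun x hx => ?_, hparts]
  · rw [image_eq_zero_of_notMem_tsupport fun h => hx (hζΩ h), mul_zero]
  · rw [image_eq_zero_of_notMem_tsupport fun h => hx (hζΩ (tsupport_fderiv_apply_subset ℝ e h)),
      mul_zero]

theorem IsWeakGradient.congr_ae {u u' : Rn n → ℝ} {G G' : Rn n → Rn n}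
    (h : IsWeakGradient Ω u G) (hu : u' =ᵐ[volume.restrict Ω] u)
    (hG : G' =ᵐ[volume.restrict Ω] G) : IsWeakGradient Ω u' G' := by
  intro ζ hζ hζc hζΩ i
  rw [integral_congr_ae (hu.mono fun x hx => congrArg (· * fderiv ℝ ζ x _) hx),
    integral_congr_ae (hG.mono fun x hx => congrArg (fun y : Rn n => y i * ζ x) hx)]
  exact h ζ hζ hζc hζΩ i

/-- The element of `H¹(Ω)` given by a `C¹` function on `ℝⁿ`, for bounded `Ω`. -/
def H1.ofContDiff (hb : Bornology.IsBounded Ω) (hψ : ContDiff ℝ 1 ψ) : H1 Ω :=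
  ⟨WithLp.toLp 2 ((memLp_of_isBounded hb hψ.continuous 2).toLp,
    (memLp_of_isBounded hb (continuous_gradient hψ) 2).toLp),
    (isWeakGradient_gradient hψ).congr_ae
      (memLp_of_isBounded hb hψ.continuous 2).coeFn_toLp
      (memLp_of_isBounded hb (continuous_gradient hψ) 2).coeFn_toLp⟩

theorem H1.coeFn_fn_ofContDiff (hb : Bornology.IsBounded Ω) (hψ : ContDiff ℝ 1 ψ) :
    (H1.ofContDiff hb hψ).fn =ᵐ[volume.restrict Ω] ψ :=
  (memLp_of_isBounded hb hψ.continuous 2).coeFn_toLp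

theorem H1.coeFn_grad_ofContDiff (hb : Bornology.IsBounded Ω) (hψ : ContDiff ℝ 1 ψ) :
    (H1.ofContDiff hb hψ).grad =ᵐ[volume.restrict Ω] gradient ψ :=
  (memLp_of_isBounded hb (continuous_gradient hψ) 2).coeFn_toLp

theorem H1.ofContDiff_sub (hb : Bornology.IsBounded Ω) (hψ : ContDiff ℝ 1 ψ)
    (hη : ContDiff ℝ 1 η) :
    H1.ofContDiff hb (hψ.sub hη) = H1.ofContDiff hb hψ - H1.ofContDiff hb hη := by
  have hfn := memLp_of_isBounded hb hψ.continuous 2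
  have hfn' := memLp_of_isBounded hb hη.continuous 2
  have hgrad := memLp_of_isBounded hb (continuous_gradient hψ) 2
  have hgrad' := memLp_of_isBounded hb (continuous_gradient hη) 2
  have hsub : gradient (ψ - η) = gradient ψ - gradient η := by
    funext x
    rw [Pi.sub_apply, gradient, gradient, gradient, ← map_sub, ← fderiv_sub
      (hψ.differentiable one_ne_zero x) (hη.differentiable one_ne_zero x)]
  exact Subtype.ext (congrArg (WithLp.toLp 2) (Prod.ext (MemLp.toLp_sub hfn hfn')
    ((MemLp.toLp_congr (memLp_of_isBounded hb (continuous_gradient (hψ.sub hη)) 2)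
      (hgrad.sub hgrad') (.of_forall fun x => congrFun hsub x)).trans
        (MemLp.toLp_sub hgrad hgrad'))))

theorem tendsto_toLp_of_tendsto_eLpNorm_sub {α E ι : Type*} {m : MeasurableSpace α}
    {μ : Measure α} [NormedAddCommGroup E] {p : ENNReal} [Fact (1 ≤ p)] {𝓕 : Filter ι}
    {f : ι → α → E} (hf : ∀ i, MemLp (f i) p μ) {f₀ : Lp E p μ}
    (h : Tendsto (fun i => eLpNorm (fun x => f i x - f₀ x) p μ) 𝓕 (𝓝 0)) :
    Tendsto (fun i => (hf i).toLp) 𝓕 (𝓝 f₀) := by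
  rw [Lp.tendsto_Lp_iff_tendsto_eLpNorm']
  exact h.congr fun i => eLpNorm_congr_ae ((hf i).coeFn_toLp.symm.sub (EventuallyEq.refl _ _))

theorem H1.tendsto_ofContDiff (hb : Bornology.IsBounded Ω) {u : H1 Ω} {ψ : ℕ → Rn n → ℝ}
    (hψ : ∀ k, ContDiff ℝ 1 (ψ k))
    (hfn : Tendsto (fun k => eLpNorm (fun x => ψ k x - u.fn x) 2 (volume.restrict Ω)) atTop (𝓝 0))
    (hgrad : Tendsto (fun k => eLpNorm (fun x => gradient (ψ k) x - u.grad x) 2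
      (volume.restrict Ω)) atTop (𝓝 0)) :
    Tendsto (fun k => H1.ofContDiff hb (hψ k)) atTop (𝓝 u) := by
  rw [tendsto_subtype_rng]
  exact ((WithLp.prodContinuousLinearEquiv 2 ℝ (L2 Ω) (L2Vec Ω)).symm.continuous.tendsto
    (u.fn, u.grad)).comp ((tendsto_toLp_of_tendsto_eLpNorm_sub _ hfn).prodMk_nhds
      (tendsto_toLp_of_tendsto_eLpNorm_sub _ hgrad))

theorem H1.dense_ofContDiff (hΩ : IsOpen Ω) (hconv : Convex ℝ Ω) (hb : Bornology.IsBounded Ω) :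
    Dense {w : H1 Ω | ∃ (ψ : Rn n → ℝ) (hψ : ContDiff ℝ 1 ψ), H1.ofContDiff hb hψ = w} := by
  intro u
  obtain ⟨ψ, hψ, hfn, hgrad⟩ := u.exists_smooth_approx hΩ hconv hb
  exact mem_closure_of_tendsto
    (H1.tendsto_ofContDiff hb (fun k => (hψ k).of_le (by simp)) hfn hgrad)
    (.of_forall fun k => ⟨_, _, rfl⟩)

theorem H1.bilinear_ext_of_contDiff (hΩ : IsOpen Ω) (hconv : Convex ℝ Ω)
    (hb : Bornology.IsBounded Ω) {B B' : H1 Ω →L[ℝ] H1 Ω →L[ℝ] ℝ}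
    (h : ∀ (ψ η : Rn n → ℝ) (hψ : ContDiff ℝ 1 ψ) (hη : ContDiff ℝ 1 η),
      B (H1.ofContDiff hb hψ) (H1.ofContDiff hb hη) =
        B' (H1.ofContDiff hb hψ) (H1.ofContDiff hb hη)) : B = B' := by
  have hspan := (H1.dense_ofContDiff hΩ hconv hb).mono (Submodule.subset_span (R := ℝ))
  refine ContinuousLinearMap.ext_on hspan ?_
  rintro _ ⟨ψ, hψ, rfl⟩
  refine ContinuousLinearMap.ext_on hspan ?_
  rintro _ ⟨η, hη, rfl⟩
  exact h ψ η hψ hη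

end SmoothFunctions

section FluxForm

variable {n : ℕ} {Ω : Set (Rn n)} {X : Rn n → Rn n} {φ ψ η : Rn n → ℝ}

/-- The form `∫_Ω φ (u v div X + v ∇u·X + u ∇v·X)` on `H¹(Ω)`, that is, `∫_Ω φ div (u v X)`. -/
def fluxForm (Ω : Set (Rn n)) (X : Rn n → Rn n) (φ : Rn n → ℝ) : H1 Ω →L[ℝ] H1 Ω →L[ℝ] ℝ :=
  H1.pairing
    (mulMap (volume.restrict Ω) (fun x => φ x * divergence X x) ∘L H1.fnL Ω +
      weightedMap 2 (volume.restrict Ω) (innerSL ℝ : Rn n →L[ℝ] Rn n →L[ℝ] ℝ)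
        (fun x => φ x • X x) ∘L H1.gradL Ω)
    (weightedMap 2 (volume.restrict Ω) (ContinuousLinearMap.lsmul ℝ ℝ).flip
      (fun x => φ x • X x) ∘L H1.fnL Ω)

theorem memLp_top_mul_divergence (hX : ContDiff ℝ 1 X) (hXc : HasCompactSupport X)
    (hφ : MemLp φ ⊤ (volume.restrict Ω)) :
    MemLp (fun x => φ x * divergence X x) ⊤ (volume.restrict Ω) :=
  ((continuous_divergence hX).memLp_top_of_hasCompactSupport
    (hasCompactSupport_divergence hXc) _).mul hφ

theorem memLp_top_smul_of_hasCompactSupport (hX : Continuous X) (hXc : HasCompactSupport X)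
    (hφ : MemLp φ ⊤ (volume.restrict Ω)) :
    MemLp (fun x => φ x • X x) ⊤ (volume.restrict Ω) :=
  (hX.memLp_top_of_hasCompactSupport hXc _).smul hφ

theorem fluxForm_apply (hX : ContDiff ℝ 1 X) (hXc : HasCompactSupport X)
    (hφ : MemLp φ ⊤ (volume.restrict Ω)) (u v : H1 Ω) :
    fluxForm Ω X φ u v = ∫ x in Ω, φ x * (u.fn x * v.fn x * divergence X x +
      v.fn x * ⟪u.grad x, X x⟫ + u.fn x * ⟪v.grad x, X x⟫) := by
  have hφX := memLp_top_smul_of_hasCompactSupport hX.continuous hXc hφ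
  rw [fluxForm, H1.pairing_apply, L2.inner_def, L2.inner_def,
    ← integral_add (L2.integrable_inner _ _) (L2.integrable_inner _ _)]
  refine integral_congr_ae ?_
  filter_upwards [coeFn_mulMap (memLp_top_mul_divergence hX hXc hφ) u.fn,
    coeFn_weightedMap (innerSL ℝ : Rn n →L[ℝ] Rn n →L[ℝ] ℝ) hφX u.grad,
    coeFn_weightedMap (ContinuousLinearMap.lsmul ℝ ℝ).flip hφX u.fn,
    Lp.coeFn_add (mulMap (volume.restrict Ω) (fun x => φ x * divergence X x) u.fn)
      (weightedMap 2 (volume.restrict Ω) (innerSL ℝ : Rn n →L[ℝ] Rn n →L[ℝ] ℝ)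
        (fun x => φ x • X x) u.grad)] with x hdiv hgrad hfn hadd
  change ⟪(mulMap _ _ u.fn + weightedMap 2 _ _ _ u.grad : L2 Ω) x, v.fn x⟫ +
    ⟪weightedMap 2 _ _ _ u.fn x, v.grad x⟫ = _
  rw [hadd, Pi.add_apply, hdiv, hgrad, hfn, innerSL_apply_apply, ContinuousLinearMap.flip_apply,
    ContinuousLinearMap.lsmul_apply, smul_eq_mul, Real.inner_apply, real_inner_smul_left,
    real_inner_smul_left, real_inner_smul_left, real_inner_comm (X x) (u.grad x),
    real_inner_comm (X x) (v.grad x)]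
  ring

theorem fluxForm_ofContDiff (hb : Bornology.IsBounded Ω) (hX : ContDiff ℝ 1 X)
    (hXc : HasCompactSupport X) (hφ : MemLp φ ⊤ (volume.restrict Ω)) (hψ : ContDiff ℝ 1 ψ)
    (hη : ContDiff ℝ 1 η) :
    fluxForm Ω X φ (H1.ofContDiff hb hψ) (H1.ofContDiff hb hη) =
      ∫ x in Ω, φ x * divergence (fun x => (ψ x * η x) • X x) x := by
  rw [fluxForm_apply hX hXc hφ]
  refine integral_congr_ae ?_
  filter_upwards [H1.coeFn_fn_ofContDiff hb hψ, H1.coeFn_fn_ofContDiff hb hη,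
    H1.coeFn_grad_ofContDiff hb hψ, H1.coeFn_grad_ofContDiff hb hη] with x hψx hηx hdψx hdηx
  have hψd := hψ.differentiable one_ne_zero x
  have hηd := hη.differentiable one_ne_zero x
  have hproduct : gradient (fun x => ψ x * η x) x = ψ x • gradient η x + η x • gradient ψ x := by
    rw [gradient, fderiv_fun_mul hψd hηd, map_add, map_smulₛₗ, map_smulₛₗ]
    rfl
  rw [hψx, hηx, hdψx, hdηx, divergence_smul (hψd.fun_mul hηd) (hX.differentiable one_ne_zero x),
    hproduct, inner_add_left, real_inner_smul_left, real_inner_smul_left]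
  ring

end FluxForm

section Trace

variable {n : ℕ} {Ω U : Set (Rn n)} {X : Rn n → Rn n}

theorem memLp_top_indicator_one (hU : MeasurableSet U) :
    MemLp (U.indicator fun _ => (1 : ℝ)) ⊤ (volume.restrict Ω) :=
  (memLp_top_const 1).indicator hU

variable [IsFiniteMeasure (surfaceMeasure U)]

theorem fluxForm_indicator_ofContDiff (hU : IsOpen U) (hUΩ : U ⊆ Ω) (hb : Bornology.IsBounded Ω)
    (hX : ContDiff ℝ 1 X) (hXc : HasCompactSupport X)
    (hnormal : ∀ y ∈ frontier U, IsNormal U y (-X y)) {ψ η : Rn n → ℝ} (hψ : ContDiff ℝ 1 ψ)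
    (hη : ContDiff ℝ 1 η) :
    fluxForm Ω X (U.indicator fun _ => 1) (H1.ofContDiff hb hψ) (H1.ofContDiff hb hη) =
      -∫ x, ψ x * η x ∂(surfaceMeasure U) := by
  rw [fluxForm_ofContDiff hb hX hXc (memLp_top_indicator_one hU.measurableSet),
    ← setIntegral_divergence_smul_eq_neg_integral_surface hU (hb.subset hUΩ) hX hXc hnormal
      (hψ.mul hη)]
  simp only [← indicator_mul_left, one_mul]
  rw [setIntegral_indicator hU.measurableSet, inter_eq_right.2 hUΩ]

theorem inner_toLp_surfaceMeasure (hU : IsOpen U) (hUΩ : U ⊆ Ω) (hb : Bornology.IsBounded Ω)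
    (hX : ContDiff ℝ 1 X) (hXc : HasCompactSupport X)
    (hnormal : ∀ y ∈ frontier U, IsNormal U y (-X y)) {ψ η : Rn n → ℝ} (hψ : ContDiff ℝ 1 ψ)
    (hη : ContDiff ℝ 1 η) :
    ⟪(memLp_surfaceMeasure (hb.subset hUΩ) hψ.continuous 2).toLp,
        (memLp_surfaceMeasure (hb.subset hUΩ) hη.continuous 2).toLp⟫ =
      -fluxForm Ω X (U.indicator fun _ => 1) (H1.ofContDiff hb hψ) (H1.ofContDiff hb hη) := by
  rw [fluxForm_indicator_ofContDiff hU hUΩ hb hX hXc hnormal hψ hη, neg_neg, L2.inner_def]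
  refine integral_congr_ae ?_
  filter_upwards [(memLp_surfaceMeasure (hb.subset hUΩ) hψ.continuous 2).coeFn_toLp,
    (memLp_surfaceMeasure (hb.subset hUΩ) hη.continuous 2).coeFn_toLp] with x hψx hηx
  rw [hψx, hηx, Real.inner_apply]

set_option maxSynthPendingDepth 3 in
theorem dist_toLp_surfaceMeasure_le (hU : IsOpen U) (hUΩ : U ⊆ Ω) (hb : Bornology.IsBounded Ω)
    (hX : ContDiff ℝ 1 X) (hXc : HasCompactSupport X)
    (hnormal : ∀ y ∈ frontier U, IsNormal U y (-X y)) {ψ η : Rn n → ℝ} (hψ : ContDiff ℝ 1 ψ)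
    (hη : ContDiff ℝ 1 η) :
    dist (memLp_surfaceMeasure (hb.subset hUΩ) hψ.continuous 2).toLp
        (memLp_surfaceMeasure (hb.subset hUΩ) hη.continuous 2).toLp ≤
      √‖fluxForm Ω X (U.indicator fun _ => 1)‖ *
        dist (H1.ofContDiff hb hψ) (H1.ofContDiff hb hη) := by
  set F := fluxForm Ω X (U.indicator fun _ => 1)
  set w := H1.ofContDiff hb hψ - H1.ofContDiff hb hη
  have hsq := inner_toLp_surfaceMeasure hU hUΩ hb hX hXc hnormal (hψ.sub hη) (hψ.sub hη)
  rw [real_inner_self_eq_norm_sq, H1.ofContDiff_sub hb hψ hη] at hsq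
  rw [dist_eq_norm, dist_eq_norm, ← MemLp.toLp_sub]
  refine le_of_sq_le_sq ?_ (by positivity)
  calc _ = -F w w := hsq
    _ ≤ ‖F w w‖ := neg_le_abs _
    _ ≤ ‖F‖ * ‖w‖ * ‖w‖ := F.le_opNorm₂ w w
    _ = (√‖F‖ * ‖w‖) ^ 2 := by
      rw [mul_pow, Real.sq_sqrt (norm_nonneg F), sq, mul_assoc]

theorem exists_isTrace (hU : IsOpen U) (hUΩ : U ⊆ Ω) (hΩ : IsOpen Ω) (hconv : Convex ℝ Ω)
    (hb : Bornology.IsBounded Ω) (hX : ContDiff ℝ 1 X) (hXc : HasCompactSupport X)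
    (hnormal : ∀ y ∈ frontier U, IsNormal U y (-X y)) (u : H1 Ω) : ∃ τ, IsTrace U u τ := by
  obtain ⟨ψ, hψ, hfn, hgrad⟩ := u.exists_smooth_approx hΩ hconv hb
  have hψ1 (k : ℕ) : ContDiff ℝ 1 (ψ k) := (hψ k).of_le (by simp)
  have hcauchy := (H1.tendsto_ofContDiff hb hψ1 hfn hgrad).cauchySeq
  have hcauchy' : CauchySeq fun k =>
      (memLp_surfaceMeasure (hb.subset hUΩ) (hψ1 k).continuous 2).toLp := by
    rw [cauchySeq_iff_tendsto_dist_atTop_0] at hcauchy ⊢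
    refine squeeze_zero (fun _ => dist_nonneg) (fun p => dist_toLp_surfaceMeasure_le hU hUΩ hb hX
      hXc hnormal (hψ1 p.1) (hψ1 p.2)) ?_
    simpa only [mul_zero] using hcauchy.const_mul _
  obtain ⟨τ, hτ⟩ := cauchySeq_tendsto_of_complete hcauchy'
  refine ⟨τ, ψ, hψ, hfn, hgrad, ?_⟩
  rw [Lp.tendsto_Lp_iff_tendsto_eLpNorm'] at hτ
  exact hτ.congr fun k => eLpNorm_congr_ae ((MemLp.coeFn_toLp _).sub (EventuallyEq.refl _ _))

theorem integral_mul_of_isTrace (hU : IsOpen U) (hUΩ : U ⊆ Ω) (hb : Bornology.IsBounded Ω)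
    (hX : ContDiff ℝ 1 X) (hXc : HasCompactSupport X)
    (hnormal : ∀ y ∈ frontier U, IsNormal U y (-X y)) {u v : H1 Ω}
    {τ σ : Lp ℝ 2 (surfaceMeasure U)} (hτ : IsTrace U u τ) (hσ : IsTrace U v σ) :
    ∫ x, τ x * σ x ∂(surfaceMeasure U) = -fluxForm Ω X (U.indicator fun _ => 1) u v := by
  obtain ⟨ψ, hψ, hψu, hψu', hψτ⟩ := hτ
  obtain ⟨η, hη, hηv, hηv', hησ⟩ := hσ
  have hψ1 (k : ℕ) : ContDiff ℝ 1 (ψ k) := (hψ k).of_le (by simp)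
  have hη1 (k : ℕ) : ContDiff ℝ 1 (η k) := (hη k).of_le (by simp)
  have hsurface := (tendsto_toLp_of_tendsto_eLpNorm_sub (fun k => memLp_surfaceMeasure
    (hb.subset hUΩ) (hψ1 k).continuous 2) hψτ).inner (𝕜 := ℝ) (tendsto_toLp_of_tendsto_eLpNorm_sub
      (fun k => memLp_surfaceMeasure (hb.subset hUΩ) (hη1 k).continuous 2) hησ)
  have hvolume := (((fluxForm Ω X (U.indicator fun _ => (1 : ℝ))).continuous₂.tendsto _).comp
    ((H1.tendsto_ofContDiff hb hψ1 hψu hψu').prodMk_nhds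
      (H1.tendsto_ofContDiff hb hη1 hηv hηv'))).neg
  refine Eq.trans ?_ (tendsto_nhds_unique (hsurface.congr fun k =>
    inner_toLp_surfaceMeasure hU hUΩ hb hX hXc hnormal (hψ1 k) (hη1 k)) hvolume)
  simp only [L2.inner_def, Real.inner_apply]

theorem integral_trace_mul_trace (hU : IsOpen U) (hUΩ : U ⊆ Ω) (hΩ : IsOpen Ω)
    (hconv : Convex ℝ Ω) (hb : Bornology.IsBounded Ω) (hX : ContDiff ℝ 1 X)
    (hXc : HasCompactSupport X) (hnormal : ∀ y ∈ frontier U, IsNormal U y (-X y)) (u v : H1 Ω) :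
    ∫ x, trace U u x * trace U v x ∂(surfaceMeasure U) =
      -fluxForm Ω X (U.indicator fun _ => 1) u v := by
  have h (w : H1 Ω) : IsTrace U w (trace U w) := by
    have hw := exists_isTrace hU hUΩ hΩ hconv hb hX hXc hnormal w
    rw [trace, dif_pos hw]
    exact hw.choose_spec
  exact integral_mul_of_isTrace hU hUΩ hb hX hXc hnormal (h u) (h v)

end Trace

section LipschitzWeight

variable {n : ℕ} {Ω : Set (Rn n)} {X : Rn n → Rn n} {φ : Rn n → ℝ} {C : NNReal}

theorem memLp_top_gradient_of_lipschitzWith (hφ : LipschitzWith C φ) :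
    MemLp (gradient φ) ⊤ (volume.restrict Ω) :=
  memLp_top_of_bound (measurable_gradient φ).aestronglyMeasurable C
    (.of_forall (norm_gradient_le_of_lipschitzWith hφ))

theorem memLp_top_inner_gradient (hφ : LipschitzWith C φ) (hX : Continuous X)
    (hXc : HasCompactSupport X) : MemLp (fun x => ⟪gradient φ x, X x⟫) ⊤ (volume.restrict Ω) :=
  (innerSL ℝ : Rn n →L[ℝ] Rn n →L[ℝ] ℝ).memLp_of_bilin ⊤
    (memLp_top_gradient_of_lipschitzWith hφ) (hX.memLp_top_of_hasCompactSupport hXc _)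

theorem setIntegral_mul_divergence_smul (hX : ContDiff ℝ 1 X) (hXc : HasCompactSupport X)
    (hXΩ : tsupport X ⊆ Ω) (hφ : LipschitzWith C φ) {w : Rn n → ℝ} (hw : ContDiff ℝ 1 w) :
    ∫ x in Ω, φ x * divergence (fun x => w x • X x) x =
      -∫ x in Ω, ⟪gradient φ x, X x⟫ * w x := by
  have hY : ContDiff ℝ 1 fun x => w x • X x := hw.smul hX
  have hYX : tsupport (fun x => w x • X x) ⊆ tsupport X :=
    closure_mono (Function.support_smul_subset_right w X)
  have hzero (x : Rn n) (hx : x ∉ Ω) : x ∉ tsupport (fun x => w x • X x) :=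
    fun h => hx (hXΩ (hYX h))
  simp only [mul_comm _ (w _), ← real_inner_smul_right]
  rw [setIntegral_eq_integral_of_forall_compl_eq_zero fun x hx => ?_,
    setIntegral_eq_integral_of_forall_compl_eq_zero fun x hx => ?_,
    integral_inner_gradient_eq_neg hφ hY (HasCompactSupport.smul_left (f := w) hXc), neg_neg]
  · rw [image_eq_zero_of_notMem_tsupport (hzero x hx), inner_zero_right]
  · rw [image_eq_zero_of_notMem_tsupport fun h => hzero x hx (tsupport_divergence_subset _ h),
      mul_zero]

theorem inner_mulMap_inner_gradient (hΩ : IsOpen Ω) (hconv : Convex ℝ Ω)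
    (hb : Bornology.IsBounded Ω) (hX : ContDiff ℝ 1 X) (hXc : HasCompactSupport X)
    (hXΩ : tsupport X ⊆ Ω) (hφ : LipschitzWith C φ) (u v : H1 Ω) :
    ⟪mulMap (volume.restrict Ω) (fun x => ⟪gradient φ x, X x⟫) u.fn, v.fn⟫ =
      -fluxForm Ω X φ u v := by
  have hφm := memLp_of_isBounded hb hφ.continuous ⊤
  have hm := memLp_top_inner_gradient (Ω := Ω) hφ hX.continuous hXc
  have hform : H1.pairing
      (mulMap (volume.restrict Ω) (fun x => ⟪gradient φ x, X x⟫) ∘L H1.fnL Ω) 0 =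
        -fluxForm Ω X φ := by
    refine H1.bilinear_ext_of_contDiff hΩ hconv hb fun ψ η hψ hη => ?_
    rw [neg_apply, neg_apply, fluxForm_ofContDiff hb hX hXc hφm hψ hη,
      setIntegral_mul_divergence_smul hX hXc hXΩ hφ (hψ.mul hη), neg_neg, H1.pairing_apply,
      zero_apply, inner_zero_left, add_zero]
    refine (inner_mulMap hm _ _).trans (integral_congr_ae ?_)
    filter_upwards [H1.coeFn_fn_ofContDiff hb hψ, H1.coeFn_fn_ofContDiff hb hη] with x hψx hηx
    change _ * ⟪(H1.ofContDiff hb hψ).fn x, _⟫ = _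
    rw [hψx, hηx, Real.inner_apply]
  have h := DFunLike.congr_fun (DFunLike.congr_fun hform u) v
  rwa [H1.pairing_apply, zero_apply, inner_zero_left, add_zero] at h

end LipschitzWeight

section PhaseProblem

variable {n : ℕ} {Ω U : Set (Rn n)} {X : Rn n → Rn n} {φ m : Rn n → ℝ}

/-- Phase functions on `Ω`, the weights interpolating between the coefficients of the outer
(`φ = 0`) and of the inner (`φ = 1`) medium; they only matter almost everywhere. -/
structure IsPhase (Ω : Set (Rn n)) (φ : Rn n → ℝ) : Prop where
  aestronglyMeasurable : AEStronglyMeasurable φ (volume.restrict Ω)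
  mem_Icc : ∀ᵐ x ∂(volume.restrict Ω), φ x ∈ Icc (0 : ℝ) 1

theorem norm_le_one_of_mem_Icc {p : ℝ} (hp : p ∈ Icc (0 : ℝ) 1) : ‖p‖ ≤ 1 := by
  rw [Real.norm_of_nonneg hp.1]
  exact hp.2

theorem min_le_add_sub_mul (s t : ℝ) {p : ℝ} (hp : p ∈ Icc (0 : ℝ) 1) :
    min s t ≤ s + (t - s) * p := by
  nlinarith [mul_nonneg (sub_nonneg.2 (min_le_left s t)) (sub_nonneg.2 hp.2),
    mul_nonneg (sub_nonneg.2 (min_le_right s t)) hp.1]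

namespace IsPhase

theorem memLp_top (hφ : IsPhase Ω φ) : MemLp φ ⊤ (volume.restrict Ω) :=
  memLp_top_of_bound hφ.aestronglyMeasurable 1 (hφ.mem_Icc.mono fun _ => norm_le_one_of_mem_Icc)

theorem memLp_top_affine (hφ : IsPhase Ω φ) (s t : ℝ) :
    MemLp (fun x => s + t * φ x) ⊤ (volume.restrict Ω) :=
  (memLp_top_const s).add (hφ.memLp_top.const_mul t)

theorem indicator (hU : MeasurableSet U) : IsPhase Ω (U.indicator fun _ => 1) where
  aestronglyMeasurable := (memLp_top_indicator_one hU).1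
  mem_Icc := .of_forall fun _ =>
    ⟨indicator_nonneg (fun _ _ => zero_le_one) _, indicator_le_self' (fun _ _ => zero_le_one) _⟩

theorem phaseField (hU : IsOpen U) {ε : ℝ} (hε : 0 < ε) : IsPhase Ω (phaseField U ε) where
  aestronglyMeasurable := (lipschitzWith_phaseField hU hε).continuous.aestronglyMeasurable
  mem_Icc := .of_forall phaseField_mem_Icc

end IsPhase

/-- The energy form with the diffusion coefficient interpolating between `α` and `1` and the
reaction coefficient interpolating between `β` and `γ` according to the phase `φ`. -/
def phaseEnergy (Ω : Set (Rn n)) (α β γ : ℝ) (φ : Rn n → ℝ) : H1 Ω →L[ℝ] H1 Ω →L[ℝ] ℝ :=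
  energy Ω (fun x => α + (1 - α) * φ x) (fun x => β + (γ - β) * φ x)

/-- The functional `v ↦ ∫_Ω (h + (q - h) φ - m g) v + ∫_Ω φ ∇·(g v X)`: the source terms together
with the boundary datum `g`, the latter split into its representation by the field `X` and a
defect of density `m`. -/
def load (Ω : Set (Rn n)) (X : Rn n → Rn n) (φ m : Rn n → ℝ) (q h : L2 Ω) (g : H1 Ω) :
    H1 Ω →L[ℝ] ℝ :=
  (innerSL ℝ (h + mulMap (volume.restrict Ω) φ (q - h) - mulMap (volume.restrict Ω) m g.fn)) ∘L
    H1.fnL Ω + fluxForm Ω X φ g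

theorem mul_sq_norm_le_phaseEnergy (hφ : IsPhase Ω φ) (α β γ : ℝ) (u : H1 Ω) :
    min (min α 1) (min β γ) * ‖u‖ ^ 2 ≤ phaseEnergy Ω α β γ φ u u := by
  refine mul_sq_norm_le_energy (hφ.memLp_top_affine _ _) (hφ.memLp_top_affine _ _) ?_ ?_ u
  · exact hφ.mem_Icc.mono fun x hx => (min_le_left _ _).trans (min_le_add_sub_mul α 1 hx)
  · exact hφ.mem_Icc.mono fun x hx => (min_le_right _ _).trans (min_le_add_sub_mul β γ hx)

theorem existsUnique_phaseEnergy_eq (hφ : IsPhase Ω φ) {α β γ : ℝ} (hα : 0 < α) (hβ : 0 < β)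
    (hγ : 0 < γ) (ℓ : H1 Ω →L[ℝ] ℝ) : ∃! u, phaseEnergy Ω α β γ φ u = ℓ :=
  existsUnique_eq_of_isCoercive ⟨min (min α 1) (min β γ), by positivity, fun u => by
    rw [mul_assoc, ← sq]
    exact mul_sq_norm_le_phaseEnergy hφ α β γ u⟩ ℓ

theorem inner_add_mulMap_sub (hφ : MemLp φ ⊤ (volume.restrict Ω)) (q h f : L2 Ω) :
    ⟪h + mulMap (volume.restrict Ω) φ (q - h), f⟫ =
      ∫ x in Ω, (h x + (q x - h x) * φ x) * f x := by
  rw [L2.inner_def]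
  refine integral_congr_ae ?_
  filter_upwards [Lp.coeFn_add h (mulMap (volume.restrict Ω) φ (q - h)), coeFn_mulMap hφ (q - h),
    Lp.coeFn_sub q h] with x hadd hmul hsub
  rw [hadd, Pi.add_apply, hmul, hsub, Pi.sub_apply, smul_eq_mul, mul_comm (φ x),
    Real.inner_apply]

theorem load_apply (hφ : MemLp φ ⊤ (volume.restrict Ω)) (m : Rn n → ℝ) (q h : L2 Ω) (g v : H1 Ω) :
    load Ω X φ m q h g v = (∫ x in Ω, (h x + (q x - h x) * φ x) * v.fn x) -
      ⟪mulMap (volume.restrict Ω) m g.fn, v.fn⟫ + fluxForm Ω X φ g v := by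
  rw [← inner_add_mulMap_sub hφ, ← inner_sub_left]
  rfl

end PhaseProblem

section SharpProblem

variable {n : ℕ} {Ω U : Set (Rn n)} {X : Rn n → Rn n}

theorem indicator_add_indicator_diff_closure {x : Rn n} (hx : x ∈ U ∨ x ∈ Ω \ closure U)
    (f h : Rn n → ℝ) :
    U.indicator f x + (Ω \ closure U).indicator h x =
      h x + (f x - h x) * U.indicator (fun _ => 1) x := by
  rcases hx with hx | hx
  · rw [indicator_of_mem hx, indicator_of_mem hx,
      indicator_of_notMem fun h => h.2 (subset_closure hx)]
    ring
  · have hxU : x ∉ U := fun h => hx.2 (subset_closure h)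
    rw [indicator_of_notMem hxU, indicator_of_notMem hxU, indicator_of_mem hx]
    ring

variable [IsFiniteMeasure (surfaceMeasure U)]

theorem ae_notMem_frontier (hn : 1 ≤ n) : ∀ᵐ x ∂(volume.restrict Ω), x ∉ frontier U :=
  ae_restrict_of_ae (measure_eq_zero_iff_ae_notMem.1 (volume_frontier_eq_zero hn))

theorem ae_mem_or_mem_diff_closure (hn : 1 ≤ n) (hU : IsOpen U) (hΩ : IsOpen Ω) :
    ∀ᵐ x ∂(volume.restrict Ω), x ∈ U ∨ x ∈ Ω \ closure U := by
  filter_upwards [ae_notMem_frontier (U := U) hn, ae_restrict_mem hΩ.measurableSet] with x hx hxΩ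
  rw [hU.frontier_eq] at hx
  by_cases hxU : x ∈ U
  · exact Or.inl hxU
  · exact Or.inr ⟨hxΩ, fun hc => hx ⟨hc, hxU⟩⟩

theorem isTwoSidedSolution_iff (hn : 1 ≤ n) (hU : IsOpen U) (hUΩ : U ⊆ Ω) (hΩ : IsOpen Ω)
    (hconv : Convex ℝ Ω) (hb : Bornology.IsBounded Ω) (hX : ContDiff ℝ 1 X)
    (hXc : HasCompactSupport X) (hnormal : ∀ y ∈ frontier U, IsNormal U y (-X y)) (α β γ : ℝ)
    (q h : L2 Ω) (g u : H1 Ω) :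
    IsTwoSidedSolution Ω U α β γ q h g u ↔
      phaseEnergy Ω α β γ (U.indicator fun _ => 1) u =
        load Ω X (U.indicator fun _ => 1) 0 q h g := by
  have hχ : IsPhase Ω (U.indicator fun _ => 1) := .indicator hU.measurableSet
  rw [ContinuousLinearMap.ext_iff]
  refine forall_congr' fun v => ?_
  have hlhs : ∫ x in Ω, (D₀ Ω U α x * ⟪u.grad x, v.grad x⟫ + c₀ Ω U β γ x * u.fn x * v.fn x) =
      phaseEnergy Ω α β γ (U.indicator fun _ => 1) u v := by
    rw [phaseEnergy, energy_apply (hχ.memLp_top_affine _ _) (hχ.memLp_top_affine _ _)]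
    refine integral_congr_ae ?_
    filter_upwards [ae_mem_or_mem_diff_closure hn hU hΩ] with x hx
    rw [D₀, c₀, indicator_add_indicator_diff_closure hx, indicator_add_indicator_diff_closure hx]
  have hrhs : ∫ x in Ω, f₀ Ω U q h x * v.fn x =
      ∫ x in Ω, (h x + (q x - h x) * U.indicator (fun _ => 1) x) * v.fn x := by
    refine integral_congr_ae ?_
    filter_upwards [ae_mem_or_mem_diff_closure hn hU hΩ] with x hx
    rw [f₀, indicator_add_indicator_diff_closure hx]
  have hzero : ⟪mulMap (volume.restrict Ω) 0 g.fn, v.fn⟫ = 0 := by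
    simp only [inner_mulMap MemLp.zero, Pi.zero_apply, zero_mul, integral_zero]
  rw [hlhs, hrhs, load_apply hχ.memLp_top, hzero, sub_zero,
    integral_trace_mul_trace hU hUΩ hΩ hconv hb hX hXc hnormal, ← sub_eq_add_neg,
    sub_eq_iff_eq_add]

end SharpProblem

section DiffuseProblem

variable {n : ℕ} {Ω U : Set (Rn n)} {X : Rn n → Rn n} {ε : ℝ}

theorem memLp_top_densityDefect (hU : IsOpen U) (hε : 0 < ε) (hX : Continuous X)
    (hXc : HasCompactSupport X) : MemLp (densityDefect U X ε) ⊤ (volume.restrict Ω) :=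
  (memLp_top_gradient_of_lipschitzWith (lipschitzWith_phaseField hU hε)).norm.sub
    (memLp_top_inner_gradient (lipschitzWith_phaseField hU hε) hX hXc)

theorem integral_mul_norm_gradient_phaseField_mul (hU : IsOpen U) (hΩ : IsOpen Ω)
    (hconv : Convex ℝ Ω) (hb : Bornology.IsBounded Ω) (hX : ContDiff ℝ 1 X)
    (hXc : HasCompactSupport X) (hXΩ : tsupport X ⊆ Ω) (hε : 0 < ε) (g v : H1 Ω) :
    ∫ x in Ω, ‖gradient (phaseField U ε) x‖ * ⟪g.fn x, v.fn x⟫ =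
      ⟪mulMap (volume.restrict Ω) (densityDefect U X ε) g.fn, v.fn⟫ -
        fluxForm Ω X (phaseField U ε) g v := by
  have hφ := lipschitzWith_phaseField hU hε
  have hinner := memLp_top_inner_gradient (Ω := Ω) hφ hX.continuous hXc
  have hdefect := memLp_top_densityDefect (Ω := Ω) hU hε hX.continuous hXc
  rw [sub_eq_add_neg, ← inner_mulMap_inner_gradient hΩ hconv hb hX hXc hXΩ hφ,
    inner_mulMap hdefect, inner_mulMap hinner,
    ← integral_add (integrable_mul_inner hdefect _ _) (integrable_mul_inner hinner _ _)]
  simp only [← add_mul, densityDefect, sub_add_cancel]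

theorem isDiffuseSolution_iff (hU : IsOpen U) (hΩ : IsOpen Ω) (hconv : Convex ℝ Ω)
    (hb : Bornology.IsBounded Ω) (hX : ContDiff ℝ 1 X) (hXc : HasCompactSupport X)
    (hXΩ : tsupport X ⊆ Ω) (hε : 0 < ε) (α β γ : ℝ) (q h : L2 Ω) (g u : H1 Ω) :
    IsDiffuseSolution Ω U α β γ q h g ε u ↔
      phaseEnergy Ω α β γ (phaseField U ε) u =
        load Ω X (phaseField U ε) (densityDefect U X ε) q h g := by
  have hφ : IsPhase Ω (phaseField U ε) := .phaseField hU hε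
  have hgrad : MemLp (fun x => ‖gradient (phaseField U ε) x‖) ⊤ (volume.restrict Ω) :=
    (memLp_top_gradient_of_lipschitzWith (lipschitzWith_phaseField hU hε)).norm
  rw [ContinuousLinearMap.ext_iff]
  refine forall_congr' fun v => ?_
  have hflux (x : Rn n) : g.fn x * ‖gradient (phaseField U ε) x‖ * v.fn x =
      ‖gradient (phaseField U ε) x‖ * ⟪g.fn x, v.fn x⟫ := by
    rw [Real.inner_apply, mul_comm (g.fn x), mul_assoc]
  have hlhs : ∫ x in Ω, (Dε U α ε x * ⟪u.grad x, v.grad x⟫ + cε U β γ ε x * u.fn x * v.fn x +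
      g.fn x * ‖gradient (phaseField U ε) x‖ * v.fn x) = phaseEnergy Ω α β γ (phaseField U ε) u v +
      ∫ x in Ω, ‖gradient (phaseField U ε) x‖ * ⟪g.fn x, v.fn x⟫ := by
    rw [phaseEnergy, energy_apply (hφ.memLp_top_affine _ _) (hφ.memLp_top_affine _ _),
      ← integral_add (integrable_energy (hφ.memLp_top_affine _ _) (hφ.memLp_top_affine _ _) _ _)
        (integrable_mul_inner hgrad _ _)]
    simp only [hflux, Dε, cε]
  rw [hlhs, integral_mul_norm_gradient_phaseField_mul hU hΩ hconv hb hX hXc hXΩ hε,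
    load_apply hφ.memLp_top]
  unfold fε
  constructor <;> intro h <;> linarith

end DiffuseProblem

section Convergence

variable {n : ℕ} {Ω : Set (Rn n)} {ι : Type*} {𝓕 : Filter ι} [𝓕.IsCountablyGenerated]
  {φ m : ι → Rn n → ℝ} {φ₀ : Rn n → ℝ} {X : Rn n → Rn n}

theorem tendsto_mulMap_add_mul {E : Type*} [NormedAddCommGroup E] [NormedSpace ℝ E]
    (hφ : ∀ᶠ i in 𝓕, IsPhase Ω (φ i)) (hφ₀ : IsPhase Ω φ₀)
    (hlim : ∀ᵐ x ∂(volume.restrict Ω), Tendsto (fun i => φ i x) 𝓕 (𝓝 (φ₀ x))) (s t : ℝ)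
    (f : Lp E 2 ((volume : Measure (Rn n)).restrict Ω)) :
    Tendsto (fun i => mulMap (volume.restrict Ω) (fun x => s + t * φ i x) f) 𝓕
      (𝓝 (mulMap (volume.restrict Ω) (fun x => s + t * φ₀ x) f)) := by
  have hbound {φ : Rn n → ℝ} (hφ : IsPhase Ω φ) :
      ∀ᵐ x ∂(volume.restrict Ω), ‖s + t * φ x‖ ≤ ‖s‖ + ‖t‖ := by
    filter_upwards [hφ.mem_Icc] with x hx
    refine norm_add_le_of_le le_rfl ?_
    rw [norm_mul]
    exact mul_le_of_le_one_right (norm_nonneg t) (norm_le_one_of_mem_Icc hx)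
  exact tendsto_weightedMap _ ENNReal.ofNat_ne_top
    (hφ.mono fun i hi => (hi.memLp_top_affine s t).1) (hφ₀.memLp_top_affine s t).1
    (hφ.mono fun i hi => hbound hi) (hbound hφ₀)
    (hlim.mono fun x hx => (hx.const_mul t).const_add s) f

theorem tendsto_phaseEnergy (hφ : ∀ᶠ i in 𝓕, IsPhase Ω (φ i)) (hφ₀ : IsPhase Ω φ₀)
    (hlim : ∀ᵐ x ∂(volume.restrict Ω), Tendsto (fun i => φ i x) 𝓕 (𝓝 (φ₀ x))) (α β γ : ℝ)
    (u : H1 Ω) :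
    Tendsto (fun i => phaseEnergy Ω α β γ (φ i) u) 𝓕 (𝓝 (phaseEnergy Ω α β γ φ₀ u)) :=
  H1.tendsto_pairing (tendsto_mulMap_add_mul hφ hφ₀ hlim _ _ _)
    (tendsto_mulMap_add_mul hφ hφ₀ hlim _ _ _)

theorem tendsto_weightedMap_smul {V E F : Type*} [NormedAddCommGroup V] [NormedSpace ℝ V]
    [NormedAddCommGroup E] [NormedSpace ℝ E] [NormedAddCommGroup F] [NormedSpace ℝ F]
    (hφ : ∀ᶠ i in 𝓕, IsPhase Ω (φ i)) (hφ₀ : IsPhase Ω φ₀)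
    (hlim : ∀ᵐ x ∂(volume.restrict Ω), Tendsto (fun i => φ i x) 𝓕 (𝓝 (φ₀ x)))
    (B : V →L[ℝ] E →L[ℝ] F) {Z : Rn n → V} (hZ : Continuous Z) (hZc : HasCompactSupport Z)
    (f : Lp E 2 ((volume : Measure (Rn n)).restrict Ω)) :
    Tendsto (fun i => weightedMap 2 (volume.restrict Ω) B (fun x => φ i x • Z x) f) 𝓕
      (𝓝 (weightedMap 2 (volume.restrict Ω) B (fun x => φ₀ x • Z x) f)) := by
  obtain ⟨A, hA⟩ := hZ.bounded_above_of_compact_support hZc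
  have hbound {φ : Rn n → ℝ} (hφ : IsPhase Ω φ) :
      ∀ᵐ x ∂(volume.restrict Ω), ‖φ x • Z x‖ ≤ A := by
    filter_upwards [hφ.mem_Icc] with x hx
    rw [norm_smul]
    exact (mul_le_of_le_one_left (norm_nonneg _) (norm_le_one_of_mem_Icc hx)).trans (hA x)
  exact tendsto_weightedMap B ENNReal.ofNat_ne_top
    (hφ.mono fun i hi => hi.aestronglyMeasurable.smul hZ.aestronglyMeasurable)
    (hφ₀.aestronglyMeasurable.smul hZ.aestronglyMeasurable) (hφ.mono fun i hi => hbound hi)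
    (hbound hφ₀) (hlim.mono fun x hx => hx.smul_const (Z x)) f

theorem tendsto_fluxForm (hφ : ∀ᶠ i in 𝓕, IsPhase Ω (φ i)) (hφ₀ : IsPhase Ω φ₀)
    (hlim : ∀ᵐ x ∂(volume.restrict Ω), Tendsto (fun i => φ i x) 𝓕 (𝓝 (φ₀ x)))
    (hX : ContDiff ℝ 1 X) (hXc : HasCompactSupport X) (u : H1 Ω) :
    Tendsto (fun i => fluxForm Ω X (φ i) u) 𝓕 (𝓝 (fluxForm Ω X φ₀ u)) :=
  H1.tendsto_pairing
    ((tendsto_weightedMap_smul hφ hφ₀ hlim _ (continuous_divergence hX)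
      (hasCompactSupport_divergence hXc) _).add
      (tendsto_weightedMap_smul hφ hφ₀ hlim _ hX.continuous hXc _))
    (tendsto_weightedMap_smul hφ hφ₀ hlim _ hX.continuous hXc _)

theorem tendsto_load (hφ : ∀ᶠ i in 𝓕, IsPhase Ω (φ i)) (hφ₀ : IsPhase Ω φ₀)
    (hlim : ∀ᵐ x ∂(volume.restrict Ω), Tendsto (fun i => φ i x) 𝓕 (𝓝 (φ₀ x)))
    (hm : ∀ᶠ i in 𝓕, AEStronglyMeasurable (m i) (volume.restrict Ω)) {C : NNReal}
    (hmC : ∀ᶠ i in 𝓕, ∀ᵐ x ∂(volume.restrict Ω), ‖m i x‖ ≤ C)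
    (hmlim : ∀ᵐ x ∂(volume.restrict Ω), Tendsto (fun i => m i x) 𝓕 (𝓝 0))
    (hX : ContDiff ℝ 1 X) (hXc : HasCompactSupport X) (q h : L2 Ω) (g : H1 Ω) :
    Tendsto (fun i => load Ω X (φ i) (m i) q h g) 𝓕 (𝓝 (load Ω X φ₀ 0 q h g)) := by
  have hsource := tendsto_mulMap_add_mul hφ hφ₀ hlim 0 1 (q - h)
  simp only [zero_add, one_mul] at hsource
  have hdefect := tendsto_weightedMap (ContinuousLinearMap.lsmul ℝ ℝ) ENNReal.ofNat_ne_top hm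
    (W₀ := 0) aestronglyMeasurable_zero hmC
    (.of_forall fun _ => norm_zero.trans_le C.coe_nonneg) hmlim g.fn
  exact ((((ContinuousLinearMap.precomp ℝ (H1.fnL Ω)) ∘L
    (innerSL ℝ : L2 Ω →L[ℝ] L2 Ω →L[ℝ] ℝ)).continuous.tendsto _).comp
      ((hsource.const_add h).sub hdefect)).add (tendsto_fluxForm hφ hφ₀ hlim hX hXc g)

theorem tendsto_of_phaseEnergy_eq {α β γ : ℝ} (hα : 0 < α) (hβ : 0 < β) (hγ : 0 < γ)
    (hφ : ∀ᶠ i in 𝓕, IsPhase Ω (φ i)) (hφ₀ : IsPhase Ω φ₀)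
    (hlim : ∀ᵐ x ∂(volume.restrict Ω), Tendsto (fun i => φ i x) 𝓕 (𝓝 (φ₀ x)))
    {ℓ : ι → H1 Ω →L[ℝ] ℝ} {ℓ₀ : H1 Ω →L[ℝ] ℝ} (hℓ : Tendsto ℓ 𝓕 (𝓝 ℓ₀)) {u : ι → H1 Ω}
    {u₀ : H1 Ω} (hu : ∀ᶠ i in 𝓕, phaseEnergy Ω α β γ (φ i) (u i) = ℓ i)
    (hu₀ : phaseEnergy Ω α β γ φ₀ u₀ = ℓ₀) : Tendsto u 𝓕 (𝓝 u₀) := by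
  refine tendsto_of_tendsto_sub_of_coercive (κ := min (min α 1) (min β γ)) (by positivity)
    (hφ.mono fun i hi => mul_sq_norm_le_phaseEnergy hi α β γ) ?_
  have h := hℓ.sub (tendsto_phaseEnergy hφ hφ₀ hlim α β γ u₀)
  rw [hu₀, sub_self] at h
  exact h.congr' (hu.mono fun i hi => by simp only [hi])

end Convergence

section SharpInterfaceLimit

theorem div_one_add_sq_le_one (t : ℝ) : t / (1 + t ^ 2) ≤ 1 := by
  rw [div_le_one (by positivity)]
  nlinarith [sq_nonneg (t - 1)]

theorem tendsto_one_div_one_add_sq_atTop : Tendsto (fun t : ℝ => 1 / (1 + t ^ 2)) atTop (𝓝 0) :=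
  tendsto_const_nhds.div_atTop (tendsto_atTop_add_const_left _ _ (tendsto_pow_atTop two_ne_zero))

theorem tendsto_div_one_add_sq_atTop : Tendsto (fun t : ℝ => t / (1 + t ^ 2)) atTop (𝓝 0) := by
  refine squeeze_zero' ?_ ?_ tendsto_inv_atTop_zero
  · filter_upwards [eventually_ge_atTop 0] with t ht using by positivity
  · filter_upwards [eventually_gt_atTop 0] with t ht
    rw [inv_eq_one_div, div_le_div_iff₀ (by positivity) ht]
    nlinarith

variable {n : ℕ} {Ω U : Set (Rn n)} {x : Rn n}

theorem tendsto_infDist_div_atTop (hne : (frontier U).Nonempty) (hx : x ∉ frontier U) :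
    Tendsto (fun ε => Metric.infDist x (frontier U) / ε) (𝓝[>] 0) atTop := by
  simp only [div_eq_mul_inv]
  exact tendsto_inv_nhdsGT_zero.const_mul_atTop
    ((isClosed_frontier.notMem_iff_infDist_pos hne).1 hx)

theorem tendsto_phaseField (hne : (frontier U).Nonempty) (hx : x ∉ frontier U) :
    Tendsto (fun ε => phaseField U ε x) (𝓝[>] 0) (𝓝 (U.indicator (fun _ => 1) x)) := by
  rw [tendsto_iff_norm_sub_tendsto_zero]
  refine squeeze_zero' (.of_forall fun _ => norm_nonneg _) ?_
    (tendsto_one_div_one_add_sq_atTop.comp (tendsto_infDist_div_atTop hne hx))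
  filter_upwards [self_mem_nhdsWithin] with ε hε using abs_phaseField_sub_indicator_le hε x

theorem tendsto_densityDefect (hU : IsOpen U) (hne : (frontier U).Nonempty) {X : Rn n → Rn n}
    {L : NNReal} (hX : LipschitzWith L X) (hnormal : ∀ y ∈ frontier U, IsNormal U y (-X y))
    (hx : x ∉ frontier U) (hd : DifferentiableAt ℝ (signedDist U) x) :
    Tendsto (fun ε => densityDefect U X ε x) (𝓝[>] 0) (𝓝 0) := by
  have h := (tendsto_div_one_add_sq_atTop.comp (tendsto_infDist_div_atTop hne hx)).const_mul (L : ℝ)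
  rw [mul_zero] at h
  refine squeeze_zero_norm' ?_ h
  filter_upwards [self_mem_nhdsWithin] with ε hε
    using abs_densityDefect_le hU hne hε hX hnormal hx hd

theorem tendsto_load_phaseField [IsFiniteMeasure (surfaceMeasure U)] (hn : 1 ≤ n) (hU : IsOpen U)
    (hne : (frontier U).Nonempty) {X : Rn n → Rn n} (hX : ContDiff ℝ 1 X)
    (hXc : HasCompactSupport X) (hnormal : ∀ y ∈ frontier U, IsNormal U y (-X y)) (q h : L2 Ω)
    (g : H1 Ω) :
    Tendsto (fun ε => load Ω X (phaseField U ε) (densityDefect U X ε) q h g) (𝓝[>] 0)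
      (𝓝 (load Ω X (U.indicator fun _ => 1) 0 q h g)) := by
  obtain ⟨L, hL⟩ := ContDiff.lipschitzWith_of_hasCompactSupport hXc hX one_ne_zero
  have hdiff : ∀ᵐ x ∂(volume.restrict Ω), DifferentiableAt ℝ (signedDist U) x :=
    ae_restrict_of_ae (lipschitzWith_signedDist hU).ae_differentiableAt
  have hfrontier : ∀ᵐ x ∂(volume.restrict Ω), x ∉ frontier U := ae_notMem_frontier hn
  refine tendsto_load (C := L) ?_ (.indicator hU.measurableSet)
    (hfrontier.mono fun x hx => tendsto_phaseField hne hx) ?_ ?_ ?_ hX hXc q h g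
  · filter_upwards [self_mem_nhdsWithin] with ε hε using .phaseField hU hε
  · filter_upwards [self_mem_nhdsWithin] with ε hε
      using (memLp_top_densityDefect hU hε hX.continuous hXc).1
  · filter_upwards [self_mem_nhdsWithin] with ε hε
    filter_upwards [hfrontier, hdiff] with x hx hd
    exact (abs_densityDefect_le hU hne hε hL hnormal hx hd).trans
      (mul_le_of_le_one_right L.coe_nonneg (div_one_add_sq_le_one _))
  · filter_upwards [hfrontier, hdiff] with x hx hd
    exact tendsto_densityDefect hU hne hL hnormal hx hd

end SharpInterfaceLimit

section Domain

variable {n : ℕ}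

theorem isOpen_cuboid (a b : Fin n → ℝ) : IsOpen (cuboid a b) := by
  simp only [cuboid, ofPred_forall, ofPred_and]
  exact isOpen_iInter_of_finite fun i =>
    (isOpen_lt continuous_const (by fun_prop)).inter (isOpen_lt (by fun_prop) continuous_const)

theorem convex_cuboid (a b : Fin n → ℝ) : Convex ℝ (cuboid a b) := by
  have h : cuboid a b = ⋂ i, (EuclideanSpace.proj i : Rn n →L[ℝ] ℝ) ⁻¹' Ioo (a i) (b i) := by
    ext x
    simp only [cuboid, mem_ofPred_eq, mem_iInter, mem_preimage, PiLp.proj_apply, mem_Ioo]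
  rw [h]
  exact convex_iInter fun i => (convex_Ioo _ _).is_linear_preimage (LinearMap.isLinear _)

theorem isBounded_cuboid (a b : Fin n → ℝ) : Bornology.IsBounded (cuboid a b) := by
  have h : cuboid a b ⊆ EuclideanSpace.equiv (Fin n) ℝ ⁻¹' Icc a b := fun x hx =>
    ⟨fun i => (hx i).1.le, fun i => (hx i).2.le⟩
  exact ((EuclideanSpace.equiv (Fin n) ℝ).antilipschitz.isBounded_preimage
    (Metric.isBounded_Icc a b)).subset h

theorem frontier_nonempty {U : Set (Rn n)} (hn : 1 ≤ n) (hne : U.Nonempty)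
    (hUb : Bornology.IsBounded U) : (frontier U).Nonempty := by
  have : Nonempty (Fin n) := ⟨⟨0, hn⟩⟩
  refine nonempty_frontier_iff.2 ⟨hne, fun h => ?_⟩
  rw [h] at hUb
  exact NormedSpace.unbounded_univ ℝ (Rn n) hUb

end Domain

end DiffuseDomain

end

open DiffuseDomain in
theorem theorem2_general {n : ℕ} (hn : 1 ≤ n) {Ω Ω₁ : Set (Rn n)} (hΩ : IsOpen Ω)
    (hconv : Convex ℝ Ω) (hb : Bornology.IsBounded Ω) (hopen : IsOpen Ω₁) (hne : Ω₁.Nonempty)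
    (hC2 : HasContDiffBoundary 2 Ω₁) (hsub : closure Ω₁ ⊆ Ω) {α β γ : ℝ} (hα : 0 < α)
    (hβ : 0 < β) (hγ : 0 < γ) (q h : L2 Ω) (g : H1 Ω) :
    (∃! u₀, IsTwoSidedSolution Ω Ω₁ α β γ q h g u₀) ∧
    (∀ ε > 0, ∃! u, IsDiffuseSolution Ω Ω₁ α β γ q h g ε u) ∧
    ∀ (u₀ : H1 Ω) (u : ℝ → H1 Ω), IsTwoSidedSolution Ω Ω₁ α β γ q h g u₀ →
      (∀ᶠ ε in 𝓝[>] 0, IsDiffuseSolution Ω Ω₁ α β γ q h g ε (u ε)) →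
      Tendsto u (𝓝[>] 0) (𝓝 u₀) := by
  have hΩ₁Ω : Ω₁ ⊆ Ω := subset_closure.trans hsub
  have hΩ₁b : Bornology.IsBounded Ω₁ := hb.subset hΩ₁Ω
  have hfrontier : (frontier Ω₁).Nonempty := frontier_nonempty hn hne hΩ₁b
  obtain ⟨X, hX, hXc, hXΩ, hnormal⟩ :=
    exists_inward_normal_field hΩ₁b hC2 hΩ (frontier_subset_closure.trans hsub)
  have : IsFiniteMeasure (surfaceMeasure Ω₁) :=
    isFiniteMeasure_surfaceMeasure hopen hΩ₁b fun y hy => ⟨_, hnormal y hy⟩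
  have hsharp := isTwoSidedSolution_iff hn hopen hΩ₁Ω hΩ hconv hb hX hXc hnormal α β γ q h g
  have hdiffuse {ε : ℝ} (hε : 0 < ε) :=
    isDiffuseSolution_iff hopen hΩ hconv hb hX hXc hXΩ hε α β γ q h g
  have hindicator : IsPhase Ω (Ω₁.indicator fun _ => 1) := .indicator hopen.measurableSet
  refine ⟨(existsUnique_congr hsharp).2 (existsUnique_phaseEnergy_eq hindicator hα hβ hγ _),
    fun ε hε => (existsUnique_congr (hdiffuse hε)).2
      (existsUnique_phaseEnergy_eq (.phaseField hopen hε) hα hβ hγ _),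
    fun u₀ u hu₀ hu => ?_⟩
  refine tendsto_of_phaseEnergy_eq hα hβ hγ ?_ hindicator
    ((ae_notMem_frontier hn).mono fun x => tendsto_phaseField hfrontier)
    (tendsto_load_phaseField hn hopen hfrontier hX hXc hnormal q h g) ?_ ((hsharp u₀).1 hu₀)
  · filter_upwards [self_mem_nhdsWithin] with ε hε using .phaseField hopen hε
  · filter_upwards [hu, self_mem_nhdsWithin] with ε hu hε using (hdiffuse hε (u ε)).1 hu

theorem theorem2 {n : ℕ} (hn : 1 ≤ n) (a b : Fin n → ℝ) (Ω₁ : Set (DiffuseDomain.Rn n))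
    (hopen : IsOpen Ω₁) (hne : Ω₁.Nonempty) (hC3 : DiffuseDomain.HasC3Boundary Ω₁)
    (hsub : closure Ω₁ ⊆ DiffuseDomain.cuboid a b)
    (α β γ : ℝ) (hα : 0 < α) (hβ : 0 < β) (hγ : 0 < γ)
    (q h : DiffuseDomain.L2 (DiffuseDomain.cuboid a b))
    (g : DiffuseDomain.H1 (DiffuseDomain.cuboid a b)) :
    (∃! u₀, DiffuseDomain.IsTwoSidedSolution (DiffuseDomain.cuboid a b) Ω₁ α β γ q h g u₀) ∧
    (∀ ε ∈ Set.Ioo (0 : ℝ) 1,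
      ∃! u, DiffuseDomain.IsDiffuseSolution (DiffuseDomain.cuboid a b) Ω₁ α β γ q h g ε u) ∧
    ∀ (u₀ : DiffuseDomain.H1 (DiffuseDomain.cuboid a b))
      (u : ℝ → DiffuseDomain.H1 (DiffuseDomain.cuboid a b)),
      DiffuseDomain.IsTwoSidedSolution (DiffuseDomain.cuboid a b) Ω₁ α β γ q h g u₀ →
      (∀ ε ∈ Set.Ioo (0 : ℝ) 1,
        DiffuseDomain.IsDiffuseSolution (DiffuseDomain.cuboid a b) Ω₁ α β γ q h g ε (u ε)) →
      ∀ ε : ℕ → ℝ, (∀ k, ε k ∈ Set.Ioo (0 : ℝ) 1) →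
        Filter.Tendsto ε Filter.atTop (nhds 0) →
        ∃ j : ℕ → ℕ, StrictMono j ∧
          Filter.Tendsto (fun k => u (ε (j k))) Filter.atTop (nhds u₀) := by
  obtain ⟨hsharp, hdiffuse, hlim⟩ := theorem2_general hn (DiffuseDomain.isOpen_cuboid a b)
    (DiffuseDomain.convex_cuboid a b) (DiffuseDomain.isBounded_cuboid a b) hopen hne
    (DiffuseDomain.HasContDiffBoundary.of_le (l := 2) (k := 3) hC3 (by norm_num)) hsub
    hα hβ hγ q h g
  refine ⟨hsharp, fun ε hε => hdiffuse ε hε.1, fun u₀ u hu₀ hu ε hε hε₀ => ⟨id, strictMono_id, ?_⟩⟩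
  have hsmall : ∀ᶠ ε : ℝ in 𝓝[>] 0, ε ∈ Ioo 0 1 := Ioo_mem_nhdsGT one_pos
  exact (hlim u₀ u hu₀ (hsmall.mono hu)).comp
    (tendsto_nhdsWithin_iff.2 ⟨hε₀, .of_forall fun k => (hε k).1⟩)
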